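/- A \emph{triangulation} $T$ with $n\ge 1$ tetrahedra consists of $n$ copies $\Delta_1,\dots,\Delta_n$ of the standard tetrahedron $\Delta$, together with a complete system of $2n$ simplicial pairings between their $4n$ triangular faces (each face lies in exactly one pairing, and is paired with a different face), such that the space obtained by gluing the $\Delta_i$ along the pairings is connected. Self-adjacencies and multiple adjacencies are allowed, and the gluing need be neither orientable nor a manifold. The \emph{dual special polyhedron} $P(T)$ is obtained as follows. In each triangular face of $\Delta$ take the $\mathsf{Y}$-shaped graph consisting of the segments from the barycentre of the face to the midpoints of its sides, and let $B\subset\Delta$ be the cone from the centre of $\Delta$ over the union of the four graphs. Then $P(T)$ is the space obtained from $n$ copies of $B$ by gluing their $\mathsf{Y}$-shaped graphs along the restrictions of the face-pairings of $T$. The manifold $D(T)$ is obtained as follows. Let $O$ be the ideal octahedron obtained from $\Delta$ by taking the convex hull of the midpoints of the six edges and removing these six points; colour white the four faces of $O$ contained in the faces of $\Delta$, and black the other four. Let $K$ be the oriented manifold obtained by mirroring $O$ in its black faces; its boundary consists of four thrice-punctured spheres, the doubles of the white faces, corresponding to the faces of $\Delta$. Each face-pairing of $T$ determines a bijection between the punctures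 of two such spheres. Then $D(T)$ is the (oriented, non-compact) $3$-manifold obtained from $n$ copies of $K$ by gluing, for each face-pairing of $T$, the two corresponding thrice-punctured spheres via the orientation-reversing homeomorphism that matches the punctures according to this bijection and is induced by the simplicial pairing (sending each copy of a white face to a copy of a white face). \textbf{Proposition.} Let $T$ be a triangulation with $n$ tetrahedra. Then $$H_1(D(T);\mathbb Z)\;\cong\;\mathbb Z^{n+1}\oplus H^2(P(T);\mathbb Z).$$ -/

import Mathlib

noncomputable section

/-! ### Triangulations -/

/-- A triangulation (in the loose sense) made of `n` tetrahedra `Δ_0, …, Δ_{n-1}`, each a copy of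
the standard tetrahedron with vertices `0, 1, 2, 3`.  Face `l` of a tetrahedron is the one opposite
to vertex `l`.  Face `l` of `Δ_i` is glued to face `perm i l l` of `Δ_(adj i l)`, and the simplicial
pairing sends each vertex `v ≠ l` of the former face to the vertex `perm i l v` of the latter.
(A bijection between the vertices of two faces extends uniquely to a permutation of
`{0, 1, 2, 3}` that sends the opposite vertex to the opposite vertex; `perm i l` is that extension.)
Every face lies in exactly one pairing and is never paired with itself, so there are `2 n` pairings;
the result of the gluing is connected, and `n` is positive. -/
structure Triangulation (n : ℕ) where
  adj : Fin n → Fin 4 → Fin n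
  perm : Fin n → Fin 4 → Equiv.Perm (Fin 4)
  /-- The partner of the partner of a face is the face itself. -/
  adj_adj : ∀ i l, adj (adj i l) (perm i l l) = i
  /-- The pairing read from the other side is the inverse simplicial map. -/
  perm_adj : ∀ i l, perm (adj i l) (perm i l l) = (perm i l)⁻¹
  /-- No face is paired with itself. -/
  ne_self : ∀ i l, (adj i l, perm i l l) ≠ (i, l)
  connected : ∀ i j, Relation.ReflTransGen (fun a b => ∃ l, adj a l = b) i j
  pos : 0 < n

/-- The space `Θ(T, B)` obtained from `n` copies of a block `B` by gluing along faces according to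
the combinatorics of `T`.  Here `face l ⊆ B` is the face of the block that corresponds to face `l` of
the tetrahedron, and `glue σ` restricts, for every `l`, to the homeomorphism from `face l` to
`face (σ l)` that the block associates to the simplicial pairing given by `σ`. -/
def Theta {n : ℕ} (T : Triangulation n) (B : Type) (face : Fin 4 → Set B)
    (glue : Equiv.Perm (Fin 4) → B → B) : Type :=
  Quot fun p q : Fin n × B =>
    ∃ l : Fin 4, p.2 ∈ face l ∧ q = (T.adj p.1 l, glue (T.perm p.1 l) p.2)

instance {n : ℕ} (T : Triangulation n) (B : Type) [TopologicalSpace B] (face : Fin 4 → Set B)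
    (glue : Equiv.Perm (Fin 4) → B → B) : TopologicalSpace (Theta T B face glue) :=
  inferInstanceAs (TopologicalSpace (Quot _))

/-- The standard tetrahedron, in barycentric coordinates. -/
abbrev Tetrahedron : Type := stdSimplex ℝ (Fin 4)

/-- The affine automorphism of the tetrahedron that sends vertex `v` to vertex `σ v`. -/
def Tetrahedron.permute (σ : Equiv.Perm (Fin 4)) (x : Tetrahedron) : Tetrahedron :=
  ⟨fun k => x.1 (σ.symm k), fun k => x.2.1 _, by
    rw [Equiv.sum_comp σ.symm x.1]; exact x.2.2⟩

/-! ### The dual special polyhedron `P(T)` -/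

/-- The cone from the centre of the tetrahedron over the union of the four `Y`-shaped graphs dual to
the triangular faces, that is, the set of the points whose largest barycentric coordinate is
attained at least twice (see `mem_spineSet_iff`). -/
def spineSet : Set (Fin 4 → ℝ) :=
  {x | x ∈ stdSimplex ℝ (Fin 4) ∧ ∃ i j, i ≠ j ∧ x i = x j ∧ ∀ k, x k ≤ x i}

/-- The `Y`-shaped graph of face `l` is the union of the segments from the barycentre of the face to
the midpoints of its three edges `{i, j}`; `spineSet` is the cone over these from the centre. -/
theorem mem_spineSet_iff (x : Fin 4 → ℝ) :
    x ∈ spineSet ↔ ∃ l i j : Fin 4, i ≠ j ∧ i ≠ l ∧ j ≠ l ∧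
      ∃ y ∈ segment ℝ (fun k => if k = l then 0 else 1 / 3)
          (fun k => if k = i ∨ k = j then 1 / 2 else 0),
        x ∈ segment ℝ (fun _ => 1 / 4) y := by
  constructor
  · rintro ⟨⟨h0, h1⟩, i, j, hij, he, hm⟩
    have key : ∀ i j : Fin 4, i ≠ j → ∃ k l : Fin 4, k ≠ l ∧ i ≠ k ∧ j ≠ k ∧ i ≠ l ∧ j ≠ l ∧
        (∀ m, m = i ∨ m = j ∨ m = k ∨ m = l) := by decide
    obtain ⟨k, l, hkl, hik, hjk, hil, hjl, hall, hle⟩ : ∃ k l : Fin 4, k ≠ l ∧ i ≠ k ∧ j ≠ k ∧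
        i ≠ l ∧ j ≠ l ∧ (∀ m, m = i ∨ m = j ∨ m = k ∨ m = l) ∧ x l ≤ x k := by
      obtain ⟨k, l, hkl, a, b, c, d, e⟩ := key i j hij
      rcases le_total (x l) (x k) with h | h
      · exact ⟨k, l, hkl, a, b, c, d, e, h⟩
      · exact ⟨l, k, hkl.symm, c, d, a, b, fun m => by have := e m; tauto, h⟩
    have hu : (Finset.univ : Finset (Fin 4)) = {i, j, k, l} := by
      ext m; simpa using hall m
    have hsum : x i + (x j + (x k + x l)) = 1 := by
      rw [← h1, hu, Finset.sum_insert (by simp [hij, hik, hil]),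
        Finset.sum_insert (by simp [hjk, hjl]), Finset.sum_pair hkl]
    have hki := hm k
    refine ⟨l, i, j, hij, hil, hjl, ?_⟩
    rcases eq_or_ne (1 - 4 * x l) 0 with hs | hs
    · refine ⟨_, left_mem_segment ℝ _ _, 1, 0, by norm_num, by norm_num, by norm_num, ?_⟩
      ext m
      rcases hall m with rfl | rfl | rfl | rfl <;> simp <;> linarith
    · have hs' : 0 < 1 - 4 * x l := lt_of_le_of_ne (by linarith) hs.symm
      refine ⟨_, ⟨3 * (x k - x l) / (1 - 4 * x l), 2 * (x i - x k) / (1 - 4 * x l),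
        div_nonneg (by linarith) hs'.le, div_nonneg (by linarith) hs'.le, ?_, rfl⟩,
        4 * x l, 1 - 4 * x l, by have := h0 l; linarith, hs'.le, by ring, ?_⟩
      · rw [← add_div, div_eq_one_iff_eq hs'.ne']; linarith
      · ext m
        rcases hall m with rfl | rfl | rfl | rfl <;>
          simp [hij, hij.symm, hik.symm, hil, hjk.symm, hjl, hkl, hil.symm, hjl.symm] <;>
          field_simp <;> linarith
  · rintro ⟨l, i, j, hij, hil, hjl, y, hy, hx⟩
    have hy' : y ∈ stdSimplex ℝ (Fin 4) := by
      refine (convex_stdSimplex ℝ (Fin 4)).segment_subset ?_ ?_ hy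
      · refine ⟨fun k => by dsimp only; split_ifs <;> norm_num, ?_⟩
        have : ∀ k : Fin 4, (if k = l then (0 : ℝ) else 1 / 3) = 1 / 3 - if k = l then 1 / 3 else 0 :=
          fun k => by split_ifs <;> norm_num
        simp only [this, Finset.sum_sub_distrib, Finset.sum_ite_eq', Finset.mem_univ, if_true]
        norm_num
      · refine ⟨fun k => by dsimp only; split_ifs <;> norm_num, ?_⟩
        have : ∀ k : Fin 4, (if k = i ∨ k = j then (1 / 2 : ℝ) else 0) =
            (if k = i then 1 / 2 else 0) + if k = j then 1 / 2 else 0 := fun k => by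
          by_cases h : k = i
          · simp [h, hij]
          · simp [h]
        simp only [this, Finset.sum_add_distrib, Finset.sum_ite_eq', Finset.mem_univ, if_true]
        norm_num
    refine ⟨(convex_stdSimplex ℝ (Fin 4)).segment_subset ?_ hy' hx, i, j, hij, ?_, ?_⟩
    · exact ⟨fun _ => by norm_num, by norm_num⟩
    all_goals
      obtain ⟨a, b, ha, hb, hab, rfl⟩ := hy
      obtain ⟨c, d, hc, hd, hcd, rfl⟩ := hx
    · simp [hil, hjl]
    · intro k
      have h1 : 0 ≤ d * a := mul_nonneg hd ha
      have h2 : 0 ≤ d * b := mul_nonneg hd hb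
      simp only [Pi.add_apply, Pi.smul_apply, smul_eq_mul, hil, if_false, true_or, if_true]
      split_ifs <;> nlinarith

/-- The block for `P(T)`. -/
abbrev Spine : Type := {x : Tetrahedron // x.1 ∈ spineSet}

/-- The faces of the block are the `Y`-shaped graphs. -/
def Spine.face (l : Fin 4) : Set Spine := {x | x.1.1 l = 0}

def Spine.glue (σ : Equiv.Perm (Fin 4)) (x : Spine) : Spine :=
  ⟨x.1.permute σ, (x.1.permute σ).2, by
    obtain ⟨-, i, j, hij, he, hm⟩ := x.2
    refine ⟨σ i, σ j, fun h => hij (σ.injective h), ?_, fun k => ?_⟩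
    · simpa [Tetrahedron.permute] using he
    · simpa [Tetrahedron.permute] using hm (σ.symm k)⟩

/-- The special polyhedron `P(T)` dual to `T`. -/
abbrev Triangulation.dualPolyhedron {n : ℕ} (T : Triangulation n) : Type :=
  Theta T Spine Spine.face Spine.glue

/-! ### The manifold `D(T)` -/

/-- The ideal octahedron: the convex hull of the six midpoints of the edges of the tetrahedron, with
these six points (its ideal vertices) removed.  It is the tetrahedron truncated at its vertices
until the edges disappear.  Its white faces are `x l = 0` and its black faces (the truncation
triangles) are `x k = 1 / 2`. -/
abbrev Octahedron : Type :=
  {x : Tetrahedron // (∀ k, x.1 k ≤ 1 / 2) ∧ ¬ ∃ i j, i ≠ j ∧ x.1 i = 1 / 2 ∧ x.1 j = 1 / 2}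

def Octahedron.permute (σ : Equiv.Perm (Fin 4)) (x : Octahedron) : Octahedron :=
  ⟨x.1.permute σ, fun k => x.2.1 (σ.symm k), by
    rintro ⟨i, j, hij, hi, hj⟩
    exact x.2.2 ⟨σ.symm i, σ.symm j, fun h => hij (σ.symm.injective h), hi, hj⟩⟩

/-- The block `K`: two copies of the octahedron, labelled by `1` and `-1`, mirrored in the black
triangles.  `K` is oriented so that the copy `1` has the orientation of the standard tetrahedron and
the mirror copy `-1` the opposite one. -/
def MirroredOctahedron : Type :=
  Quot fun p q : ℤˣ × Octahedron => p.2 = q.2 ∧ ∃ k, p.2.1.1 k = 1 / 2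

instance : TopologicalSpace MirroredOctahedron := inferInstanceAs (TopologicalSpace (Quot _))

/-- The faces of `K` are the four thrice-punctured spheres into which the white triangles glue. -/
def MirroredOctahedron.face (l : Fin 4) : Set MirroredOctahedron :=
  {z | ∃ (ε : ℤˣ) (x : Octahedron), z = Quot.mk _ (ε, x) ∧ x.1.1 l = 0}

/-- Two faces of `K` are glued by the orientation-reversing map that matches the punctures as
prescribed by `σ`.  The map induced by `σ` on the octahedron preserves the orientation (hence also
the orientations induced on the faces) if `σ` is even and reverses it if `σ` is odd, so the two mirror
copies have to be exchanged precisely if `σ` is even. -/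
def MirroredOctahedron.glue (σ : Equiv.Perm (Fin 4)) : MirroredOctahedron → MirroredOctahedron :=
  Quot.map (fun p => (-(Equiv.Perm.sign σ) * p.1, p.2.permute σ)) (by
    rintro p q ⟨h, k, hk⟩
    refine ⟨by simp only [h], σ k, ?_⟩
    simpa [Octahedron.permute, Tetrahedron.permute] using hk)

/-- The oriented manifold `D(T) = Θ(T, K)`, the orientable double of `N(T) = Θ(T, O)`. -/
abbrev Triangulation.D {n : ℕ} (T : Triangulation n) : Type :=
  Theta T MirroredOctahedron MirroredOctahedron.face MirroredOctahedron.glue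

/-! ### Singular homology and cohomology with integer coefficients -/

/-- The singular chain complex of `X` with integer coefficients. -/
abbrev singularChains (X : Type) [TopologicalSpace X] : ChainComplex (ModuleCat.{0} ℤ) ℕ :=
  ((AlgebraicTopology.singularChainComplexFunctor (ModuleCat.{0} ℤ)).obj (ModuleCat.of ℤ ℤ)).obj
    (TopCat.of X)

/-- Singular homology `H_k(X; ℤ)`. -/
abbrev singularHomology (k : ℕ) (X : Type) [TopologicalSpace X] : ModuleCat.{0} ℤ :=
  ((AlgebraicTopology.singularHomologyFunctor (ModuleCat.{0} ℤ) k).obj (ModuleCat.of ℤ ℤ)).obj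
    (TopCat.of X)

/-- Singular cohomology `H^k(X; ℤ)`: the cohomology of `Hom(C_•(X), ℤ)`. -/
abbrev singularCohomology (k : ℕ) (X : Type) [TopologicalSpace X] : ModuleCat.{0} ℤ :=
  ((singularChains X).linearYonedaObj ℤ (ModuleCat.of ℤ ℤ)).homology k

end

noncomputable section

/-! ### Singular simplices, chains and cochains -/

namespace Singular

open CategoryTheory Limits

/-! Both spaces are glued from blocks with barycentric coordinates, so their homology can be read
off open covers whose pieces contract along straight segments to one point per block and label.
Singular theory is tied to such covers by the theorem of small chains (`exists_retraction`) and by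
cones over simplices in contractible pieces (`Contracts.exists_primitive`).

For `P(T)` the cover consists of neighbourhoods of the vertices, of the edges and of the regions.
Members and pairwise intersections are contractible component by component, and the components of
the triple intersection are the flags `(i, l, k)` with `l ≠ k`: the block `i`, its edge towards face
`l`, and the sector on which the two coordinates outside `{l, k}` are largest. The Čech argument of
`Represents.exists_coboundary_eq_iff` identifies the second cohomology with `FlagClasses`. Read as a
presentation, this is the abelian group generated by flags `x (i, l, k)` that are antisymmetric in
`l, k`, have zero sum over `k`, and change sign under the face pairings (`FlagRel`).

For `D(T)` the cover consists of the interiors of the `2 n` octahedra and neighbourhoods of white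
faces, black faces and octahedron edges. A 1-cocycle with values in any group `A` has potentials on
the pieces, and their jumps are the data `w`, `b`, `e`. Let `y i k` compare the jumps at the black
face `k` of the two copies of octahedron `i`. Four octahedra meet around an octahedron edge, and
going around it shows that `y i k ± y i' (σ k)` is the same for all vertices `k` of the face `l`,
where `±` is the sign of the pairing `σ` (`Compat.sub_eq`). Now an antisymmetric 4 × 4 matrix with
zero row sums is the same thing as a function on four vertices modulo constants, through `x (l, m) =
± (y k - y k')`. Under this dictionary the edge conditions become the relation of `FlagRel` for
glued flags (`xOf_add_xOf_glueFlag`); the sign of `σ` in the two formulas is the same, because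
gluing in `D(T)` exchanges the two copies exactly when `σ` is even.

The normalization `y i 0 = 0` leaves one free potential per tetrahedron, so cocycles up to
coboundaries are homomorphisms on `FlagClasses × ℤ^(2n)` modulo those induced from `ℤ^n`. The second
factor has one generator for each face pairing. Working with all coefficient groups at once,
including `ℚ / ℤ`, yields the first homology itself: it is the kernel of the map to `ℤ^n` that is
the boundary map of the dual graph on the second factor (`nonempty_singularHomology_one_equiv_ker`).
This kernel is `FlagClasses` plus the cycles of a connected graph with `n` vertices and `2 n` edges,
which have rank `2 n - (n - 1) = n + 1`. -/

/-- The double alternating sum over two successive omissions of an index vanishes. -/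
theorem sum_sum_succAbove {M : Type*} [AddCommGroup M] {k : ℕ}
    (g : (Fin k → Fin (k + 2)) → M) :
    ∑ i : Fin (k + 2), ∑ j : Fin (k + 1), ((-1 : ℤ) ^ (i : ℕ) * (-1) ^ (j : ℕ)) •
      g (fun m => i.succAbove (j.succAbove m)) = 0 := by
  rw [← Fintype.sum_prod_type' (f := fun (i : Fin (k + 2)) (j : Fin (k + 1)) =>
    ((-1 : ℤ) ^ (i : ℕ) * (-1) ^ (j : ℕ)) • g (fun m => i.succAbove (j.succAbove m)))]
  -- The involution exchanges the two orders in which the same pair of indices can be omitted; the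
  -- two terms have opposite signs.
  refine Finset.sum_involution (fun p _ => (p.1.succAbove p.2, p.2.predAbove p.1)) ?_ ?_ ?_ ?_
  · rintro ⟨i, j⟩ -
    simp only [Fin.succAbove_succAbove_succAbove_predAbove]
    rw [← pow_add, ← pow_add, Fin.neg_one_pow_succAbove_add_predAbove, neg_smul, add_neg_cancel]
  · rintro ⟨i, j⟩ - - h
    exact Fin.succAbove_ne i j (Prod.ext_iff.1 h).1
  · simp
  · rintro ⟨i, j⟩ -
    simp [Fin.succAbove_succAbove_predAbove, Fin.predAbove_predAbove_succAbove]

/-- The singular `k`-simplices of `X`. -/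
abbrev Simplex (X : Type) [TopologicalSpace X] (k : ℕ) : Type :=
  C(stdSimplex ℝ (Fin (k + 1)), X)

/-- The integral singular `k`-chains of `X`. -/
abbrev Chain (X : Type) [TopologicalSpace X] (k : ℕ) : Type := Simplex X k →₀ ℤ

variable {X : Type} [TopologicalSpace X] {A B : Type} [AddCommGroup A] [AddCommGroup B] {k : ℕ}

/-- The map of standard simplices induced by a map of vertices. -/
def simplexMap {k m : ℕ} (f : Fin k → Fin m) : C(stdSimplex ℝ (Fin k), stdSimplex ℝ (Fin m)) :=
  ⟨stdSimplex.map f, stdSimplex.continuous_map f⟩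

theorem simplexMap_apply {k m : ℕ} (f : Fin k → Fin m) (t : stdSimplex ℝ (Fin k)) (j : Fin m) :
    (simplexMap f t).1 j = ∑ i with f i = j, t.1 i :=
  FunOnFinite.linearMap_apply_apply ℝ ℝ f _ j

theorem simplexMap_comp {k l m : ℕ} (f : Fin k → Fin l) (g : Fin l → Fin m) :
    (simplexMap g).comp (simplexMap f) = simplexMap fun i => g (f i) := by
  ext1 t
  exact stdSimplex.map_comp_apply f g t

/-- The `i`-th face of a singular simplex. -/
def face (i : Fin (k + 2)) (σ : Simplex X (k + 1)) : Simplex X k :=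
  σ.comp (simplexMap i.succAbove)

/-- The boundary map on singular chains. -/
def boundary : Chain X (k + 1) →ₗ[ℤ] Chain X k :=
  Finsupp.linearCombination ℤ fun σ =>
    ∑ i : Fin (k + 2), (-1 : ℤ) ^ (i : ℕ) • Finsupp.single (face i σ) 1

theorem boundary_single (σ : Simplex X (k + 1)) :
    boundary (Finsupp.single σ 1) =
      ∑ i : Fin (k + 2), (-1 : ℤ) ^ (i : ℕ) • Finsupp.single (face i σ) (1 : ℤ) := by
  simp [boundary]

/-- The coboundary of a singular cochain. -/
def coboundary (φ : Simplex X k → A) (σ : Simplex X (k + 1)) : A :=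
  ∑ i : Fin (k + 2), (-1 : ℤ) ^ (i : ℕ) • φ (face i σ)

/-- The evaluation of a cochain on chains. -/
def eval (φ : Simplex X k → A) : Chain X k →ₗ[ℤ] A := Finsupp.linearCombination ℤ φ

@[simp]
theorem eval_single (φ : Simplex X k → A) (σ : Simplex X k) :
    eval φ (Finsupp.single σ 1) = φ σ := by simp [eval]

theorem eval_boundary (φ : Simplex X k → A) (c : Chain X (k + 1)) :
    eval φ (boundary c) = eval (coboundary φ) c := by
  suffices eval φ ∘ₗ boundary = eval (coboundary φ) from LinearMap.congr_fun this c
  ext σ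
  simp only [LinearMap.comp_apply, Finsupp.lsingle_apply, boundary_single, map_sum, map_smul,
    eval_single, coboundary]

theorem boundary_boundary (c : Chain X (k + 2)) : boundary (boundary c) = 0 := by
  suffices boundary ∘ₗ boundary = (0 : Chain X (k + 2) →ₗ[ℤ] Chain X k) from
    LinearMap.congr_fun this c
  ext1 σ
  have h : ∀ (i : Fin (k + 3)) (j : Fin (k + 2)),
      face j (face i σ) = σ.comp (simplexMap fun m => i.succAbove (j.succAbove m)) := fun i j => by
    rw [← simplexMap_comp]; rfl
  ext1
  simp only [LinearMap.comp_apply, Finsupp.lsingle_apply, boundary_single, map_sum, map_smul,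
    LinearMap.zero_apply, Finset.smul_sum, smul_smul, h]
  exact sum_sum_succAbove fun f => Finsupp.single (σ.comp (simplexMap f)) (1 : ℤ)

theorem coboundary_coboundary (φ : Simplex X k → A) (σ : Simplex X (k + 2)) :
    coboundary (coboundary φ) σ = 0 := by
  rw [← eval_single (coboundary (coboundary φ)), ← eval_boundary, ← eval_boundary,
    boundary_boundary, map_zero]

theorem coboundary_add (φ ψ : Simplex X k → A) :
    coboundary (φ + ψ) = coboundary φ + coboundary ψ := by
  funext σ; simp [coboundary, Finset.sum_add_distrib]

theorem coboundary_sub (φ ψ : Simplex X k → A) :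
    coboundary (φ - ψ) = coboundary φ - coboundary ψ := by
  funext σ; simp [coboundary, smul_sub]

theorem coboundary_smul (r : ℤ) (φ : Simplex X k → A) :
    coboundary (r • φ) = r • coboundary φ := by
  funext σ; simp only [coboundary, Pi.smul_apply, Finset.smul_sum]
  exact Finset.sum_congr rfl fun i _ => smul_comm _ _ _

theorem coboundary_map (f : A →+ B) (φ : Simplex X k → A) (σ : Simplex X (k + 1)) :
    coboundary (fun τ => f (φ τ)) σ = f (coboundary φ σ) := by
  simp [coboundary]

theorem coboundary_congr {φ ψ : Simplex X k → A} {σ : Simplex X (k + 1)}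
    (h : ∀ i, φ (face i σ) = ψ (face i σ)) : coboundary φ σ = coboundary ψ σ := by
  simp [coboundary, h]

/-! ### Comparison with the singular homology and cohomology of Mathlib -/

/-- The inclusion of the summand of a singular simplex into the singular chain complex. -/
def inclusion (σ : Simplex X k) : ModuleCat.of ℤ ℤ ⟶ (singularChains X).X k :=
  SSet.ιChainComplex (X := TopCat.toSSet.obj (TopCat.of X))
    ((TopCat.toSSetObjEquiv (TopCat.of X) (.op ⟨k⟩)).symm σ)

theorem inclusion_d (σ : Simplex X (k + 1)) :
    inclusion σ ≫ (singularChains X).d (k + 1) k =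
      ∑ i : Fin (k + 2), (-1 : ℤ) ^ (i : ℕ) • inclusion (face i σ) := by
  refine (SSet.ιChainComplex_d _ _ _).trans ?_
  rfl

theorem singularChains_hom_ext {M : ModuleCat.{0} ℤ} {f g : (singularChains X).X k ⟶ M}
    (h : ∀ σ, inclusion σ ≫ f = inclusion σ ≫ g) : f = g := by
  refine SSet.chainComplex_hom_ext fun x => ?_
  have := h (TopCat.toSSetObjEquiv (TopCat.of X) (.op ⟨k⟩) x)
  rwa [inclusion, Equiv.symm_apply_apply] at this

/-- The comparison of Mathlib's singular chains with finitely supported functions. -/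
def toChain : (singularChains X).X k ⟶ ModuleCat.of ℤ (Chain X k) :=
  Cofan.IsColimit.desc
    (SSet.isColimitChainComplexXCofan (TopCat.toSSet.obj (TopCat.of X)) (ModuleCat.of ℤ ℤ) k)
    fun x => ModuleCat.ofHom
      (Finsupp.lsingle (TopCat.toSSetObjEquiv (TopCat.of X) (.op ⟨k⟩) x))

theorem inclusion_toChain (σ : Simplex X k) :
    inclusion σ ≫ toChain = ModuleCat.ofHom (Finsupp.lsingle σ) := by
  refine (Cofan.IsColimit.fac (SSet.isColimitChainComplexXCofan
    (TopCat.toSSet.obj (TopCat.of X)) (ModuleCat.of ℤ ℤ) k) _ _).trans ?_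
  rw [Equiv.apply_symm_apply]

theorem ofHom_linearCombination_single {R S : Type} [Ring R] (M : ModuleCat.{0} R) (v : S → M)
    (s : S) : (ModuleCat.ofHom (Finsupp.linearCombination R v)).hom (Finsupp.single s 1) = v s :=
  (Finsupp.linearCombination_single R _ _).trans (one_smul R _)

/-- The comparison of finitely supported functions with Mathlib's singular chains. -/
def ofChain : ModuleCat.of ℤ (Chain X k) ⟶ (singularChains X).X k :=
  ModuleCat.ofHom (Finsupp.linearCombination ℤ fun σ => (inclusion σ).hom 1)

theorem ofChain_single (σ : Simplex X k) :
    (ofChain (X := X)).hom (Finsupp.single σ 1) = (inclusion σ).hom 1 :=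
  ofHom_linearCombination_single _ _ σ

theorem toChain_inclusion (σ : Simplex X k) :
    (toChain (X := X)).hom ((inclusion σ).hom 1) = Finsupp.single σ 1 :=
  LinearMap.congr_fun (congrArg ModuleCat.Hom.hom (inclusion_toChain σ)) 1

/-- The identification of Mathlib's singular chains with finitely supported functions. -/
def chainIso : (singularChains X).X k ≅ ModuleCat.of ℤ (Chain X k) where
  hom := toChain
  inv := ofChain
  hom_inv_id := singularChains_hom_ext fun σ => ModuleCat.hom_ext <| LinearMap.ext_ring <|
    (congrArg (ofChain (X := X)).hom (toChain_inclusion σ)).trans (ofChain_single σ)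
  inv_hom_id := ModuleCat.hom_ext <| Finsupp.lhom_ext' fun σ => LinearMap.ext_ring <|
    (congrArg (toChain (X := X)).hom (ofChain_single σ)).trans (toChain_inclusion σ)

theorem inclusion_chainIso (σ : Simplex X k) :
    inclusion σ ≫ chainIso.hom = ModuleCat.ofHom (Finsupp.lsingle σ) :=
  inclusion_toChain σ

theorem d_chainIso : (singularChains X).d (k + 1) k ≫ chainIso.hom =
    chainIso.hom ≫ ModuleCat.ofHom boundary := by
  refine singularChains_hom_ext fun σ => ?_
  rw [← Category.assoc, inclusion_d, ← Category.assoc, inclusion_chainIso]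
  simp only [Preadditive.sum_comp, Preadditive.zsmul_comp, inclusion_chainIso]
  ext
  simp [boundary_single, -zsmul_eq_mul]

/-- The homology of a complex of modules is determined by a surjection from the cycles with the
boundaries as its kernel. -/
theorem nonempty_homology_equiv_of_ker {R : Type} [Ring R] {ι : Type} {c : ComplexShape ι}
    (K : HomologicalComplex (ModuleCat.{0} R) c) (i j l : ι) (hi : c.prev j = i) (hl : c.next j = l)
    {M : Type} [AddCommGroup M] [Module R M] (q : LinearMap.ker (K.d j l).hom →ₗ[R] M)
    (hq : Function.Surjective q) (hker : ∀ x, q x = 0 ↔ ∃ y, (K.d i j).hom y = x.1) :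
    Nonempty (K.homology j ≃ₗ[R] M) := by
  let S := K.sc' i j l
  have e₁ : K.homology j ≃ₗ[R] S.homology :=
    (ShortComplex.homologyMapIso (K.isoSc' i j l hi hl)).toLinearEquiv
  have e₂ : S.homology ≃ₗ[R] LinearMap.ker S.g.hom ⧸ LinearMap.range S.moduleCatToCycles :=
    S.moduleCatHomologyIso.toLinearEquiv
  let q' : LinearMap.ker S.g.hom →ₗ[R] M := q
  have h : LinearMap.range S.moduleCatToCycles = LinearMap.ker q' := by
    ext x
    refine Iff.trans ?_ (hker x).symm
    exact exists_congr fun y => Subtype.ext_iff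
  exact ⟨e₁.trans (e₂.trans ((Submodule.quotEquivOfEq _ _ h).trans
    (q'.quotKerEquivOfSurjective hq)))⟩

theorem nonempty_homology_equiv {R : Type} [Ring R] {ι : Type} {c : ComplexShape ι}
    (K : HomologicalComplex (ModuleCat.{0} R) c) (i j l : ι) (hi : c.prev j = i) (hl : c.next j = l)
    {M : Type} [AddCommGroup M] [Module R M] (q : K.X j →ₗ[R] M)
    (hq : ∀ m, ∃ x, (K.d j l).hom x = 0 ∧ q x = m)
    (hker : ∀ x, (K.d j l).hom x = 0 → (q x = 0 ↔ ∃ y, (K.d i j).hom y = x)) :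
    Nonempty (K.homology j ≃ₗ[R] M) :=
  nonempty_homology_equiv_of_ker K i j l hi hl (q ∘ₗ (LinearMap.ker _).subtype)
    (fun m => by obtain ⟨x, hx, rfl⟩ := hq m; exact ⟨⟨x, hx⟩, rfl⟩) fun x => hker x.1 x.2

/-- The homology of a complex of modules is determined by a linear relation between cycles and a
module of invariants. -/
theorem nonempty_homology_equiv_of_rel {R : Type} [Ring R] {ι : Type} {c : ComplexShape ι}
    (K : HomologicalComplex (ModuleCat.{0} R) c) (i j l : ι) (hi : c.prev j = i) (hl : c.next j = l)
    {L M : Type} [AddCommGroup L] [Module R L] [AddCommGroup M] [Module R M] (p : L →ₗ[R] M)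
    (hp : Function.Surjective p) (rel : K.X j → L → Prop)
    (hadd : ∀ x y f g, rel x f → rel y g → rel (x + y) (f + g))
    (hsmul : ∀ (r : R) x f, rel x f → rel (r • x) (r • f))
    (h₁ : ∀ x, (K.d j l).hom x = 0 → ∃ f, rel x f) (h₂ : ∀ f, ∃ x, (K.d j l).hom x = 0 ∧ rel x f)
    (h₃ : ∀ x f, (K.d j l).hom x = 0 → rel x f → (p f = 0 ↔ ∃ y, (K.d i j).hom y = x)) :
    Nonempty (K.homology j ≃ₗ[R] M) := by
  have hsub : ∀ x y f g, rel x f → rel y g → rel (x - y) (f - g) := fun x y f g hf hg => by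
    have := hadd x ((-1 : R) • y) f ((-1 : R) • g) hf (hsmul _ _ _ hg)
    rwa [neg_one_smul, neg_one_smul, ← sub_eq_add_neg, ← sub_eq_add_neg] at this
  -- Two invariants of one cycle differ by an invariant of the zero cycle, which `p` kills by `h₃`.
  have huniq : ∀ x f g, rel x f → rel x g → p f = p g := fun x f g hf hg =>
    sub_eq_zero.1 ((map_sub p f g).symm.trans ((h₃ (x - x) (f - g) (by rw [sub_self, map_zero])
      (hsub _ _ _ _ hf hg)).2 ⟨0, by rw [map_zero, sub_self]⟩))
  choose F hF using h₁
  let q : LinearMap.ker (K.d j l).hom →ₗ[R] M :=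
    { toFun := fun x => p (F x.1 x.2)
      map_add' := fun x y => (huniq _ _ _ (hF _ (x + y).2)
        (hadd _ _ _ _ (hF _ x.2) (hF _ y.2))).trans (map_add p _ _)
      map_smul' := fun r x => (huniq _ _ _ (hF _ (r • x).2)
        (hsmul r _ _ (hF _ x.2))).trans (map_smul p r _) }
  refine nonempty_homology_equiv_of_ker K i j l hi hl q (fun m => ?_) fun x => ?_
  · obtain ⟨f, rfl⟩ := hp m
    obtain ⟨x, hx, hf⟩ := h₂ f
    exact ⟨⟨x, hx⟩, huniq _ _ _ (hF x hx) hf⟩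
  · exact h₃ _ _ x.2 (hF _ x.2)

/-- The homomorphism `q` is defined on all chains, but only its values on cycles matter. -/
theorem nonempty_singularHomology_one_equiv {M : Type} [AddCommGroup M] [Module ℤ M]
    (q : Chain X 1 →ₗ[ℤ] M) (hq : ∀ m, ∃ c, boundary c = 0 ∧ q c = m)
    (hker : ∀ c, boundary c = 0 → (q c = 0 ↔ ∃ b, boundary b = c)) :
    Nonempty (singularHomology 1 X ≃ₗ[ℤ] M) := by
  have hd : ∀ (k : ℕ) x, boundary ((chainIso (X := X) (k := k + 1)).hom.hom x) =
      chainIso.hom.hom (((singularChains X).d (k + 1) k).hom x) := fun k x =>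
    (LinearMap.congr_fun (congrArg ModuleCat.Hom.hom (d_chainIso (X := X) (k := k))) x).symm
  have hinj : ∀ k, Function.Injective (chainIso (X := X) (k := k)).hom.hom := fun k =>
    (chainIso (X := X) (k := k)).toLinearEquiv.injective
  have hsurj : ∀ k, Function.Surjective (chainIso (X := X) (k := k)).hom.hom := fun k =>
    (chainIso (X := X) (k := k)).toLinearEquiv.surjective
  refine nonempty_homology_equiv (singularChains X) 2 1 0 (by simp) (by simp)
    (q ∘ₗ chainIso.hom.hom) (fun m => ?_) fun x hx => ?_
  · obtain ⟨c, hc, rfl⟩ := hq m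
    obtain ⟨x, rfl⟩ := hsurj 1 c
    exact ⟨x, hinj 0 (by rw [← hd, hc, map_zero]), rfl⟩
  · refine (hker _ ?_).trans ⟨?_, ?_⟩
    · rw [hd, hx, map_zero]
    · rintro ⟨b, hb⟩
      obtain ⟨y, rfl⟩ := hsurj 2 b
      exact ⟨y, hinj 1 (by rw [← hd, hb])⟩
    · rintro ⟨y, hy⟩
      exact ⟨chainIso.hom.hom y, by rw [hd, hy]⟩

/-- The cochain of a linear functional on Mathlib's singular chains. -/
def cochain (f : (singularChains X).X k ⟶ ModuleCat.of ℤ ℤ) (σ : Simplex X k) : ℤ :=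
  (inclusion σ ≫ f).hom 1

theorem cochain_injective : Function.Injective (cochain (X := X) (k := k)) := fun _ _ h =>
  singularChains_hom_ext fun σ => ModuleCat.hom_ext (LinearMap.ext_ring (congrFun h σ))

theorem cochain_surjective : Function.Surjective (cochain (X := X) (k := k)) := fun φ =>
  ⟨chainIso.hom ≫ ModuleCat.ofHom (eval φ), by
    funext σ
    rw [cochain, ← Category.assoc, inclusion_chainIso]
    exact eval_single φ σ⟩

theorem cochain_d (f : (singularChains X).X k ⟶ ModuleCat.of ℤ ℤ) :
    cochain ((singularChains X).d (k + 1) k ≫ f) = coboundary (cochain f) := by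
  funext σ
  rw [cochain, ← Category.assoc, inclusion_d, Preadditive.sum_comp]
  simp [coboundary, cochain, -zsmul_eq_mul]

/-- A relation replaces a map from cocycles because the invariant of a cocycle depends on choices of
local primitives; it becomes well defined only after applying `p`. -/
theorem nonempty_singularCohomology_two_equiv {L M : Type} [AddCommGroup L]
    [AddCommGroup M] [Module ℤ M] (p : L →ₗ[ℤ] M) (hp : Function.Surjective p)
    (rel : (Simplex X 2 → ℤ) → L → Prop)
    (hadd : ∀ x y f g, rel x f → rel y g → rel (x + y) (f + g))
    (hsmul : ∀ (r : ℤ) x f, rel x f → rel (r • x) (r • f))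
    (h₁ : ∀ φ, coboundary φ = 0 → ∃ f, rel φ f) (h₂ : ∀ f, ∃ φ, coboundary φ = 0 ∧ rel φ f)
    (h₃ : ∀ φ f, coboundary φ = 0 → rel φ f → (p f = 0 ↔ ∃ ψ, coboundary ψ = φ)) :
    Nonempty (singularCohomology 2 X ≃ₗ[ℤ] M) := by
  let K := (singularChains X).linearYonedaObj ℤ (ModuleCat.of ℤ ℤ)
  let C (k : ℕ) : K.X k →ₗ[ℤ] (Simplex X k → ℤ) :=
    { toFun := cochain
      map_add' := fun _ _ => rfl
      map_smul' := fun _ _ => rfl }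
  have hd : ∀ (k : ℕ) (f : K.X k), C (k + 1) ((K.d k (k + 1)).hom f) = coboundary (C k f) :=
    fun k f => cochain_d f
  have hd0 : ∀ (k : ℕ) (f : K.X k), (K.d k (k + 1)).hom f = 0 ↔ coboundary (C k f) = 0 :=
    fun k f => ⟨fun h => by rw [← hd, h, map_zero],
      fun h => cochain_injective ((hd k f).trans h)⟩
  refine nonempty_homology_equiv_of_rel K 1 2 3 (by simp) (by simp) p hp (fun x f => rel (C 2 x) f)
    (fun x y f g hf hg => ?_) (fun r x f hf => ?_) (fun x hx => h₁ _ ((hd0 2 x).1 hx))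
    (fun f => ?_) fun x f hx hf => (h₃ _ _ ((hd0 2 x).1 hx) hf).trans ⟨?_, ?_⟩
  · rw [map_add]; exact hadd _ _ _ _ hf hg
  · rw [map_smul]; exact hsmul _ _ _ hf
  · obtain ⟨φ, hφ, hf⟩ := h₂ f
    obtain ⟨x, rfl⟩ := cochain_surjective φ
    exact ⟨x, (hd0 2 x).2 hφ, hf⟩
  · rintro ⟨ψ, hψ⟩
    obtain ⟨g, rfl⟩ := cochain_surjective ψ
    exact ⟨g, cochain_injective ((hd 1 g).trans hψ)⟩
  · rintro ⟨g, hg⟩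
    exact ⟨C 1 g, by rw [← hd, hg]⟩

end Singular

/-! ### Barycentric subdivision -/

namespace Singular

/-- The affine map of standard simplices with prescribed images of the vertices. -/
def comb {m N : ℕ} (v : Fin m → stdSimplex ℝ (Fin N)) :
    C(stdSimplex ℝ (Fin m), stdSimplex ℝ (Fin N)) where
  toFun t := ⟨fun j => ∑ i, t.1 i * (v i).1 j,
    fun j => Finset.sum_nonneg fun i _ => mul_nonneg (t.2.1 i) ((v i).2.1 j), by
      rw [Finset.sum_comm, ← t.2.2]
      exact Finset.sum_congr rfl fun i _ => by rw [← Finset.mul_sum, (v i).2.2, mul_one]⟩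
  continuous_toFun := by
    refine Continuous.subtype_mk (continuous_pi fun j => continuous_finsetSum _ fun i _ => ?_) _
    exact ((continuous_apply i).comp continuous_subtype_val).mul continuous_const

section comb

variable {l m N : ℕ}

theorem comb_apply (v : Fin m → stdSimplex ℝ (Fin N)) (t : stdSimplex ℝ (Fin m)) (j : Fin N) :
    (comb v t).1 j = ∑ i, t.1 i * (v i).1 j := rfl

theorem comb_val (v : Fin m → stdSimplex ℝ (Fin N)) (t : stdSimplex ℝ (Fin m)) :
    (comb v t).1 = ∑ i, t.1 i • (v i).1 := by
  ext j; simp [comb_apply]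

theorem comb_comb (w : Fin m → stdSimplex ℝ (Fin N)) (v : Fin l → stdSimplex ℝ (Fin m))
    (t : stdSimplex ℝ (Fin l)) : comb w (comb v t) = comb (fun i => comb w (v i)) t := by
  refine Subtype.ext (funext fun j => ?_)
  simp only [comb_apply, Finset.sum_mul, Finset.mul_sum]
  rw [Finset.sum_comm]
  exact Finset.sum_congr rfl fun i _ => Finset.sum_congr rfl fun k _ => mul_assoc _ _ _

theorem comb_simplexMap (v : Fin m → stdSimplex ℝ (Fin N)) (f : Fin l → Fin m) :
    (comb v).comp (simplexMap f) = comb fun i => v (f i) := by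
  ext1 t
  refine Subtype.ext (funext fun j => ?_)
  simp only [ContinuousMap.comp_apply, comb_apply, simplexMap_apply, Finset.sum_mul]
  rw [← Finset.sum_fiberwise (s := Finset.univ) (g := f)]
  refine Finset.sum_congr rfl fun i _ => Finset.sum_congr rfl fun k hk => ?_
  rw [(Finset.mem_filter.1 hk).2]

theorem comb_vertex (v : Fin m → stdSimplex ℝ (Fin N)) (i : Fin m) :
    comb v (stdSimplex.vertex i) = v i := by
  refine Subtype.ext (funext fun j => ?_)
  simp [comb_apply, Pi.single_apply]

theorem comb_vertices : comb (fun i : Fin N => stdSimplex.vertex i) = ContinuousMap.id _ := by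
  ext1 t
  refine Subtype.ext (funext fun j => ?_)
  simp [comb_apply, Pi.single_apply]

end comb

/-- Chains of `m`-tuples of points of a standard simplex. -/
abbrev TupleChain (N m : ℕ) : Type := (Fin m → stdSimplex ℝ (Fin N)) →₀ ℤ

/-! ### Subdivision of affine simplices -/

namespace TupleChain

variable {N M m : ℕ}

/-- The alternating sum of the omissions of an entry. -/
def bd : TupleChain N (m + 1) →ₗ[ℤ] TupleChain N m :=
  Finsupp.linearCombination ℤ fun v =>
    ∑ i : Fin (m + 1), (-1 : ℤ) ^ (i : ℕ) • Finsupp.single (fun j => v (i.succAbove j)) 1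

theorem bd_single (v : Fin (m + 1) → stdSimplex ℝ (Fin N)) :
    bd (Finsupp.single v 1) =
      ∑ i : Fin (m + 1), (-1 : ℤ) ^ (i : ℕ) • Finsupp.single (fun j => v (i.succAbove j)) 1 := by
  simp [bd]

theorem bd_bd (c : TupleChain N (m + 2)) : bd (bd c) = 0 := by
  suffices bd ∘ₗ bd = (0 : TupleChain N (m + 2) →ₗ[ℤ] TupleChain N m) from
    LinearMap.congr_fun this c
  ext1 v
  ext1
  simp only [LinearMap.comp_apply, Finsupp.lsingle_apply, bd_single, map_sum, map_smul,
    LinearMap.zero_apply, Finset.smul_sum, smul_smul]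
  exact sum_sum_succAbove fun f => Finsupp.single (fun m => v (f m)) (1 : ℤ)

/-- The cone with a given apex. -/
def cone (b : stdSimplex ℝ (Fin N)) : TupleChain N m →ₗ[ℤ] TupleChain N (m + 1) :=
  Finsupp.lmapDomain ℤ ℤ fun v => Fin.cons b v

theorem cone_single (b : stdSimplex ℝ (Fin N)) (v : Fin m → stdSimplex ℝ (Fin N)) :
    cone b (Finsupp.single v 1) = Finsupp.single (Fin.cons b v : Fin (m + 1) → _) 1 := by
  simp [cone]

/-- The index counts entries, so `TupleChain N 0` is spanned by the empty tuple and serves as the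
augmentation. The cone contracts the augmented complex, and in this lowest degree the second term of
`bd_cone` is absent. -/
theorem bd_cone_zero (b : stdSimplex ℝ (Fin N)) (c : TupleChain N 0) : bd (cone b c) = c := by
  suffices bd ∘ₗ cone b = (LinearMap.id : TupleChain N 0 →ₗ[ℤ] _) from LinearMap.congr_fun this c
  ext1 v
  ext1
  simp only [LinearMap.comp_apply, Finsupp.lsingle_apply, cone_single, bd_single]
  simp

theorem bd_cone (b : stdSimplex ℝ (Fin N)) (c : TupleChain N (m + 1)) :
    bd (cone b c) = c - cone b (bd c) := by
  suffices bd ∘ₗ cone b = (LinearMap.id : TupleChain N (m + 1) →ₗ[ℤ] _) - cone b ∘ₗ bd from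
    LinearMap.congr_fun this c
  ext1 v
  ext1
  have h : ∀ i : Fin (m + 1), (fun j => (Fin.cons b v : Fin (m + 2) → _) (i.succ.succAbove j)) =
      Fin.cons b fun j => v (i.succAbove j) := fun i => by
    funext j
    refine Fin.cases ?_ (fun j => ?_) j <;> simp
  simp only [LinearMap.comp_apply, Finsupp.lsingle_apply, cone_single, bd_single,
    LinearMap.sub_apply, LinearMap.id_apply, map_sum, map_smul]
  rw [Fin.sum_univ_succ, sub_eq_add_neg, ← Finset.sum_neg_distrib]
  simp only [h]
  simp [pow_succ]

/-- The barycentre of a tuple. -/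
def bary (v : Fin (m + 1) → stdSimplex ℝ (Fin N)) : stdSimplex ℝ (Fin N) :=
  comb v stdSimplex.barycenter

/-- Barycentric subdivision. -/
def sd : (m : ℕ) → TupleChain N m →ₗ[ℤ] TupleChain N m
  | 0 => LinearMap.id
  | m + 1 => Finsupp.linearCombination ℤ fun v => cone (bary v) (sd m (bd (Finsupp.single v 1)))

/-- The chain homotopy from the identity to barycentric subdivision. -/
def htpy : (m : ℕ) → TupleChain N m →ₗ[ℤ] TupleChain N (m + 1)
  | 0 => 0
  | m + 1 => Finsupp.linearCombination ℤ fun v =>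
      cone (bary v) (Finsupp.single v 1 - htpy m (bd (Finsupp.single v 1)))

theorem sd_single (v : Fin (m + 1) → stdSimplex ℝ (Fin N)) :
    sd (m + 1) (Finsupp.single v 1) = cone (bary v) (sd m (bd (Finsupp.single v 1))) := by
  simp [sd]

theorem htpy_single (v : Fin (m + 1) → stdSimplex ℝ (Fin N)) :
    htpy (m + 1) (Finsupp.single v 1) =
      cone (bary v) (Finsupp.single v 1 - htpy m (bd (Finsupp.single v 1))) := by
  simp [htpy]

theorem bd_sd : ∀ (m : ℕ) (c : TupleChain N (m + 1)), bd (sd (m + 1) c) = sd m (bd c)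
  | 0, c => by
    suffices bd ∘ₗ sd 1 = sd 0 ∘ₗ (bd : TupleChain N 1 →ₗ[ℤ] _) from LinearMap.congr_fun this c
    ext1 v
    ext1
    simp only [LinearMap.comp_apply, Finsupp.lsingle_apply, sd_single, bd_cone_zero]
  | m + 1, c => by
    suffices bd ∘ₗ sd (m + 2) = sd (m + 1) ∘ₗ (bd : TupleChain N (m + 2) →ₗ[ℤ] _) from
      LinearMap.congr_fun this c
    ext1 v
    ext1
    simp only [LinearMap.comp_apply, Finsupp.lsingle_apply]
    rw [sd_single, bd_cone, bd_sd m, bd_bd, map_zero, map_zero, sub_zero]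

theorem bd_htpy : ∀ (m : ℕ) (c : TupleChain N (m + 1)),
    bd (htpy (m + 1) c) + htpy m (bd c) = c - sd (m + 1) c
  | m, c => by
    suffices bd ∘ₗ htpy (m + 1) + htpy m ∘ₗ bd =
      (LinearMap.id : TupleChain N (m + 1) →ₗ[ℤ] _) - sd (m + 1) from LinearMap.congr_fun this c
    ext1 v
    ext1
    simp only [LinearMap.comp_apply, Finsupp.lsingle_apply, LinearMap.add_apply,
      LinearMap.sub_apply, LinearMap.id_apply]
    rw [htpy_single, bd_cone, sd_single]
    -- This is the homotopy formula one degree lower, applied to a cycle. In the lowest degree it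
    -- holds since `htpy 0` is zero and `sd 0` is the identity.
    have key : bd (htpy m (bd (Finsupp.single v 1))) =
        bd (Finsupp.single v 1) - sd m (bd (Finsupp.single v 1)) := by
      cases m with
      | zero => simp [htpy, sd]
      | succ m =>
        have := bd_htpy m (bd (Finsupp.single v 1))
        rwa [bd_bd, map_zero, add_zero] at this
    rw [map_sub bd, key]
    abel_nf

/-- The effect of an affine map on chains of tuples. -/
def push (w : Fin M → stdSimplex ℝ (Fin N)) : TupleChain M m →ₗ[ℤ] TupleChain N m :=
  Finsupp.lmapDomain ℤ ℤ fun v j => comb w (v j)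

theorem push_single (w : Fin M → stdSimplex ℝ (Fin N)) (v : Fin m → stdSimplex ℝ (Fin M)) :
    push w (Finsupp.single v 1) = Finsupp.single (fun j => comb w (v j)) 1 := by
  simp [push]

theorem push_bd (w : Fin M → stdSimplex ℝ (Fin N)) (c : TupleChain M (m + 1)) :
    push w (bd c) = bd (push w c) := by
  suffices push w ∘ₗ bd = bd ∘ₗ push w from LinearMap.congr_fun this c
  ext1 v
  ext1
  simp only [LinearMap.comp_apply, Finsupp.lsingle_apply, push_single, bd_single, map_sum, map_smul]

theorem push_cone (w : Fin M → stdSimplex ℝ (Fin N)) (b : stdSimplex ℝ (Fin M))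
    (c : TupleChain M m) : push w (cone b c) = cone (comb w b) (push w c) := by
  suffices push w ∘ₗ cone b = cone (comb w b) ∘ₗ push w from LinearMap.congr_fun this c
  ext1 v
  ext1
  simp only [LinearMap.comp_apply, Finsupp.lsingle_apply, push_single, cone_single]
  congr 1
  funext j
  refine Fin.cases ?_ (fun j => ?_) j <;> simp

theorem comb_bary (w : Fin M → stdSimplex ℝ (Fin N)) (v : Fin (m + 1) → stdSimplex ℝ (Fin M)) :
    comb w (bary v) = bary fun j => comb w (v j) :=
  comb_comb _ _ _

/-- Affine maps preserve barycentres and cones, hence the whole recursion. This naturality makes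
subdivision of singular simplices compatible with faces. -/
theorem push_sd (w : Fin M → stdSimplex ℝ (Fin N)) : ∀ (m : ℕ) (c : TupleChain M m),
    push w (sd m c) = sd m (push w c)
  | 0, c => rfl
  | m + 1, c => by
    suffices push w ∘ₗ sd (m + 1) = sd (m + 1) ∘ₗ push w from LinearMap.congr_fun this c
    ext1 v
    ext1
    simp only [LinearMap.comp_apply, Finsupp.lsingle_apply]
    rw [sd_single, push_cone, push_sd, push_bd, push_single, sd_single, comb_bary]

theorem push_htpy (w : Fin M → stdSimplex ℝ (Fin N)) : ∀ (m : ℕ) (c : TupleChain M m),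
    push w (htpy m c) = htpy m (push w c)
  | 0, c => by simp [htpy]
  | m + 1, c => by
    suffices push w ∘ₗ htpy (m + 1) = htpy (m + 1) ∘ₗ push w from LinearMap.congr_fun this c
    ext1 v
    ext1
    simp only [LinearMap.comp_apply, Finsupp.lsingle_apply]
    rw [htpy_single, push_cone, map_sub, push_htpy, push_bd, push_single, htpy_single, comb_bary]

end TupleChain

theorem mem_supported_of_single {α β : Type} {s : Set α} {t : Set β}
    (L : (α →₀ ℤ) →ₗ[ℤ] (β →₀ ℤ))
    (h : ∀ a ∈ s, L (Finsupp.single a 1) ∈ Finsupp.supported ℤ ℤ t) {c : α →₀ ℤ}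
    (hc : c ∈ Finsupp.supported ℤ ℤ s) : L c ∈ Finsupp.supported ℤ ℤ t := by
  rw [Finsupp.supported_eq_span_single] at hc
  refine (Submodule.span_le (p := (Finsupp.supported ℤ ℤ t).comap L)).2 ?_ hc
  rintro _ ⟨a, ha, rfl⟩
  exact h a ha

theorem lmapDomain_mem_supported {α β : Type} {s : Set α} {t : Set β} (f : α → β)
    (h : ∀ a ∈ s, f a ∈ t) {c : α →₀ ℤ} (hc : c ∈ Finsupp.supported ℤ ℤ s) :
    Finsupp.lmapDomain ℤ ℤ f c ∈ Finsupp.supported ℤ ℤ t :=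
  mem_supported_of_single _ (fun a ha => by
    simpa using Finsupp.single_mem_supported ℤ (1 : ℤ) (h a ha)) hc

end Singular

namespace Singular

open TupleChain

/-! ### The mesh of barycentric subdivisions -/

section mesh

variable {N m : ℕ}

/-- The contraction factor of the barycentric subdivision of `m`-tuples. -/
def meshFactor (m : ℕ) : ℝ := 1 - 1 / m

/-- Positivity of `l` is needed: since `1 / 0 = 0`, the factor for `0` is `1`. -/
theorem meshFactor_mono {l m : ℕ} (h : l ≤ m) (hl : 0 < l) : meshFactor l ≤ meshFactor m := by
  have : (0 : ℝ) < l := by exact_mod_cast hl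
  have h' : (l : ℝ) ≤ m := by exact_mod_cast h
  exact sub_le_sub_left (one_div_le_one_div_of_le this h') 1

theorem meshFactor_nonneg (m : ℕ) : 0 ≤ meshFactor m := by
  rcases Nat.eq_zero_or_pos m with rfl | h
  · simp [meshFactor]
  · have : (1 : ℝ) ≤ m := by exact_mod_cast h
    exact sub_nonneg.2 ((div_le_one (by linarith)).2 this)

theorem meshFactor_lt_one {m : ℕ} (h : 0 < m) : meshFactor m < 1 := by
  have : (0 : ℝ) < m := by exact_mod_cast h
  exact sub_lt_self 1 (by positivity)

/-- Closed balls are convex. -/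
theorem dist_comb_le (v : Fin m → stdSimplex ℝ (Fin N)) (p : stdSimplex ℝ (Fin N)) {d : ℝ}
    (h : ∀ i, dist (v i) p ≤ d) (t : stdSimplex ℝ (Fin m)) : dist (comb v t) p ≤ d := by
  have := (convex_closedBall p.1 d).sum_mem (t := Finset.univ) (w := t.1) (z := fun i => (v i).1)
    (fun i _ => t.2.1 i) t.2.2 (fun i _ => Metric.mem_closedBall.2 (h i))
  rw [← comb_val] at this
  exact this

/-- The vector from the barycentre to `v i` is the mean of the `m + 1` differences `v i - v j`, one
of which vanishes; the others contribute at most `d` each. -/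
theorem dist_bary_le (v : Fin (m + 1) → stdSimplex ℝ (Fin N)) {d : ℝ}
    (h : ∀ i j, dist (v i) (v j) ≤ d) (i : Fin (m + 1)) :
    dist (v i) (bary v) ≤ meshFactor (m + 1) * d := by
  have hb : (bary v).1 = ∑ j, (1 / ((m + 1 : ℕ) : ℝ)) • (v j).1 := by
    rw [bary, comb_val]
    refine Finset.sum_congr rfl fun j _ => ?_
    rw [stdSimplex.barycenter_apply, Fintype.card_fin, one_div]
  have hm : (0 : ℝ) < ((m + 1 : ℕ) : ℝ) := by positivity
  have h1 : (v i).1 - (bary v).1 = ∑ j, (1 / ((m + 1 : ℕ) : ℝ)) • ((v i).1 - (v j).1) := by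
    rw [hb]
    simp only [smul_sub, Finset.sum_sub_distrib, Finset.sum_const, Finset.card_univ,
      Fintype.card_fin]
    rw [← Nat.cast_smul_eq_nsmul ℝ, smul_smul, mul_one_div_cancel hm.ne', one_smul]
  have h2 : dist (v i) (bary v) = ‖(v i).1 - (bary v).1‖ := dist_eq_norm (v i).1 (bary v).1
  rw [h2, h1]
  refine (norm_sum_le _ _).trans ?_
  rw [← Finset.add_sum_erase _ _ (Finset.mem_univ i), sub_self, smul_zero, norm_zero, zero_add]
  refine (Finset.sum_le_sum (g := fun _ => (1 / ((m + 1 : ℕ) : ℝ)) * d) fun j _ => ?_).trans ?_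
  · rw [norm_smul, Real.norm_of_nonneg (by positivity)]
    exact mul_le_mul_of_nonneg_left ((dist_eq_norm (v i).1 (v j).1).symm.le.trans (h i j))
      (by positivity)
  · rw [Finset.sum_const, Finset.card_erase_of_mem (Finset.mem_univ i), Finset.card_univ,
      Fintype.card_fin, nsmul_eq_mul, meshFactor]
    apply le_of_eq
    push_cast [Nat.add_sub_cancel]
    field_simp
    ring

/-- The tuples whose entries have mutual distance at most `d`. -/
def meshLE (N m : ℕ) (d : ℝ) : Set (Fin m → stdSimplex ℝ (Fin N)) :=
  {v | ∀ i j, dist (v i) (v j) ≤ d}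

/-- Distances within the base of a cone are controlled by induction, distances to the apex by
`dist_bary_le`. The second set records that all entries stay in the convex hull of `v`, which is
what the estimate at the apex needs. -/
theorem sd_single_mem (m : ℕ) (v : Fin m → stdSimplex ℝ (Fin N)) {d : ℝ} (hv : v ∈ meshLE N m d) :
    sd m (Finsupp.single v 1) ∈ Finsupp.supported ℤ ℤ
      (meshLE N m (meshFactor m * d) ∩ {u | ∀ i, u i ∈ Set.range (comb v)}) := by
  induction m with
  | zero =>
    exact Finsupp.single_mem_supported ℤ _ ⟨fun i => i.elim0, fun i => i.elim0⟩
  | succ m ih =>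
    rw [sd_single, bd_single, map_sum, map_sum]
    refine Submodule.sum_mem _ fun i _ => ?_
    rw [map_smul, map_smul]
    refine Submodule.smul_mem _ _ ?_
    refine lmapDomain_mem_supported _ ?_ (ih (fun j => v (i.succAbove j)) fun a b => hv _ _)
    rintro u ⟨hu, hu'⟩
    have hd : ∀ j, dist (u j) (bary v) ≤ meshFactor (m + 1) * d := fun j => by
      obtain ⟨t, ht⟩ := hu' j
      rw [← ht]
      exact dist_comb_le _ _ (fun k => dist_bary_le v hv _) t
    have hd0 : 0 ≤ d := dist_nonneg.trans (hv 0 0)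
    refine ⟨fun a b => ?_, fun a => ?_⟩
    · refine Fin.cases ?_ (fun a => ?_) a <;> refine Fin.cases ?_ (fun b => ?_) b
      · simpa using mul_nonneg (meshFactor_nonneg _) hd0
      · simpa [dist_comm] using hd b
      · simpa using hd a
      · simp only [Fin.cons_succ]
        exact (hu a b).trans
          (mul_le_mul_of_nonneg_right (meshFactor_mono (Nat.le_succ m) a.pos) hd0)
    · refine Fin.cases ?_ (fun a => ?_) a
      · exact ⟨_, rfl⟩
      · obtain ⟨t, ht⟩ := hu' a
        refine ⟨simplexMap i.succAbove t, ?_⟩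
        rw [Fin.cons_succ, ← ht]
        exact DFunLike.congr_fun (comb_simplexMap v i.succAbove) t

theorem sd_pow_single_mem (v : Fin m → stdSimplex ℝ (Fin N)) {d : ℝ} (hv : v ∈ meshLE N m d)
    (p : ℕ) : (sd m ^ p) (Finsupp.single v 1) ∈
      Finsupp.supported ℤ ℤ (meshLE N m (meshFactor m ^ p * d)) := by
  induction p with
  | zero => simpa using Finsupp.single_mem_supported ℤ (1 : ℤ) hv
  | succ p ih =>
    rw [pow_succ' (sd m), Module.End.mul_apply]
    refine mem_supported_of_single (sd m) (fun u hu => ?_) ih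
    rw [pow_succ', mul_assoc]
    exact Finsupp.supported_mono Set.inter_subset_left (sd_single_mem m u hu)

end mesh

/-! ### Subdivision of singular chains -/

variable {X : Type} [TopologicalSpace X] {k N : ℕ}

/-- The singular chain of a chain of tuples in the domain of a map. -/
def realize {m : ℕ} (σ : C(stdSimplex ℝ (Fin N), X)) : TupleChain N (m + 1) →ₗ[ℤ] Chain X m :=
  Finsupp.lmapDomain ℤ ℤ fun v => σ.comp (comb v)

theorem realize_single {m : ℕ} (σ : C(stdSimplex ℝ (Fin N), X))
    (v : Fin (m + 1) → stdSimplex ℝ (Fin N)) :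
    realize σ (Finsupp.single v 1) = Finsupp.single (σ.comp (comb v)) 1 := by
  simp [realize]

/-- The tuple of the vertices of the standard simplex. -/
def vertices (N : ℕ) : TupleChain N N := Finsupp.single (fun i => stdSimplex.vertex i) 1

theorem realize_vertices (σ : Simplex X k) :
    realize σ (vertices (k + 1)) = Finsupp.single σ 1 := by
  rw [vertices, realize_single, comb_vertices, ContinuousMap.comp_id]

theorem boundary_realize {m : ℕ} (σ : C(stdSimplex ℝ (Fin N), X)) (c : TupleChain N (m + 2)) :
    boundary (realize σ c) = realize σ (bd c) := by
  suffices boundary ∘ₗ realize σ = realize σ ∘ₗ bd from LinearMap.congr_fun this c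
  ext1 v
  ext1
  simp only [LinearMap.comp_apply, Finsupp.lsingle_apply, realize_single, bd_single, map_sum,
    map_smul, boundary_single]
  refine Finset.sum_congr rfl fun i _ => ?_
  rw [face, ContinuousMap.comp_assoc, comb_simplexMap]

theorem realize_comp_comb {m M : ℕ} (σ : C(stdSimplex ℝ (Fin N), X))
    (w : Fin M → stdSimplex ℝ (Fin N)) (c : TupleChain M (m + 1)) :
    realize (σ.comp (comb w)) c = realize σ (push w c) := by
  suffices realize (σ.comp (comb w)) = realize σ ∘ₗ push w from LinearMap.congr_fun this c
  ext1 v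
  ext1
  simp only [LinearMap.comp_apply, Finsupp.lsingle_apply, realize_single, push_single]
  congr 1
  ext1 t
  exact congrArg σ (comb_comb _ _ _)

/-- Barycentric subdivision of singular chains. -/
def subdivide : Chain X k →ₗ[ℤ] Chain X k :=
  Finsupp.linearCombination ℤ fun σ => realize σ (sd (k + 1) (vertices (k + 1)))

/-- The homotopy from the identity to barycentric subdivision. -/
def prism : Chain X k →ₗ[ℤ] Chain X (k + 1) :=
  Finsupp.linearCombination ℤ fun σ => realize σ (htpy (k + 1) (vertices (k + 1)))

theorem subdivide_single (σ : Simplex X k) :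
    subdivide (Finsupp.single σ 1) = realize σ (sd (k + 1) (vertices (k + 1))) := by
  simp [subdivide]

theorem prism_single (σ : Simplex X k) :
    prism (Finsupp.single σ 1) = realize σ (htpy (k + 1) (vertices (k + 1))) := by
  simp [prism]

theorem push_vertices {m : ℕ} (w : Fin m → stdSimplex ℝ (Fin N)) :
    push w (vertices m) = Finsupp.single w 1 := by
  rw [vertices, push_single]
  simp only [comb_vertex]

theorem subdivide_realize (σ : C(stdSimplex ℝ (Fin N), X)) (c : TupleChain N (k + 1)) :
    subdivide (realize σ c) = realize σ (sd (k + 1) c) := by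
  suffices subdivide ∘ₗ realize σ = realize σ ∘ₗ sd (k + 1) from LinearMap.congr_fun this c
  ext1 v
  ext1
  simp only [LinearMap.comp_apply, Finsupp.lsingle_apply, realize_single, subdivide_single]
  rw [realize_comp_comb, push_sd, push_vertices]

theorem prism_realize (σ : C(stdSimplex ℝ (Fin N), X)) (c : TupleChain N (k + 1)) :
    prism (realize σ c) = realize σ (htpy (k + 1) c) := by
  suffices prism ∘ₗ realize σ = realize σ ∘ₗ htpy (k + 1) from LinearMap.congr_fun this c
  ext1 v
  ext1
  simp only [LinearMap.comp_apply, Finsupp.lsingle_apply, realize_single, prism_single]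
  rw [realize_comp_comb, push_htpy, push_vertices]

theorem boundary_subdivide (c : Chain X (k + 1)) :
    boundary (subdivide c) = subdivide (boundary c) := by
  suffices boundary ∘ₗ subdivide = subdivide ∘ₗ (boundary : Chain X (k + 1) →ₗ[ℤ] _) from
    LinearMap.congr_fun this c
  ext1 σ
  ext1
  simp only [LinearMap.comp_apply, Finsupp.lsingle_apply]
  rw [subdivide_single, boundary_realize, bd_sd, ← realize_vertices, boundary_realize,
    subdivide_realize]

theorem boundary_prism (c : Chain X (k + 1)) :
    boundary (prism c) = c - subdivide c - prism (boundary c) := by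
  suffices boundary ∘ₗ prism = LinearMap.id - subdivide -
    prism ∘ₗ (boundary : Chain X (k + 1) →ₗ[ℤ] _) from LinearMap.congr_fun this c
  ext1 σ
  ext1
  simp only [LinearMap.comp_apply, Finsupp.lsingle_apply, LinearMap.sub_apply, LinearMap.id_apply]
  rw [← realize_vertices, prism_realize, boundary_realize, boundary_realize, subdivide_realize,
    prism_realize, ← map_sub, ← map_sub, ← bd_htpy, add_sub_cancel_right]

theorem subdivide_pow_realize (σ : C(stdSimplex ℝ (Fin N), X)) (c : TupleChain N (k + 1)) (p : ℕ) :
    (subdivide ^ p) (realize σ c) = realize σ ((sd (k + 1) ^ p) c) := by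
  induction p with
  | zero => rfl
  | succ p ih => rw [pow_succ', Module.End.mul_apply, ih, subdivide_realize, pow_succ',
      Module.End.mul_apply]

theorem boundary_subdivide_pow (c : Chain X (k + 1)) (p : ℕ) :
    boundary ((subdivide ^ p) c) = (subdivide ^ p) (boundary c) := by
  induction p with
  | zero => rfl
  | succ p ih => rw [pow_succ', Module.End.mul_apply, boundary_subdivide, ih, pow_succ',
      Module.End.mul_apply]

/-- The homotopy from the identity to an iterated barycentric subdivision. -/
def prismPow (p : ℕ) : Chain X k →ₗ[ℤ] Chain X (k + 1) :=
  ∑ i ∈ Finset.range p, prism ∘ₗ (subdivide ^ i)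

theorem prismPow_apply (p : ℕ) (c : Chain X k) :
    prismPow p c = ∑ i ∈ Finset.range p, prism ((subdivide ^ i) c) := by
  simp [prismPow]

/-- The homotopies between consecutive subdivisions telescope. -/
theorem boundary_prismPow (p : ℕ) (c : Chain X (k + 1)) :
    boundary (prismPow p c) = c - (subdivide ^ p) c - prismPow p (boundary c) := by
  induction p with
  | zero => simp [prismPow]
  | succ p ih =>
    have h : ∀ {l} (c : Chain X l), prismPow (p + 1) c = prismPow p c + prism ((subdivide ^ p) c) :=
      fun c => by rw [prismPow_apply, Finset.sum_range_succ, ← prismPow_apply]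
    rw [h, h, map_add, ih, boundary_prism, boundary_subdivide_pow, pow_succ', Module.End.mul_apply]
    abel

/-! ### Small simplices -/

variable {ι : Type} (U : ι → Set X)

/-- A singular simplex is small if it is contained in a member of the cover. -/
def Small (σ : Simplex X k) : Prop := ∃ c, ∀ t, σ t ∈ U c

/-- The chains of small simplices. -/
def smallChains (k : ℕ) : Submodule ℤ (Chain X k) := Finsupp.supported ℤ ℤ {σ | Small U σ}

variable {U}

theorem Small.face {σ : Simplex X (k + 1)} (h : Small U σ) (i : Fin (k + 2)) :
    Small U (face i σ) :=
  h.imp fun _ hc _ => hc _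

theorem Small.realize_mem {σ : Simplex X k} (h : Small U σ) {m : ℕ}
    (c : TupleChain (k + 1) (m + 1)) : realize σ c ∈ smallChains U m :=
  lmapDomain_mem_supported (s := Set.univ) (t := {τ | Small U τ}) (fun v => σ.comp (comb v))
    (fun _ _ => h.imp fun _ hc _ => hc _) (by simp [Finsupp.supported_univ])

theorem subdivide_mem {c : Chain X k} (hc : c ∈ smallChains U k) : subdivide c ∈ smallChains U k :=
  mem_supported_of_single _ (fun σ hσ => by
    rw [subdivide_single]; exact Small.realize_mem hσ _) hc

theorem prism_mem {c : Chain X k} (hc : c ∈ smallChains U k) : prism c ∈ smallChains U (k + 1) :=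
  mem_supported_of_single _ (fun σ hσ => by
    rw [prism_single]; exact Small.realize_mem hσ _) hc

theorem subdivide_pow_mem {c : Chain X k} {p q : ℕ} (hpq : p ≤ q)
    (hc : (subdivide ^ p) c ∈ smallChains U k) : (subdivide ^ q) c ∈ smallChains U k := by
  induction q, hpq using Nat.le_induction with
  | base => exact hc
  | succ q _ ih => rw [pow_succ', Module.End.mul_apply]; exact subdivide_mem ih

/-- All affine simplices of dimension at most `k` in the domain of `σ` become small after `p`
subdivisions. -/
def SmallAfter (U : ι → Set X) (σ : Simplex X k) (p : ℕ) : Prop :=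
  ∀ j ≤ k, ∀ v : Fin (j + 1) → stdSimplex ℝ (Fin (k + 1)),
    (subdivide ^ p) (Finsupp.single (σ.comp (comb v)) 1) ∈ smallChains U j

/-- An affine simplex in a face is an affine simplex in the whole. Quantifying over all affine
simplices of dimension at most `k`, rather than over `σ` alone, makes the property hereditary. -/
theorem SmallAfter.face {σ : Simplex X (k + 1)} {p : ℕ} (h : SmallAfter U σ p) (i : Fin (k + 2)) :
    SmallAfter U (face i σ) p := fun j hj v => by
  have : (Singular.face i σ).comp (comb v) =
      σ.comp (comb fun a => simplexMap i.succAbove (v a)) := by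
    have h1 : simplexMap i.succAbove =
        comb fun a : Fin (k + 1) => (stdSimplex.vertex (i.succAbove a) :
          stdSimplex ℝ (Fin (k + 2))) := by
      rw [← comb_simplexMap, comb_vertices, ContinuousMap.id_comp]
    ext1 t
    change σ (simplexMap i.succAbove (comb v t)) = σ _
    rw [h1, comb_comb]
  rw [this]
  exact h j (hj.trans k.le_succ) _

theorem SmallAfter.self {σ : Simplex X k} {p : ℕ} (h : SmallAfter U σ p) :
    (subdivide ^ p) (Finsupp.single σ 1) ∈ smallChains U k := by
  have := h k le_rfl fun i => stdSimplex.vertex i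
  rwa [comb_vertices, ContinuousMap.comp_id] at this

theorem Small.smallAfter {σ : Simplex X k} (h : Small U σ) : SmallAfter U σ 0 := fun _ _ _ =>
  Finsupp.single_mem_supported ℤ _ (h.imp fun _ hc _ => hc _)

/-- By compactness the pulled-back cover has a Lebesgue number `δ`. The mesh shrinks at least by the
factor `meshFactor (k + 1) < 1` at each step in every dimension up to `k`, so one exponent serves
all of them. -/
theorem exists_smallAfter (hU : ∀ c, IsOpen (U c)) (hcov : ∀ x, ∃ c, x ∈ U c) (σ : Simplex X k) :
    ∃ p, SmallAfter U σ p := by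
  obtain ⟨δ, hδ, hball⟩ := lebesgue_number_lemma_of_metric (s := Set.univ) isCompact_univ
    (c := fun c => σ ⁻¹' U c) (fun c => (hU c).preimage σ.continuous)
    (fun x _ => by simpa using hcov (σ x))
  obtain ⟨p, hp⟩ := exists_pow_lt_of_lt_one hδ (meshFactor_lt_one (Nat.succ_pos k))
  refine ⟨p, fun j hj v => ?_⟩
  rw [← realize_single, subdivide_pow_realize]
  -- In the supremum metric the standard simplex has diameter at most `1`.
  have hv : v ∈ meshLE (k + 1) (j + 1) 1 := fun a b => by
    refine (dist_pi_le_iff zero_le_one).2 fun i => ?_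
    rw [Real.dist_eq, abs_le]
    have h1 := (v a).2.1 i
    have h2 := (v b).2.1 i
    have h3 := stdSimplex.le_one (v a) i
    have h4 := stdSimplex.le_one (v b) i
    exact ⟨by have : (v b).1 i ≤ 1 := h4; linarith, by have : (v a).1 i ≤ 1 := h3; linarith⟩
  refine lmapDomain_mem_supported _ (fun u hu => ?_) (sd_pow_single_mem v hv p)
  obtain ⟨c, hc⟩ := hball (u 0) (Set.mem_univ _)
  refine ⟨c, fun t => hc (Metric.mem_ball.2 (lt_of_le_of_lt (dist_comb_le u _ (fun i => hu i 0) t)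
    (lt_of_le_of_lt ?_ hp)))⟩
  rw [mul_one]
  exact pow_le_pow_left₀ (meshFactor_nonneg _)
    (meshFactor_mono (Nat.succ_le_succ hj) (Nat.succ_pos j)) p

/-- The theorem of small chains: singular chains can be retracted to chains of small simplices, up
to a chain homotopy. -/
theorem exists_retraction (hU : ∀ c, IsOpen (U c)) (hcov : ∀ x, ∃ c, x ∈ U c) :
    ∃ D : ∀ k, Chain X k →ₗ[ℤ] Chain X (k + 1),
      (∀ k (σ : Simplex X k), Small U σ → D k (Finsupp.single σ 1) = 0) ∧
      ∀ k (c : Chain X (k + 1)), c - boundary (D (k + 1) c) - D k (boundary c) ∈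
        smallChains U (k + 1) := by
  classical
  have hex := fun k (σ : Simplex X k) => exists_smallAfter hU hcov σ
  -- Each simplex is subdivided as often as it needs. The least exponent is `0` for small simplices
  -- and does not increase on passing to a face.
  let D : ∀ k, Chain X k →ₗ[ℤ] Chain X (k + 1) := fun k =>
    Finsupp.linearCombination ℤ fun σ => prismPow (Nat.find (hex k σ)) (Finsupp.single σ 1)
  have hD : ∀ k (σ : Simplex X k), D k (Finsupp.single σ 1) =
      prismPow (Nat.find (hex k σ)) (Finsupp.single σ 1) := fun k σ => by simp [D]
  refine ⟨D, fun k σ h => ?_, fun k c => ?_⟩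
  · rw [hD, (Nat.find_eq_zero (hex k σ)).2 h.smallAfter]
    simp [prismPow]
  · let L : Chain X (k + 1) →ₗ[ℤ] Chain X (k + 1) :=
      LinearMap.id - boundary ∘ₗ D (k + 1) - D k ∘ₗ boundary
    refine mem_supported_of_single (s := Set.univ) L (fun σ _ => ?_)
      (by simp [Finsupp.supported_univ])
    change Finsupp.single σ 1 - boundary (D (k + 1) (Finsupp.single σ 1)) -
      D k (boundary (Finsupp.single σ 1)) ∈ smallChains U (k + 1)
    have hm := Nat.find_spec (hex (k + 1) σ)
    have hsplit : ∀ x s P E : Chain X (k + 1), x - (x - s - P) - E = s + (P - E) := by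
      intros; abel
    rw [hD, boundary_prismPow, hsplit]
    refine Submodule.add_mem _ hm.self ?_
    rw [boundary_single, map_sum, map_sum, ← Finset.sum_sub_distrib]
    refine Submodule.sum_mem _ fun i _ => ?_
    rw [map_smul, map_smul, ← smul_sub, hD, prismPow_apply, prismPow_apply]
    refine Submodule.smul_mem _ _ ?_
    -- On a face, the two homotopies differ only by prisms over iterates beyond the exponent of that
    -- face, where its subdivisions are already small.
    rw [← Finset.sum_Ico_eq_sub _ (Nat.find_min' (hex k (face i σ)) (hm.face i))]
    exact Submodule.sum_mem _ fun p hp => prism_mem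
      (subdivide_pow_mem (Finset.mem_Ico.1 hp).1 (Nat.find_spec (hex k (face i σ))).self)

theorem eval_eq_zero_of_mem {A : Type} [AddCommGroup A] {φ : Simplex X k → A}
    (h : ∀ σ, Small U σ → φ σ = 0) {c : Chain X k} (hc : c ∈ smallChains U k) : eval φ c = 0 := by
  rw [smallChains, Finsupp.supported_eq_span_single] at hc
  refine (Submodule.span_le (p := LinearMap.ker (eval φ))).2 ?_ hc
  rintro _ ⟨σ, hσ, rfl⟩
  exact (eval_single φ σ).trans (h σ hσ)

variable {A : Type} [AddCommGroup A]

/-- A cochain that is a cocycle on small simplices agrees on small simplices with a cocycle. -/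
theorem exists_cocycle_extension (hU : ∀ c, IsOpen (U c)) (hcov : ∀ x, ∃ c, x ∈ U c)
    (φ : Simplex X (k + 1) → A) (h : ∀ σ, Small U σ → coboundary φ σ = 0) :
    ∃ φ' : Simplex X (k + 1) → A, coboundary φ' = 0 ∧ ∀ σ, Small U σ → φ' σ = φ σ := by
  obtain ⟨D, hD, hmem⟩ := exists_retraction hU hcov
  -- The extension is the pullback of `φ` along the retraction `ρ` to small chains.
  let ρ : Chain X (k + 1) →ₗ[ℤ] Chain X (k + 1) :=
    LinearMap.id - boundary ∘ₗ D (k + 1) - D k ∘ₗ boundary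
  have hρ : ∀ c : Chain X (k + 1), ρ c = c - boundary (D (k + 1) c) - D k (boundary c) :=
    fun _ => rfl
  have heval : ∀ c, eval (fun σ => eval φ (ρ (Finsupp.single σ 1))) c = eval φ (ρ c) := fun c => by
    suffices eval (fun σ => eval φ (ρ (Finsupp.single σ 1))) = eval φ ∘ₗ ρ from
      LinearMap.congr_fun this c
    ext σ
    simp
  refine ⟨fun σ => eval φ (ρ (Finsupp.single σ 1)), ?_, fun σ hσ => ?_⟩
  · funext σ
    rw [Pi.zero_apply, ← eval_single (coboundary _) σ, ← eval_boundary, heval]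
    -- Since `ρ` commutes with boundaries, `ρ (boundary σ)` is the boundary of a small chain, on
    -- which the coboundary of `φ` vanishes.
    have : ρ (boundary (Finsupp.single σ 1)) = boundary (Finsupp.single σ 1 -
        boundary (D (k + 2) (Finsupp.single σ 1)) - D (k + 1) (boundary (Finsupp.single σ 1))) := by
      rw [hρ, boundary_boundary, map_zero, map_sub, map_sub, boundary_boundary]
      abel
    rw [this, eval_boundary]
    exact eval_eq_zero_of_mem h (hmem _ _)
  · have h0 : D k (boundary (Finsupp.single σ 1)) = 0 := by
      rw [boundary_single, map_sum]
      exact Finset.sum_eq_zero fun i _ => by rw [map_smul, hD _ _ (hσ.face i), smul_zero]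
    change eval φ (ρ (Finsupp.single σ 1)) = φ σ
    rw [hρ, hD _ _ hσ, h0, map_zero, sub_zero, sub_zero, eval_single]

/-- A cocycle that is a coboundary on small simplices is a coboundary. -/
theorem exists_coboundary_eq (hU : ∀ c, IsOpen (U c)) (hcov : ∀ x, ∃ c, x ∈ U c)
    (φ : Simplex X (k + 1) → A) (hφ : coboundary φ = 0) (ω : Simplex X k → A)
    (h : ∀ σ, Small U σ → φ σ = coboundary ω σ) : ∃ ω' : Simplex X k → A, coboundary ω' = φ := by
  obtain ⟨D, -, hmem⟩ := exists_retraction hU hcov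
  -- The cocycle `φ - coboundary ω` vanishes on small chains, in particular on `σ - ∂Dσ - D∂σ`. It
  -- also vanishes on the boundary `∂Dσ`, so its value at `σ` equals its value at `D∂σ`, which is
  -- the coboundary of the correction term.
  refine ⟨fun σ => ω σ + eval (φ - coboundary ω) (D k (Finsupp.single σ 1)), ?_⟩
  funext σ
  have hc : coboundary (φ - coboundary ω) = 0 := by
    rw [coboundary_sub, hφ, zero_sub, neg_eq_zero]
    exact funext (coboundary_coboundary ω)
  have h1 := eval_eq_zero_of_mem (φ := φ - coboundary ω)
    (fun σ hσ => sub_eq_zero.2 (h σ hσ)) (hmem k (Finsupp.single σ 1))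
  have h2 : eval (0 : Simplex X (k + 2) → A) = 0 := by ext σ; simp
  rw [map_sub, map_sub, eval_single, eval_boundary, hc, h2, LinearMap.zero_apply, sub_zero,
    boundary_single, map_sum, map_sum] at h1
  rw [sub_eq_zero] at h1
  have h3 : coboundary (fun σ => eval (φ - coboundary ω) (D k (Finsupp.single σ 1))) σ =
      φ σ - coboundary ω σ := by
    refine Eq.trans ?_ h1.symm
    exact Finset.sum_congr rfl fun i _ => by rw [map_smul, map_smul]
  have h4 := congrFun (coboundary_add ω
    (fun σ => eval (φ - coboundary ω) (D k (Finsupp.single σ 1)))) σ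
  rw [Pi.add_apply, h3, add_sub_cancel] at h4
  exact h4

end Singular

namespace Singular

/-! ### Cones over simplices in contractible pieces -/

variable {X : Type} [TopologicalSpace X]

/-- `U` can be contracted, inside itself, to a set of points that meets each piece of a partition
of `U` into open sets in at most one point. -/
def Contracts (U : Set X) : Prop :=
  ∃ H : C(U × unitInterval, U), (∀ u, H (u, 0) = u) ∧ IsLocallyConstant fun u => H (u, 1)

/-- The join parametrization of the simplex by an apex and the opposite face. -/
def joinMap (k : ℕ) : C(stdSimplex ℝ (Fin (k + 1)) × unitInterval, stdSimplex ℝ (Fin (k + 2))) where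
  toFun p := ⟨Fin.cons (p.2 : ℝ) fun i => (1 - (p.2 : ℝ)) * p.1.1 i, by
    constructor
    · refine Fin.cases ?_ fun i => ?_
      · exact p.2.2.1
      · exact mul_nonneg (sub_nonneg.2 p.2.2.2) (p.1.2.1 i)
    · rw [Fin.sum_univ_succ]
      simp only [Fin.cons_zero, Fin.cons_succ]
      rw [← Finset.mul_sum, p.1.2.2]
      ring⟩
  continuous_toFun := by
    refine Continuous.subtype_mk (continuous_pi fun i => ?_) _
    refine Fin.cases ?_ (fun i => ?_) i
    · exact continuous_subtype_val.comp continuous_snd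
    · exact (continuous_const.sub (continuous_subtype_val.comp continuous_snd)).mul
        ((continuous_apply i).comp (continuous_subtype_val.comp continuous_fst))

theorem joinMap_zero (k : ℕ) (p) : (joinMap k p).1 0 = p.2 := rfl

theorem joinMap_succ (k : ℕ) (p) (i : Fin (k + 1)) :
    (joinMap k p).1 i.succ = (1 - (p.2 : ℝ)) * p.1.1 i := rfl

theorem joinMap_surjective (k : ℕ) : Function.Surjective (joinMap k) := by
  intro t
  have hsum := t.2.2
  rw [Fin.sum_univ_succ] at hsum
  have h1 : t.1 0 ≤ 1 := stdSimplex.le_one t 0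
  rcases eq_or_lt_of_le h1 with h | h
  · refine ⟨(Classical.arbitrary _, 1), Subtype.ext (funext fun i => ?_)⟩
    refine Fin.cases ?_ (fun i => ?_) i
    · exact h.symm
    · rw [joinMap_succ]
      have h0 : ∑ i : Fin (k + 1), t.1 i.succ = 0 := by linarith
      have := (Finset.sum_eq_zero_iff_of_nonneg fun i _ => t.2.1 _).1 h0 i (Finset.mem_univ i)
      rw [this]
      simp
  · have h' : 0 < 1 - t.1 0 := sub_pos.2 h
    refine ⟨(⟨fun i => t.1 i.succ / (1 - t.1 0), fun i => div_nonneg (t.2.1 _) h'.le, ?_⟩,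
      ⟨t.1 0, t.2.1 0, h1⟩), Subtype.ext (funext fun i => ?_)⟩
    · rw [← Finset.sum_div, div_eq_one_iff_eq h'.ne']
      linarith
    · refine Fin.cases rfl (fun i => ?_) i
      rw [joinMap_succ]
      exact mul_div_cancel₀ _ h'.ne'

theorem isQuotientMap_joinMap (k : ℕ) : Topology.IsQuotientMap (joinMap k) :=
  (joinMap k).continuous.isClosedMap.isQuotientMap (joinMap k).continuous (joinMap_surjective k)

/-- Only the fibre over the apex is not a single point, so a map descends along `joinMap` as soon as
it is constant at parameter `1`. -/
theorem joinMap_eq {k : ℕ} {p q} (h : joinMap k p = joinMap k q) :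
    p.2 = q.2 ∧ ((p.2 : ℝ) = 1 ∨ p.1 = q.1) := by
  have h0 : p.2 = q.2 := Subtype.ext (congrFun (congrArg Subtype.val h) 0)
  refine ⟨h0, or_iff_not_imp_left.2 fun hp => Subtype.ext (funext fun i => ?_)⟩
  have := congrFun (congrArg Subtype.val h) i.succ
  rw [joinMap_succ, joinMap_succ, ← h0] at this
  exact mul_left_cancel₀ (sub_ne_zero.2 (Ne.symm hp)) this

theorem simplexMap_zero_succAbove (k : ℕ) (t : stdSimplex ℝ (Fin (k + 1))) :
    simplexMap (Fin.succAbove (0 : Fin (k + 2))) t = joinMap k (t, 0) := by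
  refine Subtype.ext (funext fun i => ?_)
  rw [simplexMap_apply]
  refine Fin.cases ?_ (fun i => ?_) i
  · rw [joinMap_zero]
    exact Finset.sum_eq_zero fun j hj => absurd (Finset.mem_filter.1 hj).2 (by simp)
  · rw [joinMap_succ, Finset.sum_filter]
    simp [Fin.succ_inj]

theorem simplexMap_succ_succAbove (k : ℕ) (i : Fin (k + 2)) (p) :
    simplexMap i.succ.succAbove (joinMap k p) =
      joinMap (k + 1) (simplexMap i.succAbove p.1, p.2) := by
  refine Subtype.ext (funext fun j => ?_)
  rw [simplexMap_apply, Finset.sum_filter, Fin.sum_univ_succ]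
  refine Fin.cases ?_ (fun j => ?_) j
  · simp [joinMap_zero]
  · simp [joinMap_succ, simplexMap_apply, Finset.mul_sum, Finset.sum_filter,
      Fin.succ_inj, (Fin.succ_ne_zero j).symm]

/-- The cone over a simplex in a contractible piece. -/
theorem exists_cone {U : Set X} (hU : Contracts U) :
    ∃ c : ∀ k, Simplex X k → Simplex X (k + 1), ∀ k (σ : Simplex X (k + 1)), (∀ t, σ t ∈ U) →
      (∀ t, c (k + 1) σ t ∈ U) ∧ face 0 (c (k + 1) σ) = σ ∧
      ∀ i : Fin (k + 2), face i.succ (c (k + 1) σ) = c k (face i σ) := by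
  classical
  obtain ⟨H, h0, h1⟩ := hU
  have key : ∀ k (σ : Simplex X k), (∀ t, σ t ∈ U) →
      ∃ τ : Simplex X (k + 1), ∀ t (ht : σ t ∈ U) s, τ (joinMap k (t, s)) = H (⟨σ t, ht⟩, s) := by
    intro k σ hσ
    let σ' : C(stdSimplex ℝ (Fin (k + 1)), U) := ⟨fun t => ⟨σ t, hσ t⟩, by fun_prop⟩
    let g : C(stdSimplex ℝ (Fin (k + 1)) × unitInterval, X) :=
      ⟨fun p => H (σ' p.1, p.2), by fun_prop⟩
    -- A simplex is connected, so the locally constant end of the contraction is a single apex on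
    -- it. The apex may vary with the simplex, hence `U` may have several components.
    have hconst : ∀ t t', H (σ' t, 1) = H (σ' t', 1) := fun t t' =>
      (h1.comp_continuous σ'.continuous).apply_eq_of_preconnectedSpace t t'
    have hg : Function.FactorsThrough g (joinMap k) := by
      intro p q hpq
      obtain ⟨hs, h⟩ := joinMap_eq hpq
      change (H (σ' p.1, p.2) : X) = H (σ' q.1, q.2)
      rw [← hs]
      rcases h with h | h
      · have : p.2 = 1 := Subtype.ext h
        rw [this, hconst]
      · rw [h]
    exact ⟨(isQuotientMap_joinMap k).lift g hg, fun t ht s => DFunLike.congr_fun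
      (Topology.IsQuotientMap.lift_comp (isQuotientMap_joinMap k) g hg) (t, s)⟩
  refine ⟨fun k σ => if hσ : ∀ t, σ t ∈ U then (key k σ hσ).choose else
    σ.comp (simplexMap fun _ => 0), fun k σ hσ => ?_⟩
  have hf : ∀ i t, face i σ t ∈ U := fun i t => hσ _
  have hc := (key _ σ hσ).choose_spec
  have hc' := fun i => (key _ (face i σ) (hf i)).choose_spec
  simp only [dif_pos hσ, dif_pos (hf _)]
  refine ⟨fun t => ?_, ?_, fun i => ?_⟩
  · obtain ⟨⟨t, s⟩, rfl⟩ := joinMap_surjective _ t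
    rw [hc t (hσ t) s]
    exact (H _).2
  · ext1 t
    change (key _ σ hσ).choose (simplexMap _ t) = _
    rw [simplexMap_zero_succAbove, hc t (hσ t), h0]
  · ext1 t
    obtain ⟨⟨t, s⟩, rfl⟩ := joinMap_surjective _ t
    change (key _ σ hσ).choose (simplexMap _ _) = _
    rw [simplexMap_succ_succAbove, hc _ (hσ _), hc' i t (hf i t)]
    rfl

/-- Cochains on a contractible piece: cocycles of positive degree are coboundaries. -/
theorem Contracts.exists_primitive {U : Set X} (hU : Contracts U) {A : Type} [AddCommGroup A]
    {k : ℕ} (φ : Simplex X (k + 1) → A)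
    (hφ : ∀ σ : Simplex X (k + 2), (∀ t, σ t ∈ U) → coboundary φ σ = 0) :
    ∃ ψ : Simplex X k → A, ∀ σ : Simplex X (k + 1), (∀ t, σ t ∈ U) → φ σ = coboundary ψ σ := by
  obtain ⟨c, hc⟩ := exists_cone hU
  -- The primitive evaluates `φ` on the cone. The cocycle condition on the cone over `σ` then reads
  -- `φ σ` minus the alternating sum over the cones of its faces.
  refine ⟨fun σ => φ (c k σ), fun σ hσ => ?_⟩
  obtain ⟨hmem, hf0, hf⟩ := hc k σ hσ
  have := hφ _ hmem
  rw [coboundary, Fin.sum_univ_succ, hf0] at this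
  simp only [hf, Fin.val_zero, pow_zero, one_smul, Fin.val_succ, pow_succ, mul_neg, mul_one,
    neg_smul, Finset.sum_neg_distrib] at this
  exact add_neg_eq_zero.1 this

end Singular

namespace Singular

/-! ### First and second cohomology from an open cover by contractible pieces -/

variable {X : Type} [TopologicalSpace X] {A : Type} [AddCommGroup A]

/-- The `i`-th vertex of a singular simplex. -/
def vert {k : ℕ} (σ : Simplex X k) (i : Fin (k + 1)) : X := σ (stdSimplex.vertex i)

/-- The `0`-cochain of a function on points. -/
def pointCochain {B : Type} (f : X → B) (σ : Simplex X 0) : B := f (vert σ 0)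

/-- The difference of the values of a function at the end points of a singular edge. -/
def edgeDiff (f : X → A) (σ : Simplex X 1) : A := f (vert σ 1) - f (vert σ 0)

theorem simplexMap_vertex {k m : ℕ} (f : Fin k → Fin m) (i : Fin k) :
    simplexMap f (stdSimplex.vertex i) = stdSimplex.vertex (f i) :=
  stdSimplex.map_vertex f i

theorem vert_face {k : ℕ} (σ : Simplex X (k + 1)) (i : Fin (k + 2)) (j : Fin (k + 1)) :
    vert (face i σ) j = vert σ (i.succAbove j) :=
  congrArg σ (simplexMap_vertex _ _)

theorem coboundary_pointCochain (f : X → A) : coboundary (pointCochain f) = edgeDiff f := by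
  funext σ
  simp [coboundary, pointCochain, vert_face, edgeDiff, sub_eq_add_neg]

theorem exists_eq_pointCochain {B : Type} (φ : Simplex X 0 → B) :
    ∃ f : X → B, pointCochain f = φ := by
  refine ⟨fun x => φ (ContinuousMap.const _ x), ?_⟩
  funext σ
  refine congrArg φ (ContinuousMap.ext fun t => congrArg σ ?_)
  exact Subsingleton.elim _ _

theorem edgeDiff_sub (f g : X → A) : edgeDiff (f - g) = edgeDiff f - edgeDiff g := by
  funext σ; simp only [edgeDiff, Pi.sub_apply]; abel

theorem coboundary_edgeDiff (f : X → A) : coboundary (edgeDiff f) = 0 := by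
  rw [← coboundary_pointCochain]; exact funext (coboundary_coboundary _)

/-- A function is path-constant on `U` if it takes the same value at the end points of every
singular edge in `U`. -/
def PathConst (U : Set X) (f : X → A) : Prop :=
  ∀ σ : Simplex X 1, (∀ t, σ t ∈ U) → edgeDiff f σ = 0

theorem PathConst.eq_of_path {U : Set X} {f : X → A} (hf : PathConst U f)
    (γ : C(unitInterval, X)) (hγ : ∀ s, γ s ∈ U) : f (γ 0) = f (γ 1) := by
  let e : C(stdSimplex ℝ (Fin 2), unitInterval) :=
    ⟨fun t => ⟨t.1 1, t.2.1 1, stdSimplex.le_one t 1⟩, by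
      exact Continuous.subtype_mk ((continuous_apply 1).comp continuous_subtype_val) _⟩
  have h := sub_eq_zero.1 (hf (γ.comp e) fun t => hγ _)
  have h1 : e (stdSimplex.vertex 1) = 1 := Subtype.ext (by simp [e])
  have h0 : e (stdSimplex.vertex 0) = 0 := Subtype.ext (by simp [e])
  change f (γ (e (stdSimplex.vertex 1))) = f (γ (e (stdSimplex.vertex 0))) at h
  rw [h1, h0] at h
  exact h.symm

theorem pathConst_of_isLocallyConstant {U : Set X} {f : X → A}
    (h : IsLocallyConstant fun u : U => f u) : PathConst U f := fun σ hσ => by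
  let σ' : C(stdSimplex ℝ (Fin 2), U) := ⟨fun t => ⟨σ t, hσ t⟩, by fun_prop⟩
  exact sub_eq_zero.2 ((h.comp_continuous σ'.continuous).apply_eq_of_preconnectedSpace _ _)

/-! ### Degree one: cocycles and their potentials on a cover -/

section firstCohomology

variable {ι : Type} {U : ι → Set X}

/-- A `1`-cocycle has potentials on the pieces of the cover. -/
theorem exists_potentials (hcon : ∀ c, Contracts (U c)) (ψ : Simplex X 1 → A)
    (hψ : coboundary ψ = 0) :
    ∃ p : ι → X → A, ∀ c (σ : Simplex X 1), (∀ t, σ t ∈ U c) → ψ σ = edgeDiff (p c) σ := by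
  have : ∀ c, ∃ p : X → A, ∀ σ : Simplex X 1, (∀ t, σ t ∈ U c) → ψ σ = edgeDiff p σ := fun c => by
    obtain ⟨φ, hφ⟩ := (hcon c).exists_primitive ψ fun σ _ => congrFun hψ σ
    obtain ⟨f, rfl⟩ := exists_eq_pointCochain φ
    exact ⟨f, by rwa [coboundary_pointCochain] at hφ⟩
  choose p hp using this
  exact ⟨p, hp⟩

theorem pathConst_potentials {ψ : Simplex X 1 → A} {p : ι → X → A}
    (hp : ∀ c (σ : Simplex X 1), (∀ t, σ t ∈ U c) → ψ σ = edgeDiff (p c) σ) (c d : ι) :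
    PathConst (U c ∩ U d) (p c - p d) := fun σ hσ => by
  rw [edgeDiff_sub, Pi.sub_apply, ← hp c σ fun t => (hσ t).1, ← hp d σ fun t => (hσ t).2, sub_self]

/-- Potentials with path-constant differences define a `1`-cocycle. -/
theorem exists_cocycle_of_potentials (hU : ∀ c, IsOpen (U c)) (hcov : ∀ x, ∃ c, x ∈ U c)
    (p : ι → X → A) (hp : ∀ c d, PathConst (U c ∩ U d) (p c - p d)) :
    ∃ ψ : Simplex X 1 → A, coboundary ψ = 0 ∧
      ∀ c (σ : Simplex X 1), (∀ t, σ t ∈ U c) → ψ σ = edgeDiff (p c) σ := by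
  classical
  -- The choice of a piece containing `σ` is immaterial, since potentials differ by path-constant
  -- functions on overlaps.
  let F : Simplex X 1 → A := fun σ => if h : Small U σ then edgeDiff (p h.choose) σ else 0
  have hF : ∀ c (σ : Simplex X 1), (∀ t, σ t ∈ U c) → F σ = edgeDiff (p c) σ := fun c σ hσ => by
    have h : Small U σ := ⟨c, hσ⟩
    have h1 := hp h.choose c σ fun t => ⟨h.choose_spec t, hσ t⟩
    rw [edgeDiff_sub, Pi.sub_apply, sub_eq_zero] at h1
    simp only [F, dif_pos h, h1]
  obtain ⟨ψ, hψ, hψF⟩ := exists_cocycle_extension hU hcov F fun σ ⟨c, hc⟩ => by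
    rw [coboundary_congr (ψ := edgeDiff (p c)) fun i => hF c _ fun t => hc _, coboundary_edgeDiff]
    rfl
  exact ⟨ψ, hψ, fun c σ hσ => (hψF σ ⟨c, hσ⟩).trans (hF c σ hσ)⟩

/-- A `1`-cocycle whose potentials can be corrected to agree on overlaps is a coboundary. -/
theorem exists_eq_edgeDiff (hU : ∀ c, IsOpen (U c)) (hcov : ∀ x, ∃ c, x ∈ U c)
    (ψ : Simplex X 1 → A) (hψ : coboundary ψ = 0) (p κ : ι → X → A)
    (hp : ∀ c (σ : Simplex X 1), (∀ t, σ t ∈ U c) → ψ σ = edgeDiff (p c) σ)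
    (hκ : ∀ c, PathConst (U c) (κ c))
    (hpκ : ∀ c d, ∀ x ∈ U c ∩ U d, p c x - p d x = κ c x - κ d x) :
    ∃ h : X → A, ψ = edgeDiff h := by
  choose col hcol using hcov
  -- The corrected potentials agree on overlaps and glue to a global function.
  let h : X → A := fun x => p (col x) x - κ (col x) x
  have hh : ∀ c, ∀ x ∈ U c, h x = p c x - κ c x := fun c x hx => by
    have := hpκ (col x) c x ⟨hcol x, hx⟩
    rw [sub_eq_sub_iff_sub_eq_sub] at this
    exact this
  obtain ⟨ω, hω⟩ := exists_coboundary_eq hU (fun x => ⟨_, hcol x⟩) ψ hψ (pointCochain h) (by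
    rintro σ ⟨c, hc⟩
    have h1 := hκ c σ hc
    rw [coboundary_pointCochain, hp c σ hc]
    simp only [edgeDiff] at *
    rw [hh c (vert σ 1) (hc _), hh c (vert σ 0) (hc _), sub_sub_sub_comm, h1, sub_zero])
  obtain ⟨f, rfl⟩ := exists_eq_pointCochain ω
  exact ⟨f, by rw [← hω, coboundary_pointCochain]⟩

end firstCohomology

/-! ### Degree two: Čech representatives on a cover by three sets -/

section secondCohomology

variable {U : Fin 3 → Set X}

/-- `f` represents the second cohomology class of `φ` with respect to a cover by three open sets. -/
def Represents (U : Fin 3 → Set X) (φ : Simplex X 2 → A) (f : X → A) : Prop :=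
  ∃ (ψ : Fin 3 → Simplex X 1 → A) (χ : Fin 3 → Fin 3 → X → A),
    (∀ c (σ : Simplex X 2), (∀ t, σ t ∈ U c) → φ σ = coboundary (ψ c) σ) ∧
    (∀ c d (σ : Simplex X 1), (∀ t, σ t ∈ U c ∩ U d) → ψ c σ - ψ d σ = edgeDiff (χ c d) σ) ∧
    ∀ x, (∀ c, x ∈ U c) → f x = χ 0 1 x + χ 1 2 x - χ 0 2 x

theorem Represents.add {φ φ' : Simplex X 2 → A} {f f' : X → A} (h : Represents U φ f)
    (h' : Represents U φ' f') : Represents U (φ + φ') (f + f') := by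
  obtain ⟨ψ, χ, h1, h2, h3⟩ := h
  obtain ⟨ψ', χ', h1', h2', h3'⟩ := h'
  refine ⟨ψ + ψ', χ + χ', fun c σ hσ => ?_, fun c d σ hσ => ?_, fun x hx => ?_⟩
  · rw [Pi.add_apply ψ, coboundary_add, Pi.add_apply, Pi.add_apply, h1 c σ hσ, h1' c σ hσ]
  · have a := h2 c d σ hσ
    have b := h2' c d σ hσ
    simp only [edgeDiff, Pi.add_apply] at *
    rw [add_sub_add_comm, a, b, add_sub_add_comm]
  · simp only [Pi.add_apply, h3 x hx, h3' x hx]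
    abel

theorem Represents.zsmul {φ : Simplex X 2 → A} {f : X → A} (r : ℤ) (h : Represents U φ f) :
    Represents U (r • φ) (r • f) := by
  obtain ⟨ψ, χ, h1, h2, h3⟩ := h
  refine ⟨r • ψ, r • χ, fun c σ hσ => ?_, fun c d σ hσ => ?_, fun x hx => ?_⟩
  · rw [Pi.smul_apply r ψ, coboundary_smul, Pi.smul_apply, Pi.smul_apply, h1 c σ hσ]
  · have a := h2 c d σ hσ
    simp only [edgeDiff, Pi.smul_apply] at *
    rw [← smul_sub, a, smul_sub]
  · simp only [Pi.smul_apply, h3 x hx, smul_add, smul_sub]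

/-- Every `2`-cocycle is represented by a path-constant function on the triple intersection. -/
theorem exists_represents (hcon : ∀ c, Contracts (U c))
    (hcon' : ∀ c d, c < d → Contracts (U c ∩ U d)) (φ : Simplex X 2 → A) (hφ : coboundary φ = 0) :
    ∃ f, PathConst (⋂ c, U c) f ∧ Represents U φ f := by
  have h := fun c => (hcon c).exists_primitive φ fun σ _ => congrFun hφ σ
  choose ψ hψ using h
  have h : ∀ c d, ∃ χ : X → A, c < d → ∀ σ : Simplex X 1, (∀ t, σ t ∈ U c ∩ U d) →
      ψ c σ - ψ d σ = edgeDiff χ σ := fun c d => by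
    by_cases hcd : c < d
    · obtain ⟨ω, hω⟩ := (hcon' c d hcd).exists_primitive (ψ c - ψ d) fun σ hσ => by
        rw [coboundary_sub, Pi.sub_apply, ← hψ c σ fun t => (hσ t).1, ← hψ d σ fun t => (hσ t).2,
          sub_self]
      obtain ⟨χ, rfl⟩ := exists_eq_pointCochain ω
      rw [coboundary_pointCochain] at hω
      exact ⟨χ, fun _ => hω⟩
    · exact ⟨0, fun h => absurd h hcd⟩
  choose χ hχ using h
  -- Only intersections with `c < d` are assumed contractible; the remaining differences follow by
  -- antisymmetry.
  have hχ' : ∀ c d, ∀ σ : Simplex X 1, (∀ t, σ t ∈ U c ∩ U d) → ψ c σ - ψ d σ =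
      edgeDiff (if c < d then χ c d else if d < c then -χ d c else 0) σ := fun c d σ hσ => by
    rcases lt_trichotomy c d with h | rfl | h
    · rw [if_pos h, hχ c d h σ hσ]
    · simp [edgeDiff]
    · rw [if_neg h.not_gt, if_pos h, ← neg_sub, hχ d c h σ fun t => (hσ t).symm]
      simp only [edgeDiff, Pi.neg_apply]
      abel
  refine ⟨χ 0 1 + χ 1 2 - χ 0 2, fun σ hσ => ?_, ψ, _, hψ, hχ', fun x _ => by simp⟩
  have hσ' := fun c t => Set.mem_iInter.1 (hσ t) c
  have e1 := hχ 0 1 (by decide) σ fun t => ⟨hσ' _ t, hσ' _ t⟩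
  have e2 := hχ 1 2 (by decide) σ fun t => ⟨hσ' _ t, hσ' _ t⟩
  have e3 := hχ 0 2 (by decide) σ fun t => ⟨hσ' _ t, hσ' _ t⟩
  have e4 : edgeDiff (χ 0 1) σ + edgeDiff (χ 1 2) σ - edgeDiff (χ 0 2) σ = 0 := by
    rw [← e1, ← e2, ← e3]; abel
  rw [← e4]
  simp only [edgeDiff, Pi.add_apply, Pi.sub_apply]
  abel

/-- Every path-constant function on the triple intersection represents a `2`-cocycle. -/
theorem exists_cocycle_represents (hU : ∀ c, IsOpen (U c)) (hcov : ∀ x, ∃ c, x ∈ U c) (f : X → A)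
    (hf : PathConst (⋂ c, U c) f) : ∃ φ, coboundary φ = 0 ∧ Represents U φ f := by
  classical
  have hf' : ∀ σ : Simplex X 1, (∀ t, σ t ∈ U 0) → (∀ t, σ t ∈ U 1) → (∀ t, σ t ∈ U 2) →
      edgeDiff f σ = 0 := fun σ h0 h1 h2 => hf σ fun t => Set.mem_iInter.2 fun c => by
    fin_cases c
    exacts [h0 t, h1 t, h2 t]
  -- On `U 0` the primitive has to be `edgeDiff f` for edges in `U 1` and zero for edges in `U 2`.
  -- The two prescriptions agree on the triple intersection, where `f` is path-constant; on `U 1`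
  -- and `U 2` the primitives are zero.
  let ψ₀ : Simplex X 1 → A := fun σ =>
    if (∀ t, σ t ∈ U 1) ∧ ¬ ∀ t, σ t ∈ U 2 then edgeDiff f σ else 0
  have hψ1 : ∀ σ : Simplex X 1, (∀ t, σ t ∈ U 0) → (∀ t, σ t ∈ U 1) → ψ₀ σ = edgeDiff f σ :=
    fun σ h0 h1 => by
      by_cases h2 : ∀ t, σ t ∈ U 2
      · simp [ψ₀, h2, hf' σ h0 h1 h2]
      · simp only [ψ₀, if_pos (And.intro h1 h2)]
  have hψ2 : ∀ σ : Simplex X 1, (∀ t, σ t ∈ U 2) → ψ₀ σ = 0 := fun σ h2 => by simp [ψ₀, h2]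
  let φ₀ : Simplex X 2 → A := fun σ => if ∀ t, σ t ∈ U 0 then coboundary ψ₀ σ else 0
  have hφ0 : ∀ σ : Simplex X 2, (∀ t, σ t ∈ U 0) → φ₀ σ = coboundary ψ₀ σ := fun σ h0 => if_pos h0
  have hφ1 : ∀ σ : Simplex X 2, (∀ t, σ t ∈ U 1) → φ₀ σ = 0 := fun σ h1 => by
    by_cases h0 : ∀ t, σ t ∈ U 0
    · rw [hφ0 σ h0, coboundary_congr (ψ := edgeDiff f) fun i => hψ1 _ (fun t => h0 _) fun t => h1 _,
        coboundary_edgeDiff]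
      rfl
    · exact if_neg h0
  have hφ2 : ∀ σ : Simplex X 2, (∀ t, σ t ∈ U 2) → φ₀ σ = 0 := fun σ h2 => by
    by_cases h0 : ∀ t, σ t ∈ U 0
    · rw [hφ0 σ h0, coboundary_congr (ψ := 0) fun i => hψ2 _ fun t => h2 _]
      simp [coboundary]
    · exact if_neg h0
  obtain ⟨φ, hφ, hφ'⟩ := exists_cocycle_extension hU hcov φ₀ (by
    rintro σ ⟨c, hc⟩
    have hz : ∀ d, (∀ σ : Simplex X 2, (∀ t, σ t ∈ U d) → φ₀ σ = 0) → (∀ t, σ t ∈ U d) →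
        coboundary φ₀ σ = 0 := fun d hd h => by
      rw [coboundary_congr (ψ := 0) fun i => hd _ fun t => h _]
      simp [coboundary]
    fin_cases c
    · rw [coboundary_congr (ψ := coboundary ψ₀) fun i => hφ0 _ fun t => hc _,
        coboundary_coboundary]
    · exact hz 1 hφ1 hc
    · exact hz 2 hφ2 hc)
  refine ⟨φ, hφ, ![ψ₀, 0, 0], ![![0, f, 0], ![-f, 0, 0], ![0, 0, 0]], fun c σ hσ => ?_,
    fun c d σ hσ => ?_, fun x _ => by simp⟩
  · rw [hφ' σ ⟨c, hσ⟩]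
    fin_cases c
    · exact hφ0 σ hσ
    · exact (hφ1 σ hσ).trans (by simp [coboundary])
    · exact (hφ2 σ hσ).trans (by simp [coboundary])
  · have hc := fun t => (hσ t).1
    have hd := fun t => (hσ t).2
    clear hσ
    have hz : edgeDiff (0 : X → A) σ = 0 := by simp [edgeDiff]
    have hn : edgeDiff (-f) σ = -edgeDiff f σ := by simp only [edgeDiff, Pi.neg_apply]; abel
    fin_cases c <;> fin_cases d <;> simp
    · rw [hz]
    · exact hψ1 σ hc hd
    · rw [hz]; exact hψ2 σ hd
    · rw [hn, hψ1 σ hd hc]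
    · rw [hz]
    · rw [hz]
    · rw [hz, neg_eq_zero]; exact hψ2 σ hc
    · rw [hz]
    · rw [hz]

/-- A represented class vanishes if and only if the representing function is a combination of
path-constant functions on the pairwise intersections. -/
theorem Represents.exists_coboundary_eq_iff (hU : ∀ c, IsOpen (U c)) (hcov : ∀ x, ∃ c, x ∈ U c)
    (hcon : ∀ c, Contracts (U c)) {φ : Simplex X 2 → A} (hφ : coboundary φ = 0) {f : X → A}
    (h : Represents U φ f) :
    (∃ ω, coboundary ω = φ) ↔ ∃ g₀₁ g₁₂ g₀₂ : X → A, PathConst (U 0 ∩ U 1) g₀₁ ∧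
      PathConst (U 1 ∩ U 2) g₁₂ ∧ PathConst (U 0 ∩ U 2) g₀₂ ∧
      ∀ x, (∀ c, x ∈ U c) → f x = g₀₁ x + g₁₂ x - g₀₂ x := by
  classical
  obtain ⟨ψ, χ, h1, h2, h3⟩ := h
  constructor
  · rintro ⟨ω, rfl⟩
    -- If `ω` is a global primitive, then each `ψ c - ω` is closed on `U c` and so has a potential
    -- there. Subtracting these potentials makes the `χ c d` path-constant, and their contributions
    -- cancel in the alternating sum.
    have h := fun c => (hcon c).exists_primitive (ψ c - ω) fun σ hσ => by
      rw [coboundary_sub, Pi.sub_apply, ← h1 c σ hσ, sub_self]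
    choose e he using h
    choose e' he' using fun c => exists_eq_pointCochain (e c)
    have hpc : ∀ c d, PathConst (U c ∩ U d) (χ c d - (e' c - e' d)) := fun c d σ hσ => by
      have a := he c σ fun t => (hσ t).1
      have b := he d σ fun t => (hσ t).2
      rw [← he', coboundary_pointCochain, Pi.sub_apply] at a b
      rw [edgeDiff_sub, edgeDiff_sub, Pi.sub_apply, Pi.sub_apply, ← a, ← b, ← h2 c d σ hσ]
      abel
    refine ⟨_, _, _, hpc 0 1, hpc 1 2, hpc 0 2, fun x hx => ?_⟩
    rw [h3 x hx]
    simp only [Pi.sub_apply]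
    abel
  · rintro ⟨g₀₁, g₁₂, g₀₂, hg₀₁, hg₁₂, hg₀₂, hg⟩
    -- Functions `e c` are sought with `e c - e d = χ c d - g c d` on overlaps, so that the `ψ c -
    -- edgeDiff (e c)` glue. Putting `e 2 = 0` forces `e 0` and `e 1` on `U 2`; outside `U 2`, `e 1`
    -- is taken to be zero and the overlap of `U 0` with `U 1` determines `e 0`. The only remaining
    -- condition, on the triple intersection, is the hypothesis on `f`.
    let e : Fin 3 → X → A := ![fun x => if x ∈ U 2 then χ 0 2 x - g₀₂ x else
        if x ∈ U 1 then χ 0 1 x - g₀₁ x else 0,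
      fun x => if x ∈ U 2 then χ 1 2 x - g₁₂ x else 0, 0]
    have e01 : ∀ x, x ∈ U 0 → x ∈ U 1 → e 0 x - e 1 x = χ 0 1 x - g₀₁ x := fun x h0 h1 => by
      by_cases h2 : x ∈ U 2
      · have hx : ∀ c, x ∈ U c := fun c => by fin_cases c; exacts [h0, h1, h2]
        have a := (h3 x hx).symm.trans (hg x hx)
        simp only [e, Matrix.cons_val_zero, Matrix.cons_val_one, if_pos h2]
        rw [sub_eq_sub_iff_add_eq_add] at a
        have b : χ 0 1 x - g₀₁ x - (χ 0 2 x - g₀₂ x - (χ 1 2 x - g₁₂ x)) =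
          (χ 0 1 x + χ 1 2 x + g₀₂ x) - (g₀₁ x + g₁₂ x + χ 0 2 x) := by abel
        rw [a, sub_self, sub_eq_zero] at b
        exact b.symm
      · simp [e, h1, h2]
    have e12 : ∀ x, x ∈ U 1 → x ∈ U 2 → e 1 x - e 2 x = χ 1 2 x - g₁₂ x := fun x _ h2 => by
      simp [e, h2]
    have e02 : ∀ x, x ∈ U 0 → x ∈ U 2 → e 0 x - e 2 x = χ 0 2 x - g₀₂ x := fun x _ h2 => by
      simp [e, h2]
    have key : ∀ c d, c < d → ∀ σ : Simplex X 1, (∀ t, σ t ∈ U c) → (∀ t, σ t ∈ U d) →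
        ψ c σ - edgeDiff (e c) σ = ψ d σ - edgeDiff (e d) σ := by
      have aux : ∀ c d (g : X → A), PathConst (U c ∩ U d) g →
          (∀ x, x ∈ U c → x ∈ U d → e c x - e d x = χ c d x - g x) → ∀ σ : Simplex X 1,
          (∀ t, σ t ∈ U c) → (∀ t, σ t ∈ U d) →
          ψ c σ - edgeDiff (e c) σ = ψ d σ - edgeDiff (e d) σ := by
        intro c d g hg he σ hc hd
        rw [sub_eq_sub_iff_sub_eq_sub, h2 c d σ fun t => ⟨hc t, hd t⟩]
        have a := he (vert σ 1) (hc _) (hd _)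
        have b := he (vert σ 0) (hc _) (hd _)
        have k := hg σ fun t => ⟨hc t, hd t⟩
        rw [edgeDiff, sub_eq_zero] at k
        simp only [edgeDiff]
        rw [sub_sub_sub_comm, a, b, k]
        abel
      intro c d hcd
      fin_cases c <;> fin_cases d <;> simp at hcd
      · exact aux 0 1 g₀₁ hg₀₁ e01
      · exact aux 0 2 g₀₂ hg₀₂ e02
      · exact aux 1 2 g₁₂ hg₁₂ e12
    have key' : ∀ c d, ∀ σ : Simplex X 1, (∀ t, σ t ∈ U c) → (∀ t, σ t ∈ U d) →
        ψ c σ - edgeDiff (e c) σ = ψ d σ - edgeDiff (e d) σ := fun c d σ hc hd => by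
      rcases lt_trichotomy c d with h | rfl | h
      · exact key c d h σ hc hd
      · rfl
      · exact (key d c h σ hd hc).symm
    let ω : Simplex X 1 → A := fun σ =>
      if h : Small U σ then ψ h.choose σ - edgeDiff (e h.choose) σ else 0
    have hω : ∀ c (σ : Simplex X 1), (∀ t, σ t ∈ U c) → ω σ = (ψ c - edgeDiff (e c)) σ :=
      fun c σ hσ => by
        have h : Small U σ := ⟨c, hσ⟩
        exact (dif_pos h).trans (key' _ _ σ h.choose_spec hσ)
    exact Singular.exists_coboundary_eq hU hcov φ hφ ω fun σ ⟨c, hc⟩ => by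
      rw [coboundary_congr fun i => hω c _ fun t => hc _, coboundary_sub, coboundary_edgeDiff,
        sub_zero, h1 c σ hc]

end secondCohomology

end Singular

/-! ### Spaces glued from blocks in the tetrahedron -/

namespace Block

open Singular

/-- The indices of the smallest coordinates. -/
def amin (x : Fin 4 → ℝ) : Finset (Fin 4) := Finset.univ.filter fun k => ∀ m, x k ≤ x m

/-- The indices of the largest coordinates. -/
def amax (x : Fin 4 → ℝ) : Finset (Fin 4) := Finset.univ.filter fun k => ∀ m, x m ≤ x k

theorem mem_amin {x : Fin 4 → ℝ} {k : Fin 4} : k ∈ amin x ↔ ∀ m, x k ≤ x m := by simp [amin]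

theorem mem_amax {x : Fin 4 → ℝ} {k : Fin 4} : k ∈ amax x ↔ ∀ m, x m ≤ x k := by simp [amax]

theorem amin_eq_iff {x : Fin 4 → ℝ} {S : Finset (Fin 4)} (hS : S.Nonempty) :
    amin x = S ↔ (∀ i ∈ S, ∀ j ∈ S, x i = x j) ∧ ∀ i ∈ S, ∀ m ∉ S, x i < x m := by
  constructor
  · rintro rfl
    refine ⟨fun i hi j hj => le_antisymm (mem_amin.1 hi j) (mem_amin.1 hj i), fun i hi m hm => ?_⟩
    rw [mem_amin] at hi hm
    push Not at hm
    obtain ⟨j, hj⟩ := hm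
    exact (hi j).trans_lt hj
  · rintro ⟨h1, h2⟩
    ext k
    rw [mem_amin]
    obtain ⟨i, hi⟩ := hS
    constructor
    · intro hk
      by_contra hkS
      exact absurd (hk i) (not_le.2 (h2 i hi k hkS))
    · intro hk m
      by_cases hm : m ∈ S
      · exact (h1 k hk m hm).le
      · exact (h2 k hk m hm).le

theorem amax_eq_amin (x : Fin 4 → ℝ) : amax x = amin fun k => -x k := by
  ext k; simp [mem_amax, mem_amin]

theorem amax_eq_iff {x : Fin 4 → ℝ} {S : Finset (Fin 4)} (hS : S.Nonempty) :
    amax x = S ↔ (∀ i ∈ S, ∀ j ∈ S, x i = x j) ∧ ∀ i ∈ S, ∀ m ∉ S, x m < x i := by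
  rw [amax_eq_amin, amin_eq_iff hS]
  simp

theorem amin_permute (x : Fin 4 → ℝ) (σ : Equiv.Perm (Fin 4)) :
    amin (fun k => x (σ.symm k)) = (amin x).map σ.toEmbedding := by
  ext k
  rw [mem_amin, Finset.mem_map_equiv, mem_amin]
  exact ⟨fun h m => by simpa using h (σ m), fun h m => h _⟩

theorem amax_permute (x : Fin 4 → ℝ) (σ : Equiv.Perm (Fin 4)) :
    amax (fun k => x (σ.symm k)) = (amax x).map σ.toEmbedding := by
  rw [amax_eq_amin, amax_eq_amin]
  exact amin_permute (fun k => -x k) σ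

theorem isOpen_amin_eq {S : Finset (Fin 4)} (hS : S.card = 1) :
    IsOpen {x : Fin 4 → ℝ | amin x = S} := by
  obtain ⟨l, rfl⟩ := Finset.card_eq_one.1 hS
  simp only [amin_eq_iff (Finset.singleton_nonempty l), Finset.mem_singleton, forall_eq,
    true_and]
  simp only [Set.ofPred_forall]
  exact isOpen_iInter_of_finite fun m => isOpen_iInter_of_finite fun _ =>
    isOpen_lt (continuous_apply l) (continuous_apply m)

theorem isOpen_amax_eq {S : Finset (Fin 4)} (hS : S.card = 1) :
    IsOpen {x : Fin 4 → ℝ | amax x = S} := by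
  simp only [amax_eq_amin]
  exact (isOpen_amin_eq hS).preimage (continuous_pi fun k => (continuous_apply k).neg)

/-- Conditions on points of the tetrahedron: positivity of the coordinates, uniqueness of the
smallest coordinate, the bound `1 / 2` for the coordinates, and genericity of the largest
coordinates. -/
structure Cond where
  a : Bool
  u : Bool
  b : Bool
  v : Bool

/-- The points that satisfy the conditions; generic points have `c` largest coordinates. -/
def Sat (c : ℕ) (C : Cond) (x : Fin 4 → ℝ) : Prop :=
  (C.a → ∀ m, 0 < x m) ∧ (C.u → (amin x).card = 1) ∧ (C.b → ∀ m, x m < 1 / 2) ∧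
    (C.v → (amax x).card = c)

/-- The part of the pair `(amin x, amax x)` that is locally constant under the conditions. -/
def label (C : Cond) (x : Fin 4 → ℝ) : Finset (Fin 4) × Finset (Fin 4) :=
  (if C.u then amin x else ∅, if C.v then amax x else ∅)

/-- The centre of the piece with the given label. -/
def centre (α β γ : ℝ) (s : Finset (Fin 4) × Finset (Fin 4)) (m : Fin 4) : ℝ :=
  if m ∈ s.1 then α else if m ∈ s.2 then β else γ

/-- The segment from a point to the centre of its piece. -/
def line (C : Cond) (α β γ : ℝ) (x : Fin 4 → ℝ) (s : ℝ) (m : Fin 4) : ℝ :=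
  (1 - s) * x m + s * centre α β γ (label C x) m

variable {c : ℕ} {C : Cond} {α β γ : ℝ} {x : Fin 4 → ℝ}

theorem line_zero : line C α β γ x 0 = x := by funext m; simp [line]

theorem line_one : line C α β γ x 1 = centre α β γ (label C x) := by funext m; simp [line]

theorem label_permute (σ : Equiv.Perm (Fin 4)) :
    label C (fun k => x (σ.symm k)) =
      ((label C x).1.map σ.toEmbedding, (label C x).2.map σ.toEmbedding) := by
  simp only [label, amin_permute, amax_permute]
  congr 1 <;> split_ifs <;> simp

theorem line_permute (σ : Equiv.Perm (Fin 4)) (s : ℝ) :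
    line C α β γ (fun k => x (σ.symm k)) s = fun k => line C α β γ x s (σ.symm k) := by
  funext m
  simp only [line, label_permute, centre, Finset.mem_map_equiv]

theorem sat_permute (σ : Equiv.Perm (Fin 4)) :
    Sat c C (fun k => x (σ.symm k)) ↔ Sat c C x := by
  simp only [Sat, amin_permute, amax_permute, Finset.card_map]
  rw [σ.symm.forall_congr_left (p := fun k => 0 < x (σ.symm k)),
    σ.symm.forall_congr_left (p := fun k => x (σ.symm k) < 1 / 2)]
  simp

theorem line_mem (hx : x ∈ stdSimplex ℝ (Fin 4))
    (hc : centre α β γ (label C x) ∈ stdSimplex ℝ (Fin 4)) {s : ℝ} (hs : s ∈ Set.Icc (0 : ℝ) 1) :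
    line C α β γ x s ∈ stdSimplex ℝ (Fin 4) :=
  convex_stdSimplex ℝ (Fin 4) hx hc (sub_nonneg.2 hs.2) hs.1 (sub_add_cancel 1 s)

theorem lineMap_lt {a b a' b' s : ℝ} (hs : s ∈ Set.Icc (0 : ℝ) 1) (h : a < b) (h' : a' < b') :
    (1 - s) * a + s * a' < (1 - s) * b + s * b' := by
  rcases eq_or_lt_of_le hs.1 with rfl | h0
  · simpa using h
  · exact add_lt_add_of_le_of_lt (mul_le_mul_of_nonneg_left h.le (sub_nonneg.2 hs.2))
      (mul_lt_mul_of_pos_left h' h0)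

theorem disjoint_amin_amax (h : (amin x).card = 1) : Disjoint (amin x) (amax x) := by
  obtain ⟨l, hl⟩ := Finset.card_eq_one.1 h
  rw [hl, Finset.disjoint_singleton_left]
  intro hmax
  have h1 := (amin_eq_iff (Finset.singleton_nonempty l)).1 hl
  obtain ⟨m, hm⟩ := exists_ne l
  exact absurd (mem_amax.1 hmax m)
    (not_le.2 (h1.2 l (Finset.mem_singleton_self l) m (by simpa using hm)))

theorem disjoint_label (h : Sat c C x) : Disjoint (label C x).1 (label C x).2 := by
  simp only [label]
  split_ifs with hu hv
  · exact disjoint_amin_amax (h.2.1 hu)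
  all_goals simp

/-- The conditions are preserved along the segments to the centre. -/
theorem Sat.line (h : Sat c C x) (hc : c ≠ 0) (hu : C.u → α < γ) (huv : C.u → C.v → α < β)
    (hv : C.v → γ < β) (ha : C.a → 0 < α ∧ 0 < β ∧ 0 < γ)
    (hb : C.b → α < 1 / 2 ∧ β < 1 / 2 ∧ γ < 1 / 2) {s : ℝ} (hs : s ∈ Set.Icc (0 : ℝ) 1) :
    Sat c C (line C α β γ x s) ∧ label C (Block.line C α β γ x s) = label C x := by
  have hmin : C.u → amin (Block.line C α β γ x s) = amin x := fun hCu => by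
    have hcard := h.2.1 hCu
    obtain ⟨l, hl⟩ := Finset.card_eq_one.1 hcard
    have h1 := (amin_eq_iff (Finset.singleton_nonempty l)).1 hl
    rw [hl, amin_eq_iff (Finset.singleton_nonempty l)]
    simp only [Finset.mem_singleton, forall_eq, true_and] at h1 ⊢
    intro m hm
    refine lineMap_lt hs (h1 m hm) ?_
    have h2 : (label C x).1 = {l} := by simp [label, hCu, hl]
    simp only [centre, h2, if_true, Finset.mem_singleton, hm, if_false]
    split_ifs with h3
    · refine huv hCu (by_contra fun hCv => ?_)
      simp [label, hCv] at h3
    · exact hu hCu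
  have hmax : C.v → amax (Block.line C α β γ x s) = amax x := fun hCv => by
    have hne : (amax x).Nonempty := Finset.card_ne_zero.1 (by rw [h.2.2.2 hCv]; exact hc)
    have h1 := (amax_eq_iff hne).1 rfl
    have hd := disjoint_label h
    have hcen : ∀ i ∈ amax x, centre α β γ (label C x) i = β := fun i hi => by
      have h2 : i ∈ (label C x).2 := by simpa [label, hCv] using hi
      have h3 : i ∉ (label C x).1 := fun h3 => Finset.disjoint_left.1 hd h3 h2
      simp [centre, h2, h3]
    refine (amax_eq_iff hne).2 ⟨fun i hi j hj => ?_, fun i hi m hm => ?_⟩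
    · simp only [Block.line, hcen i hi, hcen j hj, h1.1 i hi j hj]
    · refine lineMap_lt hs (h1.2 i hi m hm) ?_
      rw [hcen i hi]
      have h2 : m ∉ (label C x).2 := by simpa [label, hCv] using hm
      simp only [centre, h2, if_false]
      split_ifs with h3
      · have hCu : C.u := by
          by_contra hCu
          simp [label, hCu] at h3
        exact huv hCu hCv
      · exact hv hCv
  refine ⟨⟨fun hCa m => ?_, fun hCu => by rw [hmin hCu]; exact h.2.1 hCu, fun hCb m => ?_,
    fun hCv => by rw [hmax hCv]; exact h.2.2.2 hCv⟩, ?_⟩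
  · have := lineMap_lt (b' := centre α β γ (label C x) m) (a' := 0) hs (h.1 hCa m) (by
      obtain ⟨h1, h2, h3⟩ := ha hCa
      simp only [centre]
      split_ifs <;> assumption)
    rwa [mul_zero, mul_zero, add_zero] at this
  · have := lineMap_lt (a' := centre α β γ (label C x) m) (b' := 1 / 2) hs (h.2.2.1 hCb m) (by
      obtain ⟨h1, h2, h3⟩ := hb hCb
      simp only [centre]
      split_ifs <;> assumption)
    calc Block.line C α β γ x s m < _ := this
      _ = 1 / 2 := by ring
  · simp only [label]
    congr 1
    · split_ifs with hCu
      exacts [hmin hCu, rfl]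
    · split_ifs with hCv
      exacts [hmax hCv, rfl]

theorem sum_centre {s : Finset (Fin 4) × Finset (Fin 4)} (h : Disjoint s.1 s.2) :
    ∑ m, centre α β γ s m = s.1.card * α + s.2.card * β + (4 - s.1.card - s.2.card) * γ := by
  have : ∀ m, centre α β γ s m =
      γ + (if m ∈ s.1 then α - γ else 0) + if m ∈ s.2 then β - γ else 0 := fun m => by
    simp only [centre]
    split_ifs with h1 h2
    · exact absurd h2 (Finset.disjoint_left.1 h h1)
    all_goals ring
  simp only [this, Finset.sum_add_distrib, Finset.sum_const, Finset.sum_ite_mem,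
    Finset.univ_inter, Finset.card_univ, Fintype.card_fin, nsmul_eq_mul]
  push_cast
  ring

/-- A label has one smallest index if `C.u` holds and `c` largest indices if `C.v` holds, and is
empty otherwise; `hsum` is the resulting sum of the coordinates. -/
theorem centre_mem (h : Sat c C x) (hα : C.u → 0 ≤ α) (hβ : C.v → 0 ≤ β) (hγ : 0 ≤ γ)
    (hsum : (if C.u then α - γ else 0) + (if C.v then c * (β - γ) else 0) + 4 * γ = 1) :
    centre α β γ (label C x) ∈ stdSimplex ℝ (Fin 4) := by
  constructor
  · intro m
    simp only [centre]
    split_ifs with h1 h2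
    · refine hα (by_contra fun hC => ?_)
      simp [label, hC] at h1
    · refine hβ (by_contra fun hC => ?_)
      simp [label, hC] at h2
    · exact hγ
  · rw [sum_centre (disjoint_label h), ← hsum]
    simp only [label]
    split_ifs with h1 h2 h3
    · rw [h.2.1 h1, h.2.2.2 h2]; push_cast; ring
    · rw [h.2.1 h1]; simp; ring
    · rw [h.2.2.2 h3]; simp; ring
    · simp

/-- A space glued from copies of a block of the tetrahedron along permutations of the
coordinates. -/
structure Gluing (J : Type) [TopologicalSpace J] (p : Tetrahedron → Prop) (X : Type)
    [TopologicalSpace X] where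
  proj : J × {x : Tetrahedron // p x} → X
  isQuotientMap : Topology.IsQuotientMap proj
  rel : J × {x : Tetrahedron // p x} → J × {x : Tetrahedron // p x} → Prop
  eqvGen : ∀ {y y'}, proj y = proj y' → Relation.EqvGen rel y y'
  sound : ∀ {y y'}, rel y y' → proj y = proj y'
  perm : ∀ {y y'}, rel y y' → ∃ σ : Equiv.Perm (Fin 4), y'.2.1.1 = fun k => y.2.1.1 (σ.symm k)

/-! ### Glued spaces and the contraction of their pieces -/

namespace Gluing

variable {J : Type} [TopologicalSpace J] {p : Tetrahedron → Prop} {X : Type}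
  [TopologicalSpace X] (G : Gluing J p X) {A : Type}

theorem eq_of_rel {B : Type} (f : J × {x : Tetrahedron // p x} → B)
    (hf : ∀ y y', G.rel y y' → f y = f y') {y y'} (h : G.proj y = G.proj y') : f y = f y' := by
  have h' := G.eqvGen h
  clear h
  induction h' with
  | rel _ _ h => exact hf _ _ h
  | refl => rfl
  | symm _ _ _ ih => exact ih.symm
  | trans _ _ _ _ _ ih1 ih2 => exact ih1.trans ih2

/-- The image of the points that satisfy the conditions. -/
def piece (c : ℕ) (C : Cond) : Set X := G.proj '' {y | Sat c C y.2.1.1}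

theorem proj_mem_piece {y : J × {x : Tetrahedron // p x}} :
    G.proj y ∈ G.piece c C ↔ Sat c C y.2.1.1 := by
  refine ⟨?_, fun h => ⟨y, h, rfl⟩⟩
  rintro ⟨y', hy', h⟩
  refine (Eq.to_iff (G.eq_of_rel (fun y => Sat c C y.2.1.1) (fun y y' hr => ?_) h)).1 hy'
  obtain ⟨σ, hσ⟩ := G.perm hr
  simp only [hσ, sat_permute]

/-- The geometric requirements for contracting the pieces onto their centres. -/
structure IsCentre (c : ℕ) (C : Cond) (α β γ : ℝ) : Prop where
  mem : ∀ x : {x : Tetrahedron // p x}, Sat c C x.1.1 → ∀ s ∈ Set.Icc (0 : ℝ) 1,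
    ∃ h : line C α β γ x.1.1 s ∈ stdSimplex ℝ (Fin 4), p ⟨_, h⟩
  sat : ∀ x : Fin 4 → ℝ, Sat c C x → ∀ s ∈ Set.Icc (0 : ℝ) 1,
    Sat c C (line C α β γ x s) ∧ label C (line C α β γ x s) = label C x
  rel : ∀ y y', G.rel y y' → Sat c C y.2.1.1 → ∀ s ∈ Set.Icc (0 : ℝ) 1, ∀ z z',
    z.1 = y.1 → z'.1 = y'.1 → z.2.1.1 = line C α β γ y.2.1.1 s →
    z'.2.1.1 = line C α β γ y'.2.1.1 s → G.rel z z'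
  isOpen_amax : C.v → ∀ S : Finset (Fin 4), S.card = c →
    IsOpen {x : {x : Tetrahedron // p x} | amax x.1.1 = S}

namespace IsCentre

variable {G} (hC : G.IsCentre c C α β γ)

include hC

theorem isOpen_sat : IsOpen {y : J × {x : Tetrahedron // p x} | Sat c C y.2.1.1} := by
  have hcoord : ∀ m, Continuous fun y : J × {x : Tetrahedron // p x} => y.2.1.1 m := fun m =>
    (continuous_apply m).comp (continuous_subtype_val.comp
      (continuous_subtype_val.comp continuous_snd))
  have himp : ∀ (b : Bool) (P : J × {x : Tetrahedron // p x} → Prop),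
      (b → IsOpen {y | P y}) → IsOpen {y | b → P y} := fun b P h => by
    cases b
    · simp
    · simpa using h rfl
  refine (himp _ _ fun _ => ?_).inter ((himp _ _ fun _ => ?_).inter
    ((himp _ _ fun _ => ?_).inter (himp _ _ fun hv => ?_)))
  · simp only [Set.ofPred_forall]
    exact isOpen_iInter_of_finite fun m => isOpen_lt continuous_const (hcoord m)
  · have : {y : J × {x : Tetrahedron // p x} | (amin y.2.1.1).card = 1} =
        ⋃ (S : Finset (Fin 4)) (_ : S.card = 1), {y | amin y.2.1.1 = S} := by
      ext y; simp
    rw [this]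
    exact isOpen_iUnion fun S => isOpen_iUnion fun hS =>
      (isOpen_amin_eq hS).preimage (continuous_pi hcoord)
  · simp only [Set.ofPred_forall]
    exact isOpen_iInter_of_finite fun m => isOpen_lt (hcoord m) continuous_const
  · have : {y : J × {x : Tetrahedron // p x} | (amax y.2.1.1).card = c} =
        ⋃ (S : Finset (Fin 4)) (_ : S.card = c), {y | amax y.2.1.1 = S} := by
      ext y; simp
    rw [this]
    exact isOpen_iUnion fun S => isOpen_iUnion fun hS =>
      (hC.isOpen_amax hv S hS).preimage continuous_snd

theorem isOpen_piece : IsOpen (G.piece c C) := by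
  rw [← G.isQuotientMap.isOpen_preimage, show G.proj ⁻¹' G.piece c C =
    {y | Sat c C y.2.1.1} from Set.ext fun _ => G.proj_mem_piece]
  exact hC.isOpen_sat

/-- Under the conditions the index sets in the label have prescribed cardinalities, and each set of
that size occurs on an open set. -/
theorem isLocallyConstant_label : IsLocallyConstant
    fun y : {y : J × {x : Tetrahedron // p x} // Sat c C y.2.1.1} => label C y.1.2.1.1 := by
  have h : ∀ (f : {y : J × {x : Tetrahedron // p x} // Sat c C y.2.1.1} → Finset (Fin 4)),
      (∀ S, IsOpen {y | f y = S}) → IsLocallyConstant f := fun f hf =>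
    (IsLocallyConstant.iff_isOpen_fiber).2 hf
  have h1 := h (fun y => if C.u then amin y.1.2.1.1 else ∅) fun S => by
    by_cases hu : C.u
    · simp only [hu, if_true]
      by_cases hS : S.card = 1
      · refine (isOpen_amin_eq hS).preimage (continuous_pi fun m => ?_)
        exact (continuous_apply m).comp (continuous_subtype_val.comp
          (continuous_subtype_val.comp (continuous_snd.comp continuous_subtype_val)))
      · convert isOpen_empty
        refine Set.eq_empty_of_forall_notMem fun y hy => hS ?_
        rw [← show amin y.1.2.1.1 = S from hy]
        exact y.2.2.1 hu
    · simp [hu]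
  have h2 := h (fun y => if C.v then amax y.1.2.1.1 else ∅) fun S => by
    by_cases hv : C.v
    · simp only [hv, if_true]
      by_cases hS : S.card = c
      · exact (hC.isOpen_amax hv S hS).preimage (continuous_snd.comp continuous_subtype_val)
      · convert isOpen_empty
        refine Set.eq_empty_of_forall_notMem fun y hy => hS ?_
        rw [← show amax y.1.2.1.1 = S from hy]
        exact y.2.2.2.2 hv
    · simp [hv]
  exact h1.prodMk h2

/-- The contraction of a piece, on the level of the blocks. -/
def lift (y : {y : J × {x : Tetrahedron // p x} // Sat c C y.2.1.1}) (s : unitInterval) :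
    J × {x : Tetrahedron // p x} :=
  (y.1.1, ⟨⟨line C α β γ y.1.2.1.1 s, (hC.mem y.1.2 y.2 s s.2).1⟩, (hC.mem y.1.2 y.2 s s.2).2⟩)

theorem sat_lift (y s) : Sat c C (hC.lift y s).2.1.1 := (hC.sat _ y.2 s s.2).1

theorem lift_zero (y) : hC.lift y 0 = y.1 :=
  Prod.ext rfl (Subtype.ext (Subtype.ext line_zero))

theorem continuous_lift : Continuous fun q : _ × unitInterval => hC.lift q.1 q.2 := by
  have hcen : ∀ m, Continuous fun y : {y : J × {x : Tetrahedron // p x} // Sat c C y.2.1.1} =>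
      centre α β γ (label C y.1.2.1.1) m := fun m =>
    (hC.isLocallyConstant_label.comp fun L => centre α β γ L m).continuous
  refine (continuous_fst.comp (continuous_subtype_val.comp continuous_fst)).prodMk ?_
  refine Continuous.subtype_mk (Continuous.subtype_mk (continuous_pi fun m => ?_) _) _
  have hs : Continuous fun q : {y : J × {x : Tetrahedron // p x} // Sat c C y.2.1.1} ×
      unitInterval => (q.2 : ℝ) := continuous_subtype_val.comp continuous_snd
  have hx : Continuous fun q : {y : J × {x : Tetrahedron // p x} // Sat c C y.2.1.1} ×
      unitInterval => q.1.1.2.1.1 m :=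
    (continuous_apply m).comp (continuous_subtype_val.comp (continuous_subtype_val.comp
      (continuous_snd.comp (continuous_subtype_val.comp continuous_fst))))
  exact ((continuous_const.sub hs).mul hx).add (hs.mul ((hcen m).comp continuous_fst))

theorem proj_lift_eq {y y'} (h : G.proj y.1 = G.proj y'.1) (s : unitInterval) :
    G.proj (hC.lift y s) = G.proj (hC.lift y' s) := by
  classical
  -- Chains of relations run through the whole block, so the contracted point is extended by `none`
  -- to points that violate the conditions.
  let f : J × {x : Tetrahedron // p x} → Option X := fun y =>
    if hy : Sat c C y.2.1.1 then some (G.proj (hC.lift ⟨y, hy⟩ s)) else none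
  have := G.eq_of_rel f (fun z z' hr => by
    have hz : Sat c C z.2.1.1 ↔ Sat c C z'.2.1.1 := by
      rw [← G.proj_mem_piece, ← G.proj_mem_piece, G.sound hr]
    by_cases h1 : Sat c C z.2.1.1
    · simp only [f, dif_pos h1, dif_pos (hz.1 h1)]
      exact congrArg some (G.sound (hC.rel z z' hr h1 s s.2 _ _ rfl rfl rfl rfl))
    · simp only [f, dif_neg h1, dif_neg fun h2 => h1 (hz.2 h2)]) h
  simpa only [f, dif_pos y.2, dif_pos y'.2, Option.some.injEq] using this

theorem contracts [DiscreteTopology J] : Contracts (G.piece c C) := by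
  have hU := hC.isOpen_piece
  let W := G.proj ⁻¹' G.piece c C
  have hW : ∀ w : W, Sat c C w.1.2.1.1 := fun w => G.proj_mem_piece.1 w.2
  have hq : Topology.IsQuotientMap ((G.piece c C).restrictPreimage G.proj) :=
    G.isQuotientMap.restrictPreimage_isOpen hU
  let r : C(W, G.piece c C) := ⟨(G.piece c C).restrictPreimage G.proj, hq.continuous⟩
  have hcont : Continuous fun w : W => (⟨w.1, hW w⟩ :
      {y : J × {x : Tetrahedron // p x} // Sat c C y.2.1.1}) :=
    Continuous.subtype_mk continuous_subtype_val _
  let k : C(W × unitInterval, G.piece c C) :=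
    ⟨fun q => ⟨G.proj (hC.lift ⟨q.1.1, hW q.1⟩ q.2), G.proj_mem_piece.2 (hC.sat_lift _ _)⟩, by
      refine Continuous.subtype_mk (G.isQuotientMap.continuous.comp ?_) _
      exact hC.continuous_lift.comp ((hcont.comp continuous_fst).prodMk continuous_snd)⟩
  -- The homotopy is curried before it descends, so that only the projection to the piece has to be
  -- a quotient map, and not its product with the interval.
  have hk : Function.FactorsThrough k.curry r := by
    intro w w' h
    ext s
    exact hC.proj_lift_eq (y := ⟨w.1, hW w⟩) (y' := ⟨w'.1, hW w'⟩)
      (congrArg Subtype.val h) s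
  let K : C(G.piece c C, C(unitInterval, G.piece c C)) :=
    Topology.IsQuotientMap.lift (f := r) hq k.curry hk
  have hK : ∀ w s, K (r w) s = k (w, s) := fun w s =>
    DFunLike.congr_fun
      (DFunLike.congr_fun (Topology.IsQuotientMap.lift_comp (f := r) hq k.curry hk) w) s
  refine ⟨K.uncurry, fun u => ?_, ?_⟩
  · obtain ⟨w, rfl⟩ := hq.surjective u
    refine (hK w 0).trans (Subtype.ext ?_)
    exact congrArg G.proj (hC.lift_zero ⟨w.1, hW w⟩)
  · intro S
    rw [← hq.isOpen_preimage]
    -- The end point is determined by the index of the block and by the label, both of which are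
    -- locally constant.
    have hloc : IsLocallyConstant fun w : W => k (w, 1) := by
      have h1 : IsLocallyConstant fun w : W => (w.1.1, label C w.1.2.1.1) :=
        IsLocallyConstant.prodMk
          ((IsLocallyConstant.iff_continuous _).2 (continuous_fst.comp continuous_subtype_val))
          (hC.isLocallyConstant_label.comp_continuous hcont)
      refine (IsLocallyConstant.iff_eventually_eq _).2 fun w => ?_
      filter_upwards [(IsLocallyConstant.iff_eventually_eq _).1 h1 w] with w' hw'
      refine Subtype.ext (congrArg G.proj ?_)
      obtain ⟨h2, h3⟩ := Prod.ext_iff.1 hw'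
      refine Prod.ext h2 (Subtype.ext (Subtype.ext ?_))
      simp only [lift, Set.Icc.coe_one, line_one]
      exact congrArg _ h3
    have : (G.piece c C).restrictPreimage G.proj ⁻¹' ((fun u => K.uncurry (u, 1)) ⁻¹' S) =
        (fun w : W => k (w, 1)) ⁻¹' S := by
      ext w
      exact Eq.to_iff (congrArg (· ∈ S) (hK w 1))
    rw [this]
    exact hloc S

/-- A path-constant function on a piece only depends on labels. -/
theorem eq_of_label [AddCommGroup A] {f : X → A} (hf : PathConst (G.piece c C) f) {y y'}
    (hy : Sat c C y.2.1.1) (hy' : Sat c C y'.2.1.1) (h1 : y.1 = y'.1)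
    (h2 : label C y.2.1.1 = label C y'.2.1.1) : f (G.proj y) = f (G.proj y') := by
  have key : ∀ (y) (hy : Sat c C y.2.1.1), f (G.proj y) = f (G.proj (hC.lift ⟨y, hy⟩ 1)) :=
    fun y hy => by
      have := hf.eq_of_path ⟨fun s => G.proj (hC.lift ⟨y, hy⟩ s),
        G.isQuotientMap.continuous.comp (hC.continuous_lift.comp
          (continuous_const.prodMk continuous_id))⟩
        fun s => G.proj_mem_piece.2 (hC.sat_lift _ _)
      exact (congrArg (fun z => f (G.proj z)) (hC.lift_zero ⟨y, hy⟩)).symm.trans this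
  rw [key y hy, key y' hy']
  congr 2
  refine Prod.ext h1 (Subtype.ext (Subtype.ext ?_))
  simp only [lift, Set.Icc.coe_one, line_one, h2]

/-- A function whose lift only depends on labels is path-constant. -/
theorem pathConst [DiscreteTopology J] [AddCommGroup A] {f : X → A}
    (g : J × {x : Tetrahedron // p x} → A)
    (hfg : ∀ y, Sat c C y.2.1.1 → f (G.proj y) = g y)
    (hg : ∀ y y', Sat c C y.2.1.1 → Sat c C y'.2.1.1 → y.1 = y'.1 →
      label C y.2.1.1 = label C y'.2.1.1 → g y = g y') : PathConst (G.piece c C) f := by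
  refine pathConst_of_isLocallyConstant fun S => ?_
  have hq : Topology.IsQuotientMap ((G.piece c C).restrictPreimage G.proj) :=
    G.isQuotientMap.restrictPreimage_isOpen hC.isOpen_piece
  rw [← hq.isOpen_preimage]
  let W := G.proj ⁻¹' G.piece c C
  have hW : ∀ w : W, Sat c C w.1.2.1.1 := fun w => G.proj_mem_piece.1 w.2
  have hcont : Continuous fun w : W => (⟨w.1, hW w⟩ :
      {y : J × {x : Tetrahedron // p x} // Sat c C y.2.1.1}) :=
    Continuous.subtype_mk continuous_subtype_val _
  have h1 : IsLocallyConstant fun w : W => (w.1.1, label C w.1.2.1.1) :=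
    IsLocallyConstant.prodMk
      ((IsLocallyConstant.iff_continuous _).2 (continuous_fst.comp continuous_subtype_val))
      (hC.isLocallyConstant_label.comp_continuous hcont)
  have hloc : IsLocallyConstant fun w : W => f (G.proj w.1) := by
    refine (IsLocallyConstant.iff_eventually_eq _).2 fun w => ?_
    filter_upwards [(IsLocallyConstant.iff_eventually_eq _).1 h1 w] with w' hw'
    obtain ⟨h2, h3⟩ := Prod.ext_iff.1 hw'
    rw [hfg _ (hW w'), hfg _ (hW w)]
    exact hg _ _ (hW w') (hW w) h2 h3
  exact hloc S

end IsCentre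

end Gluing

end Block

namespace Block

open Singular

/-! ### The pieces of the polyhedron and of the manifold -/

variable {n : ℕ} (T : Triangulation n) {c : ℕ} {C : Cond} {α β γ : ℝ} {x : Fin 4 → ℝ}

/-- The numerical requirements on the coordinates of the centres of pieces. -/
structure GoodCentre (c : ℕ) (C : Cond) (α β γ : ℝ) : Prop where
  lt_gamma : C.u → α < γ
  lt_beta : C.u → C.v → α < β
  gamma_lt : C.v → γ < β
  pos : C.a → 0 < α ∧ 0 < β ∧ 0 < γ
  lt_half : C.b → α < 1 / 2 ∧ β < 1 / 2 ∧ γ < 1 / 2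
  nonneg : 0 ≤ α ∧ 0 ≤ β ∧ 0 ≤ γ
  le_half : α < 1 / 2 ∧ β ≤ 1 / 2 ∧ γ < 1 / 2
  eq_zero : C.a = false → if C.u then α = 0 else γ = 0
  sum : (if C.u then α - γ else 0) + (if C.v then c * (β - γ) else 0) + 4 * γ = 1

theorem GoodCentre.line_mem (h : GoodCentre c C α β γ) (hx : x ∈ stdSimplex ℝ (Fin 4))
    (hS : Sat c C x) {s : ℝ} (hs : s ∈ Set.Icc (0 : ℝ) 1) :
    line C α β γ x s ∈ stdSimplex ℝ (Fin 4) :=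
  Block.line_mem hx
    (centre_mem hS (fun _ => h.nonneg.1) (fun _ => h.nonneg.2.1) h.nonneg.2.2 h.sum) hs

theorem GoodCentre.sat (h : GoodCentre c C α β γ) (hc : c ≠ 0) (hS : Sat c C x) {s : ℝ}
    (hs : s ∈ Set.Icc (0 : ℝ) 1) :
    Sat c C (line C α β γ x s) ∧ label C (line C α β γ x s) = label C x :=
  hS.line hc h.lt_gamma h.lt_beta h.gamma_lt h.pos h.lt_half hs

theorem exists_pos_of_mem (hx : x ∈ stdSimplex ℝ (Fin 4)) : ∃ k, 0 < x k := by
  by_contra! h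
  have := hx.2 ▸ Finset.sum_nonpos fun k (_ : k ∈ Finset.univ) => h k
  norm_num at this

theorem notMem_amax_of_eq_zero (hx : x ∈ stdSimplex ℝ (Fin 4)) {l : Fin 4} (hl : x l = 0) :
    l ∉ amax x := fun h => by
  obtain ⟨k, hk⟩ := exists_pos_of_mem hx
  exact absurd (mem_amax.1 h k) (by rw [hl]; exact not_le.2 hk)

/-- The contraction has to keep points on the faces of the block. A vanishing coordinate is a
smallest one and never a largest one, so the centre has there the value `α` if `C.u` holds and `γ`
otherwise, and `eq_zero` makes this value `0`. -/
theorem GoodCentre.line_eq_zero (h : GoodCentre c C α β γ) (hx : x ∈ stdSimplex ℝ (Fin 4))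
    (hS : Sat c C x) {l : Fin 4} (hl : x l = 0) (s : ℝ) : line C α β γ x s l = 0 := by
  have ha : C.a = false := by
    by_contra ha
    exact absurd (hS.1 (by simpa using ha) l) (by rw [hl]; exact lt_irrefl 0)
  have h0 := h.eq_zero ha
  have hmin : l ∈ amin x := mem_amin.2 fun m => hl ▸ hx.1 m
  have hmax := notMem_amax_of_eq_zero hx hl
  simp only [line, hl, mul_zero, zero_add, centre, label]
  by_cases hu : C.u <;> by_cases hv : C.v <;> simp_all

/-- The polyhedron as a glued space. -/
def spineGluing : Gluing (Fin n) (fun x : Tetrahedron => x.1 ∈ spineSet) T.dualPolyhedron where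
  proj := Quot.mk _
  isQuotientMap := isQuotientMap_quot_mk
  rel p q := ∃ l : Fin 4, p.2 ∈ Spine.face l ∧ q = (T.adj p.1 l, Spine.glue (T.perm p.1 l) p.2)
  eqvGen h := Quot.eqvGen_exact h
  sound h := Quot.sound h
  perm := by
    rintro y y' ⟨l, hl, rfl⟩
    exact ⟨T.perm y.1 l, rfl⟩

theorem mem_spineSet_iff_card : x ∈ spineSet ↔ x ∈ stdSimplex ℝ (Fin 4) ∧ 2 ≤ (amax x).card := by
  refine and_congr_right fun _ => ⟨?_, fun h => ?_⟩
  · rintro ⟨i, j, hij, he, hm⟩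
    exact Finset.one_lt_card.2 ⟨i, mem_amax.2 hm, j, mem_amax.2 (he ▸ hm), hij⟩
  · obtain ⟨i, hi, j, hj, hij⟩ := Finset.one_lt_card.1 h
    rw [mem_amax] at hi hj
    exact ⟨i, j, hij, le_antisymm (hj i) (hi j), hi⟩

theorem GoodCentre.isCentre_spine (h : GoodCentre 2 C α β γ) :
    (spineGluing T).IsCentre 2 C α β γ where
  sat x hS s hs := h.sat two_ne_zero hS hs
  mem x hS s hs := by
    refine ⟨h.line_mem x.1.2 hS hs, mem_spineSet_iff_card.2 ⟨h.line_mem x.1.2 hS hs, ?_⟩⟩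
    by_cases hv : C.v
    · exact ((h.sat two_ne_zero hS hs).1.2.2.2 hv).ge
    · obtain ⟨i, hi, j, hj, hij⟩ := Finset.one_lt_card.1 (mem_spineSet_iff_card.1 x.2).2
      -- Without the condition `v` the centre attains its maximum `γ` at every largest index of `x`.
      -- So all of these remain largest along the segment, and there are still at least two.
      have hle : ∀ m, centre α β γ (label C x.1.1) m ≤ γ := fun m => by
        have h2 : m ∉ (label C x.1.1).2 := by simp [label, hv]
        simp only [centre, h2, if_false]
        split_ifs with h1
        · refine (h.lt_gamma (by_contra fun hu => ?_)).le
          simp [label, hu] at h1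
        · exact le_rfl
      have hcen : ∀ i ∈ amax x.1.1, centre α β γ (label C x.1.1) i = γ := fun i hi => by
        have h1 : i ∉ (label C x.1.1).1 := fun h1 => by
          by_cases hu : C.u
          · simp only [label, hu, if_true] at h1
            exact Finset.disjoint_left.1 (disjoint_amin_amax (hS.2.1 hu)) h1 hi
          · simp [label, hu] at h1
        have h2 : i ∉ (label C x.1.1).2 := by simp [label, hv]
        simp [centre, h1, h2]
      have key : ∀ i ∈ amax x.1.1, i ∈ amax (line C α β γ x.1.1 s) := fun i hi => by
        refine mem_amax.2 fun m => ?_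
        simp only [line, hcen i hi]
        exact add_le_add (mul_le_mul_of_nonneg_left (mem_amax.1 hi m) (sub_nonneg.2 hs.2))
          (mul_le_mul_of_nonneg_left (hle m) hs.1)
      exact Finset.one_lt_card.2 ⟨i, key i hi, j, key j hj, hij⟩
  rel := by
    rintro y y' ⟨l, hl, rfl⟩ hS s hs z z' hz hz' h1 h2
    refine ⟨l, ?_, Prod.ext ?_ (Subtype.ext (Subtype.ext ?_))⟩
    · change z.2.1.1 l = 0
      rw [h1]
      exact h.line_eq_zero y.2.1.2 hS hl s
    · rw [hz', hz]
    · rw [h2, hz]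
      refine (line_permute (x := y.2.1.1) (T.perm y.1 l) s).trans ?_
      rw [← h1]
      rfl
  isOpen_amax := by
    intro _ S hS
    have hne : S.Nonempty := Finset.card_ne_zero.1 (by rw [hS]; exact two_ne_zero)
    -- At least two coordinates are largest on the spine. For `S` with two elements it therefore
    -- suffices that no index outside `S` is largest, which is an open condition although equality
    -- of coordinates is not.
    have : {x : {x : Tetrahedron // x.1 ∈ spineSet} | amax x.1.1 = S} =
        {x | ∀ m ∉ S, ∃ i ∈ S, x.1.1 m < x.1.1 i} := by
      ext x
      constructor
      · intro hx m hm
        obtain ⟨i, hi⟩ := hne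
        exact ⟨i, hi, ((amax_eq_iff ⟨i, hi⟩).1 hx).2 i hi m hm⟩
      · intro hx
        refine Finset.eq_of_subset_of_card_le (fun i hi => ?_) ?_
        · by_contra hiS
          obtain ⟨j, -, hj⟩ := hx i hiS
          exact absurd (mem_amax.1 hi j) (not_le.2 hj)
        · rw [hS]; exact (mem_spineSet_iff_card.1 x.2).2
    rw [this]
    simp only [Set.ofPred_forall, Set.ofPred_exists]
    have hcoord : ∀ m, Continuous fun x : {x : Tetrahedron // x.1 ∈ spineSet} => x.1.1 m :=
      fun m => (continuous_apply m).comp (continuous_subtype_val.comp continuous_subtype_val)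
    refine isOpen_iInter_of_finite fun m => isOpen_iInter_of_finite fun _ =>
      isOpen_iUnion fun i => ?_
    by_cases hi : i ∈ S
    · simpa [hi] using isOpen_lt (hcoord m) (hcoord i)
    · simp [hi]

/-- A point of the spine with `x l = 0` has two or three largest coordinates. In the latter case it
is the barycentre of the face `l`, whose smallest coordinate is unique. -/
theorem exists_sat_spine (hx : x ∈ spineSet) :
    Sat 2 ⟨true, false, false, false⟩ x ∨ Sat 2 ⟨false, true, false, false⟩ x ∨
      Sat 2 ⟨false, false, false, true⟩ x := by
  simp only [Sat, Bool.false_eq_true, false_imp_iff, true_imp_iff, true_and, and_true]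
  obtain ⟨hx, h2⟩ := mem_spineSet_iff_card.1 hx
  by_contra! h
  obtain ⟨⟨l, hl⟩, h3, h4⟩ := h
  have hl : x l = 0 := le_antisymm hl (hx.1 l)
  have hmax := notMem_amax_of_eq_zero hx hl
  have h5 : amax x = {l}ᶜ := Finset.eq_of_subset_of_card_le
    (fun k hk => by
      rw [Finset.mem_compl, Finset.mem_singleton]
      rintro rfl
      exact hmax hk)
    (by rw [Finset.card_compl, Fintype.card_fin, Finset.card_singleton]; omega)
  refine h3 (Finset.card_eq_one.2 ⟨l, (amin_eq_iff (Finset.singleton_nonempty l)).2 ?_⟩)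
  simp only [Finset.mem_singleton, forall_eq, true_and]
  intro m hm
  have h6 : m ∈ amax x := by simpa [h5] using hm
  obtain ⟨k, hk⟩ := exists_pos_of_mem hx
  rw [hl]
  exact hk.trans_le (mem_amax.1 h6 k)

/-- The gluing relation on the octahedra. -/
def octahedronRel (y y' : (Fin n × ℤˣ) × Octahedron) : Prop :=
  (∃ l, y.2.1.1 l = 0 ∧ y' = ((T.adj y.1.1 l, -(Equiv.Perm.sign (T.perm y.1.1 l)) * y.1.2),
    y.2.permute (T.perm y.1.1 l))) ∨
  (∃ k, y.2.1.1 k = 1 / 2 ∧ y'.1.1 = y.1.1 ∧ y'.2 = y.2)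

/-- The projection from the octahedra to the manifold. -/
def octahedronProj (y : (Fin n × ℤˣ) × Octahedron) : T.D :=
  Quot.mk _ (y.1.1, Quot.mk _ (y.1.2, y.2))

/-- The projection is a composite of two quotients. Their index sets are discrete, so openness can
be tested on each copy of the octahedron. -/
theorem isQuotientMap_octahedronProj : Topology.IsQuotientMap (octahedronProj T) := by
  refine (Topology.isQuotientMap_iff _).2 ⟨.of_isOpen_preimage_iff_isOpen fun S => ?_, ?_⟩
  rotate_left
  · rintro ⟨i, ⟨ε, x⟩⟩
    exact ⟨((i, ε), x), rfl⟩
  · have hprod : ∀ {J Y : Type} [TopologicalSpace J] [DiscreteTopology J] [TopologicalSpace Y]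
        (S : Set (J × Y)), IsOpen S ↔ ∀ j, IsOpen {y | (j, y) ∈ S} := fun S => by
      refine continuous_Prop.symm.trans (continuous_prod_of_discrete_left.trans ?_)
      exact forall_congr' fun j => continuous_Prop
    refine Iff.trans ?_ (isQuotientMap_quot_mk.isOpen_preimage (s := S))
    rw [hprod, hprod, Prod.forall]
    refine forall_congr' fun i => Iff.trans ?_ isQuotientMap_quot_mk.isOpen_preimage
    rw [hprod]
    rfl

/-- The iterated quotient maps back to the quotient by the single relation `octahedronRel`. -/
theorem eqvGen_of_octahedronProj_eq {y y' : (Fin n × ℤˣ) × Octahedron}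
    (h : octahedronProj T y = octahedronProj T y') :
    Relation.EqvGen (octahedronRel T) y y' := by
  let f (i : Fin n) : MirroredOctahedron → Quot (octahedronRel T) :=
    Quot.lift (fun q => Quot.mk _ ((i, q.1), q.2)) (by
      rintro p q ⟨h, k, hk⟩
      exact Quot.sound (Or.inr ⟨k, hk, rfl, h.symm⟩))
  let F : T.D → Quot (octahedronRel T) := Quot.lift (fun q => f q.1 q.2) (by
    rintro ⟨i, z⟩ ⟨j, w⟩ ⟨l, ⟨ε, x, hz, hx⟩, hw⟩
    obtain ⟨rfl, rfl⟩ := Prod.ext_iff.1 hw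
    dsimp only at hz
    subst hz
    exact Quot.sound (Or.inl ⟨l, hx, rfl⟩))
  exact Quot.eqvGen_exact (congrArg F h)

/-- The manifold as a glued space. -/
def octahedronGluing : Gluing (Fin n × ℤˣ)
    (fun x : Tetrahedron => (∀ k, x.1 k ≤ 1 / 2) ∧ ¬ ∃ i j, i ≠ j ∧ x.1 i = 1 / 2 ∧ x.1 j = 1 / 2)
    T.D where
  proj := octahedronProj T
  isQuotientMap := isQuotientMap_octahedronProj T
  rel := octahedronRel T
  eqvGen h := eqvGen_of_octahedronProj_eq T h
  sound := by
    rintro y y' (⟨l, hl, rfl⟩ | ⟨k, hk, h1, h2⟩)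
    · exact Quot.sound ⟨l, ⟨_, _, rfl, hl⟩, rfl⟩
    · refine congrArg (Quot.mk _) (Prod.ext h1.symm (Quot.sound ⟨h2.symm, k, hk⟩))
  perm := by
    rintro y y' (⟨l, hl, rfl⟩ | ⟨k, hk, h1, h2⟩)
    · exact ⟨T.perm y.1.1 l, rfl⟩
    · exact ⟨1, by rw [h2]; rfl⟩

/-- Hypothesis `hb` concerns pieces that may meet black faces: the contraction keeps a coordinate `1
/ 2` only if the centre also has the value `1 / 2` at the largest index. -/
theorem GoodCentre.isCentre_octahedron (h : GoodCentre 1 C α β γ)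
    (hb : C.b = false → C.v ∧ β = 1 / 2) : (octahedronGluing T).IsCentre 1 C α β γ where
  sat x hS s hs := h.sat one_ne_zero hS hs
  mem x hS s hs := by
    refine ⟨h.line_mem x.1.2 hS hs, fun k => ?_, ?_⟩
    · change (1 - s) * x.1.1 k + s * centre α β γ (label C x.1.1) k ≤ 1 / 2
      have h1 : centre α β γ (label C x.1.1) k ≤ 1 / 2 := by
        simp only [centre]
        split_ifs
        exacts [h.le_half.1.le, h.le_half.2.1, h.le_half.2.2.le]
      nlinarith [x.2.1 k, hs.1, hs.2]
    · rintro ⟨i, j, hij, hi, hj⟩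
      have hcen : ∀ k, centre α β γ (label C x.1.1) k ≤ 1 / 2 ∧
          (centre α β γ (label C x.1.1) k = 1 / 2 → C.v ∧ k ∈ amax x.1.1) := fun k => by
        simp only [centre]
        split_ifs with h1 h2
        · exact ⟨h.le_half.1.le, fun he => absurd he h.le_half.1.ne⟩
        · refine ⟨h.le_half.2.1, fun _ => ?_⟩
          by_cases hv : C.v
          · exact ⟨hv, by simpa [label, hv] using h2⟩
          · simp [label, hv] at h2
        · exact ⟨h.le_half.2.2.le, fun he => absurd he h.le_half.2.2.ne⟩
      change (1 - s) * x.1.1 i + s * centre α β γ (label C x.1.1) i = 1 / 2 at hi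
      change (1 - s) * x.1.1 j + s * centre α β γ (label C x.1.1) j = 1 / 2 at hj
      -- Two coordinates `1 / 2` on the segment would come from two in `x`, or, at the end `s = 1`,
      -- from two indices in `amax x`; both are excluded.
      rcases eq_or_lt_of_le hs.2 with rfl | hs1
      · simp only [sub_self, zero_mul, one_mul, zero_add] at hi hj
        obtain ⟨hv, hi⟩ := (hcen i).2 hi
        obtain ⟨-, hj⟩ := (hcen j).2 hj
        exact hij (Finset.card_le_one.1 (hS.2.2.2 hv).le i hi j hj)
      · have key : ∀ k, (1 - s) * x.1.1 k + s * centre α β γ (label C x.1.1) k = 1 / 2 →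
            x.1.1 k = 1 / 2 := fun k hk => by
          refine le_antisymm (x.2.1 k) ?_
          by_contra! hlt
          nlinarith [(hcen k).1, hs.1, mul_lt_mul_of_pos_left hlt (sub_pos.2 hs1)]
        exact x.2.2 ⟨i, j, hij, key i hi, key j hj⟩
  rel := by
    rintro y y' (⟨l, hl, rfl⟩ | ⟨k, hk, h3, h4⟩) hS s hs z z' hz hz' h1 h2
    · refine Or.inl ⟨l, ?_, Prod.ext ?_ (Subtype.ext (Subtype.ext ?_))⟩
      · rw [h1]
        exact h.line_eq_zero y.2.1.2 hS hl s
      · rw [hz', hz]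
      · rw [h2, hz]
        refine (line_permute (x := y.2.1.1) (T.perm y.1.1 l) s).trans ?_
        rw [← h1]
        rfl
    · refine Or.inr ⟨k, ?_, by rw [hz', hz, h3], Subtype.ext (Subtype.ext ?_)⟩
      · have hbf : C.b = false := by
          by_contra hbt
          exact absurd (hS.2.2.1 (by simpa using hbt) k) (by rw [hk]; exact lt_irrefl _)
        obtain ⟨hv, rfl⟩ := hb hbf
        have hmax : k ∈ amax y.2.1.1 := mem_amax.2 fun m => (y.2.2.1 m).trans hk.ge
        have h5 : k ∈ (label C y.2.1.1).2 := by simpa [label, hv] using hmax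
        have h6 : k ∉ (label C y.2.1.1).1 := fun h6 =>
          Finset.disjoint_left.1 (disjoint_label hS) h6 h5
        rw [h1]
        simp only [line, hk, centre, h5, h6, if_true, if_false]
        ring
      · rw [h2, h1, h4]
  isOpen_amax _ S hS := (isOpen_amax_eq hS).preimage
    (continuous_subtype_val.comp continuous_subtype_val)

/-- Two vanishing coordinates would force the other two to be `1 / 2`, and two coordinates equal to
`1 / 2` are excluded as well: both describe ideal vertices. -/
theorem exists_sat_octahedron (x : Octahedron) :
    Sat 1 ⟨true, false, true, false⟩ x.1.1 ∨ Sat 1 ⟨false, true, true, false⟩ x.1.1 ∨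
      Sat 1 ⟨true, false, false, true⟩ x.1.1 ∨ Sat 1 ⟨false, true, false, true⟩ x.1.1 := by
  have h1 : (∀ m, 0 < x.1.1 m) ∨ (amin x.1.1).card = 1 := by
    by_contra! h
    obtain ⟨⟨l, hl⟩, h⟩ := h
    have hl : x.1.1 l = 0 := le_antisymm hl (x.1.2.1 l)
    obtain ⟨m, hm, hml⟩ : ∃ m, x.1.1 m = 0 ∧ m ≠ l := by
      by_contra! h'
      refine h (Finset.card_eq_one.2 ⟨l, (amin_eq_iff (Finset.singleton_nonempty l)).2 ?_⟩)
      simp only [Finset.mem_singleton, forall_eq, true_and]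
      intro m hm
      rw [hl]
      exact lt_of_le_of_ne (x.1.2.1 m) fun h0 => hm (h' m h0.symm)
    have key : ∀ l m : Fin 4, m ≠ l → ∃ i j : Fin 4, i ≠ j ∧
        Finset.univ = ({l, m, i, j} : Finset _) ∧
        m ∉ ({i, j} : Finset _) ∧ l ∉ ({m, i, j} : Finset _) := by decide
    obtain ⟨i, j, hij, hu⟩ := key l m hml
    obtain ⟨hu, h3, h4⟩ := hu
    have hs := x.1.2.2
    rw [hu, Finset.sum_insert h4, Finset.sum_insert h3, Finset.sum_pair hij, hl, hm] at hs
    have hi := x.2.1 i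
    have hj := x.2.1 j
    exact x.2.2 ⟨i, j, hij, by linarith, by linarith⟩
  have h2 : (∀ m, x.1.1 m < 1 / 2) ∨ (amax x.1.1).card = 1 := by
    by_contra! h
    obtain ⟨⟨k, hk⟩, h⟩ := h
    have hk : x.1.1 k = 1 / 2 := le_antisymm (x.2.1 k) hk
    refine h (Finset.card_eq_one.2 ⟨k, (amax_eq_iff (Finset.singleton_nonempty k)).2 ?_⟩)
    simp only [Finset.mem_singleton, forall_eq, true_and]
    intro m hm
    rw [hk]
    exact lt_of_le_of_ne (x.2.1 m) fun h0 => x.2.2 ⟨m, k, hm, h0, hk⟩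
  simp only [Sat, Bool.false_eq_true, false_imp_iff, true_imp_iff, true_and, and_true]
  tauto

end Block

namespace Block

open Singular

/-! ### Functions on glued spaces -/

namespace Gluing

variable {J : Type} [TopologicalSpace J] {p : Tetrahedron → Prop} {X : Type} [TopologicalSpace X]
  (G : Gluing J p X) {A : Type} {c : ℕ} {C C' : Cond} {α β γ : ℝ}

theorem exists_function (g : J × {x : Tetrahedron // p x} → A)
    (hg : ∀ y y', G.rel y y' → g y = g y') : ∃ f : X → A, ∀ y, f (G.proj y) = g y := by
  choose r hr using G.isQuotientMap.surjective
  exact ⟨fun x => g (r x), fun y => G.eq_of_rel g hg (hr _)⟩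

/-- A function of labels that is compatible with the gluing is defined on the piece. -/
theorem exists_function_of_label [Zero A] (g : J → Finset (Fin 4) × Finset (Fin 4) → A)
    (hg : ∀ y y', G.rel y y' → Sat c C y.2.1.1 → g y.1 (label C y.2.1.1) =
      g y'.1 (label C y'.2.1.1)) :
    ∃ f : X → A, ∀ y, Sat c C y.2.1.1 → f (G.proj y) = g y.1 (label C y.2.1.1) := by
  classical
  obtain ⟨f, hf⟩ := G.exists_function
    (fun y => if Sat c C y.2.1.1 then g y.1 (label C y.2.1.1) else 0) fun y y' h => by
      have h1 : Sat c C y.2.1.1 ↔ Sat c C y'.2.1.1 := by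
        rw [← G.proj_mem_piece, ← G.proj_mem_piece, G.sound h]
      by_cases h2 : Sat c C y.2.1.1
      · rw [if_pos h2, if_pos (h1.1 h2)]
        exact hg y y' h h2
      · rw [if_neg h2, if_neg fun h3 => h2 (h1.2 h3)]
  exact ⟨f, fun y hy => (hf y).trans (if_pos hy)⟩

theorem piece_inter : G.piece c C ∩ G.piece c C' =
    G.piece c ⟨C.a || C'.a, C.u || C'.u, C.b || C'.b, C.v || C'.v⟩ := by
  ext x
  obtain ⟨y, rfl⟩ := G.isQuotientMap.surjective x
  rw [Set.mem_inter_iff, G.proj_mem_piece, G.proj_mem_piece, G.proj_mem_piece]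
  simp only [Sat, Bool.or_eq_true, or_imp]
  tauto

/-- This computes degree-zero cohomology: each point of a piece is joined within it to the centre
given by its block and label. -/
theorem IsCentre.pathConst_iff [DiscreteTopology J] {G : Gluing J p X} (hC : G.IsCentre c C α β γ)
    [AddCommGroup A] {f : X → A} : PathConst (G.piece c C) f ↔
      ∃ g : J → Finset (Fin 4) × Finset (Fin 4) → A,
        ∀ y, Sat c C y.2.1.1 → f (G.proj y) = g y.1 (label C y.2.1.1) := by
  classical
  constructor
  · intro hf
    refine ⟨fun j L => if h : ∃ y, Sat c C y.2.1.1 ∧ y.1 = j ∧ label C y.2.1.1 = L then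
      f (G.proj h.choose) else 0, fun y hy => ?_⟩
    have h : ∃ y' : J × {x : Tetrahedron // p x}, Sat c C y'.2.1.1 ∧ y'.1 = y.1 ∧
        label C y'.2.1.1 = label C y.2.1.1 :=
      ⟨y, hy, rfl, rfl⟩
    dsimp only
    rw [dif_pos h]
    obtain ⟨h1, h2, h3⟩ := h.choose_spec
    exact hC.eq_of_label hf hy h1 h2.symm h3.symm
  · rintro ⟨g, hg⟩
    exact hC.pathConst (fun y => g y.1 (label C y.2.1.1)) hg fun y y' _ _ h1 h2 => by rw [h1, h2]

end Gluing

/-- Points with prescribed smallest and largest coordinates. -/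
theorem exists_point {α β γ : ℝ} {S : Finset (Fin 4) × Finset (Fin 4)} (h1 : S.1.card = 1)
    (h2 : S.2.Nonempty) (hd : Disjoint S.1 S.2) (hα : 0 ≤ α) (hαγ : α < γ) (hγβ : γ < β)
    (hs : α + S.2.card * β + (3 - S.2.card) * γ = 1) :
    centre α β γ S ∈ stdSimplex ℝ (Fin 4) ∧ amin (centre α β γ S) = S.1 ∧
      amax (centre α β γ S) = S.2 := by
  have hne : S.1.Nonempty := Finset.card_ne_zero.1 (by rw [h1]; exact one_ne_zero)
  have e1 : ∀ i ∈ S.1, centre α β γ S i = α := fun i hi => if_pos hi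
  have e2 : ∀ i ∈ S.2, centre α β γ S i = β := fun i hi => by
    have h3 : i ∉ S.1 := fun h => Finset.disjoint_left.1 hd h hi
    simp [centre, hi, h3]
  have e3 : ∀ i, centre α β γ S i = α ∨ centre α β γ S i = β ∨ centre α β γ S i = γ := fun i => by
    simp only [centre]
    split_ifs <;> simp
  refine ⟨⟨fun m => ?_, ?_⟩, (amin_eq_iff hne).2 ⟨fun i hi j hj => ?_, fun i hi m hm => ?_⟩,
    (amax_eq_iff h2).2 ⟨fun i hi j hj => ?_, fun i hi m hm => ?_⟩⟩
  · rcases e3 m with h | h | h <;> rw [h] <;> linarith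
  · rw [sum_centre hd, h1, ← hs]
    push_cast
    ring
  · rw [e1 i hi, e1 j hj]
  · rw [e1 i hi]
    simp only [centre, hm, if_false]
    split_ifs <;> linarith
  · rw [e2 i hi, e2 j hj]
  · rw [e2 i hi]
    simp only [centre, hm, if_false]
    split_ifs <;> linarith

/-! ### The second cohomology of the polyhedron -/

variable {n : ℕ} (T : Triangulation n)

/-- The flags `(i, l, k)`: face `l` of the tetrahedron `i` together with its edge opposite to `k`
(degenerate if `l = k`). -/
abbrev Flag (n : ℕ) : Type := Fin n × Fin 4 × Fin 4

/-- The face pairings on flags. -/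
def glueFlag (a : Flag n) : Flag n :=
  (T.adj a.1 a.2.1, T.perm a.1 a.2.1 a.2.1, T.perm a.1 a.2.1 a.2.2)

theorem glueFlag_glueFlag (a : Flag n) : glueFlag T (glueFlag T a) = a := by
  simp [glueFlag, T.adj_adj, T.perm_adj]

theorem glueFlag_ne (a : Flag n) : glueFlag T a ≠ a := fun h => by
  simp only [glueFlag, Prod.ext_iff] at h
  exact T.ne_self a.1 a.2.1 (Prod.ext h.1 h.2.1)

/-- The integral functions on flags that are trivial as second cohomology classes. -/
def trivialFlags : Submodule ℤ (Flag n → ℤ) where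
  -- The three functions live on the components of the pairwise intersections: (vertex, edge),
  -- (edge, region), (vertex, region). Only the middle ones reach the faces of the blocks and have
  -- to respect the pairings. Values of `F` at `l = k` are unconstrained, so they disappear in the
  -- quotient.
  carrier := {F | ∃ (g₀₁ : Fin n → Fin 4 → ℤ) (g₁₂ : Flag n → ℤ)
    (g₀₂ : Fin n → Finset (Fin 4) → ℤ), (∀ a, g₁₂ (glueFlag T a) = g₁₂ a) ∧
      ∀ i l k, l ≠ k → F (i, l, k) = g₀₁ i l + g₁₂ (i, l, k) - g₀₂ i {l, k}}
  add_mem' := by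
    rintro F F' ⟨a, b, c, h1, h2⟩ ⟨a', b', c', h1', h2'⟩
    refine ⟨a + a', b + b', c + c', fun x => ?_, fun i l k h => ?_⟩
    · simp only [Pi.add_apply, h1, h1']
    · simp only [Pi.add_apply, h2 i l k h, h2' i l k h]
      ring
  zero_mem' := ⟨0, 0, 0, by simp, by simp⟩
  smul_mem' := by
    rintro r F ⟨a, b, c, h1, h2⟩
    refine ⟨r • a, r • b, r • c, fun x => ?_, fun i l k h => ?_⟩
    · simp only [Pi.smul_apply, h1]
    · simp only [Pi.smul_apply, h2 i l k h, smul_eq_mul]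
      ring

/-- The combinatorial model of the second cohomology of the polyhedron. -/
abbrev FlagClasses : Type := (Flag n → ℤ) ⧸ trivialFlags T

/-- The first three centres are the centre of the tetrahedron, the barycentre of a face and the
midpoint of an edge. The others are convenient points subject to the inequalities of `GoodCentre`; a
parameter not used by the label is free within them. -/
theorem spine_goodCentres :
    GoodCentre 2 ⟨true, false, false, false⟩ (1 / 4) (1 / 4) (1 / 4) ∧
    GoodCentre 2 ⟨false, true, false, false⟩ 0 (1 / 3) (1 / 3) ∧
    GoodCentre 2 ⟨false, false, false, true⟩ 0 (1 / 2) 0 ∧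
    GoodCentre 2 ⟨true, true, false, false⟩ (1 / 8) (1 / 4) (7 / 24) ∧
    GoodCentre 2 ⟨true, false, false, true⟩ (1 / 8) (3 / 8) (1 / 8) ∧
    GoodCentre 2 ⟨false, true, false, true⟩ 0 (3 / 8) (1 / 4) ∧
    GoodCentre 2 ⟨true, true, false, true⟩ (1 / 8) (5 / 16) (1 / 4) := by
  refine ⟨?_, ?_, ?_, ?_, ?_, ?_, ?_⟩ <;> constructor <;> norm_num

/-- The cover of the polyhedron by neighbourhoods of its vertices, edges and regions. -/
def spineCover (j : Fin 3) : Set T.dualPolyhedron :=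
  (spineGluing T).piece 2 (![⟨true, false, false, false⟩, ⟨false, true, false, false⟩,
    ⟨false, false, false, true⟩] j)

theorem spineCover_inter₀₁ : spineCover T 0 ∩ spineCover T 1 =
    (spineGluing T).piece 2 ⟨true, true, false, false⟩ := (spineGluing T).piece_inter

theorem spineCover_inter₀₂ : spineCover T 0 ∩ spineCover T 2 =
    (spineGluing T).piece 2 ⟨true, false, false, true⟩ := (spineGluing T).piece_inter

theorem spineCover_inter₁₂ : spineCover T 1 ∩ spineCover T 2 =
    (spineGluing T).piece 2 ⟨false, true, false, true⟩ := (spineGluing T).piece_inter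

theorem iInter_spineCover : ⋂ j, spineCover T j =
    (spineGluing T).piece 2 ⟨true, true, false, true⟩ := by
  refine Eq.trans ?_ (((spineGluing T).piece_inter (C := ⟨true, true, false, false⟩)
    (C' := ⟨false, false, false, true⟩)))
  rw [← spineCover_inter₀₁]
  ext x
  simp [Fin.forall_fin_succ, Set.mem_iInter, spineCover, and_assoc]

theorem isOpen_spineCover (j : Fin 3) : IsOpen (spineCover T j) := by
  obtain ⟨h0, h1, h2, -⟩ := spine_goodCentres
  fin_cases j
  exacts [(h0.isCentre_spine T).isOpen_piece, (h1.isCentre_spine T).isOpen_piece,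
    (h2.isCentre_spine T).isOpen_piece]

theorem contracts_spineCover (j : Fin 3) : Contracts (spineCover T j) := by
  obtain ⟨h0, h1, h2, -⟩ := spine_goodCentres
  fin_cases j
  exacts [(h0.isCentre_spine T).contracts, (h1.isCentre_spine T).contracts,
    (h2.isCentre_spine T).contracts]

theorem contracts_spineCover_inter (j j' : Fin 3) (h : j < j') :
    Contracts (spineCover T j ∩ spineCover T j') := by
  obtain ⟨-, -, -, h0, h1, h2, -⟩ := spine_goodCentres
  fin_cases j <;> fin_cases j' <;> simp at h
  · exact spineCover_inter₀₁ T ▸ (h0.isCentre_spine T).contracts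
  · exact spineCover_inter₀₂ T ▸ (h1.isCentre_spine T).contracts
  · exact spineCover_inter₁₂ T ▸ (h2.isCentre_spine T).contracts

theorem exists_mem_spineCover (x : T.dualPolyhedron) : ∃ j, x ∈ spineCover T j := by
  obtain ⟨y, rfl⟩ := (spineGluing T).isQuotientMap.surjective x
  rcases exists_sat_spine y.2.2 with h | h | h
  exacts [⟨0, (spineGluing T).proj_mem_piece.2 h⟩, ⟨1, (spineGluing T).proj_mem_piece.2 h⟩,
    ⟨2, (spineGluing T).proj_mem_piece.2 h⟩]

/-- The value of a function on flags at a label. -/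
def flagValue {A : Type} [AddCommMonoid A] (F : Fin 4 × Fin 4 → A)
    (S : Finset (Fin 4) × Finset (Fin 4)) : A :=
  ∑ l ∈ S.1, ∑ k ∈ (S.1 ∪ S.2)ᶜ, F (l, k)

theorem flagValue_eq {A : Type} [AddCommMonoid A] (F : Fin 4 × Fin 4 → A) {l k : Fin 4}
    (h : l ≠ k) : flagValue F ({l}, {l, k}ᶜ) = F (l, k) := by
  have : ({l} ∪ {l, k}ᶜ : Finset (Fin 4))ᶜ = {k} := by revert l k; decide
  simp only [flagValue, this, Finset.sum_singleton]

theorem eq_pair_of_card {s : Finset (Fin 4) × Finset (Fin 4)} (h1 : s.1.card = 1)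
    (h2 : s.2.card = 2) (h : Disjoint s.1 s.2) :
    ∃ l k, l ≠ k ∧ s = ({l}, {l, k}ᶜ) := by
  obtain ⟨S, S'⟩ := s
  obtain ⟨l, rfl⟩ := Finset.card_eq_one.1 h1
  revert S' l
  decide

theorem exists_flagPoint {l k : Fin 4} (h : l ≠ k) (i : Fin n) :
    ∃ y : Fin n × Spine, y.1 = i ∧ (∀ m, 0 < y.2.1.1 m) ∧ amin y.2.1.1 = {l} ∧
      amax y.2.1.1 = {l, k}ᶜ := by
  have hc : ({l, k}ᶜ : Finset (Fin 4)).card = 2 := by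
    rw [Finset.card_compl, Finset.card_pair h, Fintype.card_fin]
  obtain ⟨h1, h2, h3⟩ := exists_point (α := 1 / 8) (β := 5 / 16) (γ := 1 / 4)
    (S := ({l}, {l, k}ᶜ)) (Finset.card_singleton l)
    (Finset.card_ne_zero.1 (by rw [hc]; exact two_ne_zero)) (by simp) (by norm_num) (by norm_num)
    (by norm_num) (by rw [hc]; norm_num)
  refine ⟨(i, ⟨⟨_, h1⟩, mem_spineSet_iff_card.2 ⟨h1, by rw [h3, hc]⟩⟩), rfl, fun m => ?_, h2, h3⟩
  simp only [centre]
  split_ifs <;> norm_num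

theorem exists_faceFlagPoint {l k : Fin 4} (h : l ≠ k) (i : Fin n) :
    ∃ y : Fin n × Spine, y.1 = i ∧ y.2.1.1 l = 0 ∧ amin y.2.1.1 = {l} ∧
      amax y.2.1.1 = {l, k}ᶜ := by
  have hc : ({l, k}ᶜ : Finset (Fin 4)).card = 2 := by
    rw [Finset.card_compl, Finset.card_pair h, Fintype.card_fin]
  obtain ⟨h1, h2, h3⟩ := exists_point (α := 0) (β := 3 / 8) (γ := 1 / 4)
    (S := ({l}, {l, k}ᶜ)) (Finset.card_singleton l)
    (Finset.card_ne_zero.1 (by rw [hc]; exact two_ne_zero)) (by simp) (by norm_num) (by norm_num)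
    (by norm_num) (by rw [hc]; norm_num)
  exact ⟨(i, ⟨⟨_, h1⟩, mem_spineSet_iff_card.2 ⟨h1, by rw [h3, hc]⟩⟩), rfl, by simp [centre],
    h2, h3⟩

/-- A function on flags represents a cohomology class. -/
def FlagRepresents (φ : Simplex T.dualPolyhedron 2 → ℤ) (F : Flag n → ℤ) : Prop :=
  ∃ f, Represents (spineCover T) φ f ∧ ∀ y : Fin n × Spine,
    Sat 2 ⟨true, true, false, true⟩ y.2.1.1 → f ((spineGluing T).proj y) =
      flagValue (fun a => F (y.1, a)) (label ⟨true, true, false, true⟩ y.2.1.1)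

/-- Gluing involves only points with a vanishing coordinate, so compatibility is vacuous on pieces
inside the open blocks. -/
theorem rel_spine_absurd {y y' : Fin n × Spine} (h : (spineGluing T).rel y y') {C : Cond}
    (hC : C.a) (hS : Sat 2 C y.2.1.1) : False := by
  obtain ⟨l, hl, -⟩ := h
  exact absurd (hS.1 hC l) (by rw [show y.2.1.1 l = 0 from hl]; exact lt_irrefl 0)

theorem pathConst_of_flagValue {f : T.dualPolyhedron → ℤ} {F : Flag n → ℤ}
    (hf : ∀ y : Fin n × Spine,
      Sat 2 ⟨true, true, false, true⟩ y.2.1.1 → f ((spineGluing T).proj y) =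
      flagValue (fun a => F (y.1, a)) (label ⟨true, true, false, true⟩ y.2.1.1)) :
    PathConst (⋂ j, spineCover T j) f := by
  rw [iInter_spineCover]
  exact ((spine_goodCentres.2.2.2.2.2.2).isCentre_spine T).pathConst_iff.2
    ⟨fun i => flagValue fun a => F (i, a), hf⟩

/-- This is the Čech criterion with every path-constant function replaced by a function of labels.
-/
theorem FlagRepresents.mk_eq_zero_iff {φ : Simplex T.dualPolyhedron 2 → ℤ} {F : Flag n → ℤ}
    (hφ : coboundary φ = 0) (h : FlagRepresents T φ F) :
    F ∈ trivialFlags T ↔ ∃ ω, coboundary ω = φ := by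
  obtain ⟨f, hf, hF⟩ := h
  obtain ⟨-, -, -, h01, h02, h12, h012⟩ := spine_goodCentres
  rw [hf.exists_coboundary_eq_iff (isOpen_spineCover T) (exists_mem_spineCover T)
    (contracts_spineCover T) hφ]
  simp only [spineCover_inter₀₁, spineCover_inter₀₂, spineCover_inter₁₂,
    (h01.isCentre_spine T).pathConst_iff, (h02.isCentre_spine T).pathConst_iff,
    (h12.isCentre_spine T).pathConst_iff]
  constructor
  · rintro ⟨g₀₁, g₁₂, g₀₂, hg, hg'⟩
    obtain ⟨f₀₁, hf₀₁⟩ := (spineGluing T).exists_function_of_label (c := 2)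
      (C := ⟨true, true, false, false⟩) (fun i S => ∑ l ∈ S.1, g₀₁ i l)
      fun y y' h hS => (rel_spine_absurd T h rfl hS).elim
    -- A sector is labelled by its two largest indices, so `g₀₂` is evaluated at their complement
    -- `{l, k}`.
    obtain ⟨f₀₂, hf₀₂⟩ := (spineGluing T).exists_function_of_label (c := 2)
      (C := ⟨true, false, false, true⟩) (fun i S => g₀₂ i S.2ᶜ)
      fun y y' h hS => (rel_spine_absurd T h rfl hS).elim
    obtain ⟨f₁₂, hf₁₂⟩ := (spineGluing T).exists_function_of_label (c := 2)
      (C := ⟨false, true, false, true⟩) (fun i => flagValue fun a => g₁₂ (i, a))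
      fun y y' h hS => by
        obtain ⟨l, hl, rfl⟩ := h
        obtain ⟨l', k, hlk, hlab⟩ := eq_pair_of_card (s := label ⟨false, true, false, true⟩ y.2.1.1)
          (by simpa [label] using hS.2.1 rfl) (by simpa [label] using hS.2.2.2 rfl)
          (disjoint_label hS)
        obtain rfl : l' = l := by
          have h1 : l ∈ amin y.2.1.1 := mem_amin.2 fun m => by
            rw [show y.2.1.1 l = 0 from hl]
            exact y.2.1.2.1 m
          have h2 : amin y.2.1.1 = {l'} := by simpa [label] using congrArg Prod.fst hlab
          rw [h2, Finset.mem_singleton] at h1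
          exact h1.symm
        have e : (Spine.glue (T.perm y.1 l') y.2).1.1 =
          fun k => y.2.1.1 ((T.perm y.1 l').symm k) := rfl
        rw [e, label_permute, hlab, flagValue_eq _ hlk]
        have e2 : (({l', k}ᶜ : Finset (Fin 4)).map (T.perm y.1 l').toEmbedding) =
            {T.perm y.1 l' l', T.perm y.1 l' k}ᶜ := by
          ext m
          simp [Finset.mem_map_equiv, Equiv.symm_apply_eq]
        rw [Finset.map_singleton, e2]
        refine (hg (y.1, l', k)).symm.trans (Eq.symm (flagValue_eq
          (fun a => g₁₂ (T.adj y.1 l', a)) ?_))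
        exact fun h => hlk ((T.perm y.1 l').injective h)
    refine ⟨f₀₁, f₁₂, f₀₂, ⟨fun i S => ∑ l ∈ S.1, g₀₁ i l, hf₀₁⟩,
      ⟨fun i => flagValue fun a => g₁₂ (i, a), hf₁₂⟩, ⟨fun i S => g₀₂ i S.2ᶜ, hf₀₂⟩, fun x hx => ?_⟩
    have hx : x ∈ ⋂ j, spineCover T j := Set.mem_iInter.2 hx
    rw [iInter_spineCover] at hx
    obtain ⟨y, hy, rfl⟩ := hx
    obtain ⟨l, k, hlk, hlab⟩ := eq_pair_of_card (s := label ⟨true, true, false, true⟩ y.2.1.1)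
      (by simpa [label] using hy.2.1 rfl) (by simpa [label] using hy.2.2.2 rfl)
      (disjoint_label hy)
    rw [hF y hy, hf₀₁ y ⟨hy.1, hy.2.1, hy.2.2.1, by simp⟩,
      hf₁₂ y ⟨by simp, hy.2.1, hy.2.2.1, hy.2.2.2⟩,
      hf₀₂ y ⟨hy.1, by simp, hy.2.2.1, hy.2.2.2⟩]
    have e1 : amin y.2.1.1 = {l} := by simpa [label] using congrArg Prod.fst hlab
    have e2 : amax y.2.1.1 = {l, k}ᶜ := by simpa [label] using congrArg Prod.snd hlab
    simp only [label, if_true, e1, e2, flagValue_eq _ hlk, hg' y.1 l k hlk, Finset.sum_singleton,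
      compl_compl]
  · rintro ⟨g₀₁, g₁₂, g₀₂, ⟨G₀₁, h₀₁⟩, ⟨G₁₂, h₁₂⟩, ⟨G₀₂, h₀₂⟩, hg⟩
    refine ⟨fun i l => G₀₁ i ({l}, ∅),
      fun a => if a.2.1 = a.2.2 then 0 else G₁₂ a.1 ({a.2.1}, {a.2.1, a.2.2}ᶜ),
      fun i S => G₀₂ i (∅, Sᶜ), ?_, fun i l k hlk => ?_⟩
    · rintro ⟨i, l, k⟩
      simp only [glueFlag, EmbeddingLike.apply_eq_iff_eq]
      split_ifs with hlk
      · rfl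
      -- A point of face `l` with the given label belongs to both blocks, and reading the function
      -- on either side gives the invariance.
      obtain ⟨y, rfl, hy0, hy1, hy2⟩ := exists_faceFlagPoint hlk i
      have hS : Sat 2 ⟨false, true, false, true⟩ y.2.1.1 := ⟨by simp, fun _ => by simp [hy1],
        by simp, fun _ => by rw [hy2, Finset.card_compl, Finset.card_pair hlk, Fintype.card_fin]⟩
      have hrel : (spineGluing T).rel y (T.adj y.1 l, Spine.glue (T.perm y.1 l) y.2) :=
        ⟨l, hy0, rfl⟩
      have e : (Spine.glue (T.perm y.1 l) y.2).1.1 =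
          fun k => y.2.1.1 ((T.perm y.1 l).symm k) := rfl
      have a1 := h₁₂ y hS
      have a2 := h₁₂ (T.adj y.1 l, Spine.glue (T.perm y.1 l) y.2) (by
        simp only [e]
        exact (sat_permute _).2 hS)
      rw [← (spineGluing T).sound hrel, a1] at a2
      simp only [e, label_permute] at a2
      simp only [label, if_true, hy1, hy2] at a2
      rw [a2]
      congr 2
      ext m
      simp [Finset.mem_map_equiv, Equiv.symm_apply_eq]
    · obtain ⟨y, rfl, hy0, hy1, hy2⟩ := exists_flagPoint hlk i
      have hS : Sat 2 ⟨true, true, false, true⟩ y.2.1.1 := ⟨fun _ => hy0, fun _ => by simp [hy1],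
        by simp, fun _ => by rw [hy2, Finset.card_compl, Finset.card_pair hlk, Fintype.card_fin]⟩
      have a := hg ((spineGluing T).proj y) (fun j => Set.mem_iInter.1 (by
        rw [iInter_spineCover]; exact (spineGluing T).proj_mem_piece.2 hS) j)
      rw [hF y hS, h₀₁ y ⟨hS.1, hS.2.1, hS.2.2.1, by simp⟩,
        h₁₂ y ⟨by simp, hS.2.1, hS.2.2.1, hS.2.2.2⟩,
        h₀₂ y ⟨hS.1, by simp, hS.2.2.1, hS.2.2.2⟩] at a
      simpa only [label, hy1, hy2, flagValue_eq _ hlk, hlk, if_true, if_false, Bool.false_eq_true,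
        compl_compl] using a

/-- The second cohomology of the polyhedron. -/
theorem nonempty_cohomology_dualPolyhedron_equiv :
    Nonempty (singularCohomology 2 T.dualPolyhedron ≃ₗ[ℤ] FlagClasses T) := by
  refine nonempty_singularCohomology_two_equiv (trivialFlags T).mkQ
    (Submodule.mkQ_surjective _) (FlagRepresents T) ?_ ?_ ?_ ?_ ?_
  · rintro φ φ' F F' ⟨f, h1, h2⟩ ⟨f', h1', h2'⟩
    refine ⟨f + f', h1.add h1', fun y hy => ?_⟩
    simp only [Pi.add_apply, h2 y hy, h2' y hy, flagValue, Finset.sum_add_distrib]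
  · rintro r φ F ⟨f, h1, h2⟩
    refine ⟨r • f, h1.zsmul r, fun y hy => ?_⟩
    simp only [Pi.smul_apply, h2 y hy, flagValue, Finset.smul_sum]
  · intro φ hφ
    obtain ⟨f, hf, hr⟩ := exists_represents (contracts_spineCover T)
      (contracts_spineCover_inter T) φ hφ
    rw [iInter_spineCover, (spine_goodCentres.2.2.2.2.2.2.isCentre_spine T).pathConst_iff] at hf
    obtain ⟨g, hg⟩ := hf
    refine ⟨fun a => g a.1 ({a.2.1}, {a.2.1, a.2.2}ᶜ), f, hr, fun y hy => ?_⟩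
    obtain ⟨l, k, hlk, hlab⟩ := eq_pair_of_card (s := label ⟨true, true, false, true⟩ y.2.1.1)
      (by simpa [label] using hy.2.1 rfl) (by simpa [label] using hy.2.2.2 rfl)
      (disjoint_label hy)
    rw [hg y hy, hlab, flagValue_eq _ hlk]
  · intro F
    obtain ⟨f, hf⟩ := (spineGluing T).exists_function_of_label (c := 2)
      (C := ⟨true, true, false, true⟩) (fun i => flagValue fun a => F (i, a))
      fun y y' h hS => (rel_spine_absurd T h rfl hS).elim
    obtain ⟨φ, hφ, hr⟩ := exists_cocycle_represents (isOpen_spineCover T)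
      (exists_mem_spineCover T) f (pathConst_of_flagValue T hf)
    exact ⟨φ, hφ, f, hr, hf⟩
  · intro φ F hφ h
    rw [Submodule.mkQ_apply, Submodule.Quotient.mk_eq_zero]
    exact h.mk_eq_zero_iff T hφ

end Block

namespace Block

open Singular

/-! ### The first cohomology of the manifold -/

variable {n : ℕ} (T : Triangulation n)

/-- The conjunction of conditions. -/
def Cond.or (C C' : Cond) : Cond := ⟨C.a || C'.a, C.u || C'.u, C.b || C'.b, C.v || C'.v⟩

/-- The conditions that define the pieces of the manifold. -/
def octahedronCond : Fin 4 → Cond := ![⟨true, false, true, false⟩, ⟨false, true, true, false⟩,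
  ⟨true, false, false, true⟩, ⟨false, true, false, true⟩]

/-- The cover of the manifold by the interiors of the octahedra and neighbourhoods of the white
faces, of the black faces and of the edges. -/
def octahedronCover (j : Fin 4) : Set T.D := (octahedronGluing T).piece 1 (octahedronCond j)

theorem octahedronCover_inter (j j' : Fin 4) : octahedronCover T j ∩ octahedronCover T j' =
    (octahedronGluing T).piece 1 ((octahedronCond j).or (octahedronCond j')) :=
  (octahedronGluing T).piece_inter

theorem octahedron_goodCentres :
    GoodCentre 1 ⟨true, false, true, false⟩ (1 / 4) (1 / 4) (1 / 4) ∧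
    GoodCentre 1 ⟨false, true, true, false⟩ 0 (1 / 3) (1 / 3) ∧
    GoodCentre 1 ⟨true, false, false, true⟩ (1 / 6) (1 / 2) (1 / 6) ∧
    GoodCentre 1 ⟨false, true, false, true⟩ 0 (1 / 2) (1 / 4) ∧
    GoodCentre 1 ⟨true, true, true, false⟩ (1 / 8) (1 / 4) (7 / 24) ∧
    GoodCentre 1 ⟨true, false, true, true⟩ (5 / 24) (3 / 8) (5 / 24) ∧
    GoodCentre 1 ⟨true, true, true, true⟩ (1 / 8) (3 / 8) (1 / 4) ∧
    GoodCentre 1 ⟨false, true, true, true⟩ 0 (3 / 8) (5 / 16) ∧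
    GoodCentre 1 ⟨true, true, false, true⟩ (1 / 8) (1 / 2) (3 / 16) := by
  refine ⟨?_, ?_, ?_, ?_, ?_, ?_, ?_, ?_, ?_⟩ <;> constructor <;> norm_num

/-- The sixteen pairs give only nine conditions, because the pairs `{0, 3}` and `{1, 2}` both impose
all four requirements. -/
theorem exists_isCentre_inter (j j' : Fin 4) : ∃ α β γ : ℝ,
    (octahedronGluing T).IsCentre 1 ((octahedronCond j).or (octahedronCond j')) α β γ := by
  obtain ⟨h0, h1, h2, h3, h01, h02, h03, h13, h23⟩ := octahedron_goodCentres
  fin_cases j <;> fin_cases j' <;>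
    first
    | exact ⟨_, _, _, h0.isCentre_octahedron T (by simp)⟩
    | exact ⟨_, _, _, h1.isCentre_octahedron T (by simp)⟩
    | exact ⟨_, _, _, h2.isCentre_octahedron T (by simp)⟩
    | exact ⟨_, _, _, h3.isCentre_octahedron T (by simp)⟩
    | exact ⟨_, _, _, h01.isCentre_octahedron T (by simp)⟩
    | exact ⟨_, _, _, h02.isCentre_octahedron T (by simp)⟩
    | exact ⟨_, _, _, h03.isCentre_octahedron T (by simp)⟩
    | exact ⟨_, _, _, h13.isCentre_octahedron T (by simp)⟩
    | exact ⟨_, _, _, h23.isCentre_octahedron T (by simp)⟩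

theorem Cond.or_self (C : Cond) : C.or C = C := by simp [Cond.or]

theorem exists_isCentre (j : Fin 4) : ∃ α β γ : ℝ,
    (octahedronGluing T).IsCentre 1 (octahedronCond j) α β γ := by
  simpa only [Cond.or_self] using exists_isCentre_inter T j j

theorem isOpen_octahedronCover (j : Fin 4) : IsOpen (octahedronCover T j) := by
  obtain ⟨_, _, _, h⟩ := exists_isCentre T j
  exact h.isOpen_piece

theorem contracts_octahedronCover (j : Fin 4) : Contracts (octahedronCover T j) := by
  obtain ⟨_, _, _, h⟩ := exists_isCentre T j
  exact h.contracts

theorem exists_mem_octahedronCover (x : T.D) : ∃ j, x ∈ octahedronCover T j := by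
  obtain ⟨y, rfl⟩ := (octahedronGluing T).isQuotientMap.surjective x
  rcases exists_sat_octahedron y.2 with h | h | h | h
  exacts [⟨0, (octahedronGluing T).proj_mem_piece.2 h⟩,
    ⟨1, (octahedronGluing T).proj_mem_piece.2 h⟩, ⟨2, (octahedronGluing T).proj_mem_piece.2 h⟩,
    ⟨3, (octahedronGluing T).proj_mem_piece.2 h⟩]

theorem pathConst_octahedronCover_inter_iff {A : Type} [AddCommGroup A] (j j' : Fin 4)
    {f : T.D → A} : PathConst (octahedronCover T j ∩ octahedronCover T j') f ↔
      ∃ g : Fin n × ℤˣ → Finset (Fin 4) × Finset (Fin 4) → A, ∀ y : (Fin n × ℤˣ) × Octahedron,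
        Sat 1 ((octahedronCond j).or (octahedronCond j')) y.2.1.1 →
          f (octahedronProj T y) =
            g y.1 (label ((octahedronCond j).or (octahedronCond j')) y.2.1.1) := by
  obtain ⟨_, _, _, h⟩ := exists_isCentre_inter T j j'
  rw [octahedronCover_inter]
  exact h.pathConst_iff

theorem pathConst_octahedronCover_iff {A : Type} [AddCommGroup A] (j : Fin 4)
    {f : T.D → A} : PathConst (octahedronCover T j) f ↔
      ∃ g : Fin n × ℤˣ → Finset (Fin 4) × Finset (Fin 4) → A, ∀ y : (Fin n × ℤˣ) × Octahedron,
        Sat 1 (octahedronCond j) y.2.1.1 →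
          f (octahedronProj T y) = g y.1 (label (octahedronCond j) y.2.1.1) := by
  obtain ⟨_, _, _, h⟩ := exists_isCentre T j
  exact h.pathConst_iff

/-- The face pairings on the octahedra. -/
def glueOct (q : Fin n × ℤˣ) (l : Fin 4) : Fin n × ℤˣ :=
  (T.adj q.1 l, -(Equiv.Perm.sign (T.perm q.1 l)) * q.2)

theorem exists_octahedronPoint {l k : Fin 4} (h : l ≠ k) (q : Fin n × ℤˣ) :
    ∃ y : (Fin n × ℤˣ) × Octahedron, y.1 = q ∧ (∀ m, 0 < y.2.1.1 m) ∧ (∀ m, y.2.1.1 m < 1 / 2) ∧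
      amin y.2.1.1 = {l} ∧ amax y.2.1.1 = {k} := by
  obtain ⟨h1, h2, h3⟩ := exists_point (α := 1 / 8) (β := 3 / 8) (γ := 1 / 4)
    (S := ({l}, {k})) (Finset.card_singleton l) (Finset.singleton_nonempty k)
    (by simpa using h) (by norm_num) (by norm_num) (by norm_num) (by norm_num)
  have h4 : ∀ m, centre (1 / 8) (3 / 8) (1 / 4) ({l}, {k}) m < 1 / 2 := fun m => by
    simp only [centre]
    split_ifs <;> norm_num
  refine ⟨(q, ⟨⟨_, h1⟩, fun m => (h4 m).le, ?_⟩), rfl, fun m => ?_, h4, h2, h3⟩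
  · rintro ⟨i, j, -, hi, -⟩
    exact (h4 i).ne hi
  · simp only [centre]
    split_ifs <;> norm_num

theorem exists_whitePoint {l k : Fin 4} (h : l ≠ k) (q : Fin n × ℤˣ) :
    ∃ y : (Fin n × ℤˣ) × Octahedron, y.1 = q ∧ y.2.1.1 l = 0 ∧ (∀ m, y.2.1.1 m < 1 / 2) ∧
      amin y.2.1.1 = {l} ∧ amax y.2.1.1 = {k} := by
  obtain ⟨h1, h2, h3⟩ := exists_point (α := 0) (β := 3 / 8) (γ := 5 / 16)
    (S := ({l}, {k})) (Finset.card_singleton l) (Finset.singleton_nonempty k)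
    (by simpa using h) (by norm_num) (by norm_num) (by norm_num) (by norm_num)
  have h4 : ∀ m, centre 0 (3 / 8) (5 / 16) ({l}, {k}) m < 1 / 2 := fun m => by
    simp only [centre]
    split_ifs <;> norm_num
  refine ⟨(q, ⟨⟨_, h1⟩, fun m => (h4 m).le, ?_⟩), rfl, by simp [centre], h4, h2, h3⟩
  rintro ⟨i, j, -, hi, -⟩
  exact (h4 i).ne hi

theorem exists_blackPoint {l k : Fin 4} (h : l ≠ k) (q : Fin n × ℤˣ) :
    ∃ y : (Fin n × ℤˣ) × Octahedron, y.1 = q ∧ (∀ m, 0 < y.2.1.1 m) ∧ y.2.1.1 k = 1 / 2 ∧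
      amin y.2.1.1 = {l} ∧ amax y.2.1.1 = {k} := by
  obtain ⟨h1, h2, h3⟩ := exists_point (α := 1 / 8) (β := 1 / 2) (γ := 3 / 16)
    (S := ({l}, {k})) (Finset.card_singleton l) (Finset.singleton_nonempty k)
    (by simpa using h) (by norm_num) (by norm_num) (by norm_num) (by norm_num)
  have h4 : ∀ m, centre (1 / 8) (1 / 2) (3 / 16) ({l}, {k}) m ≤ 1 / 2 := fun m => by
    simp only [centre]
    split_ifs <;> norm_num
  have h5 : ∀ m, centre (1 / 8) (1 / 2) (3 / 16) ({l}, {k}) m = 1 / 2 → m = k := fun m => by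
    simp only [centre, Finset.mem_singleton]
    split_ifs with h6 h7 <;> norm_num
    exact h7
  refine ⟨(q, ⟨⟨_, h1⟩, h4, ?_⟩), rfl, fun m => ?_, by simp [centre, h.symm], h2, h3⟩
  · rintro ⟨i, j, hij, hi, hj⟩
    exact hij ((h5 i hi).trans (h5 j hj).symm)
  · simp only [centre]
    split_ifs <;> norm_num

/-- Differences of potentials of a cocycle on the pieces, in terms of the octahedra (`w` for white
faces, `b` for black faces, `e` for edges). -/
structure HasData {A : Type} [AddCommGroup A] (ψ : Simplex T.D 1 → A)
    (w b : Fin n × ℤˣ → Fin 4 → A) (e : Fin n × ℤˣ → Fin 4 → Fin 4 → A)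
    (p : Fin 4 → T.D → A) : Prop where
  potential : ∀ c (σ : Simplex T.D 1), (∀ t, σ t ∈ octahedronCover T c) → ψ σ = edgeDiff (p c) σ
  white : ∀ (y : (Fin n × ℤˣ) × Octahedron) (l : Fin 4), Sat 1 ⟨true, true, true, false⟩ y.2.1.1 →
    amin y.2.1.1 = {l} → p 0 (octahedronProj T y) - p 1 (octahedronProj T y) = w y.1 l
  black : ∀ (y : (Fin n × ℤˣ) × Octahedron) (k : Fin 4), Sat 1 ⟨true, false, true, true⟩ y.2.1.1 →
    amax y.2.1.1 = {k} → p 0 (octahedronProj T y) - p 2 (octahedronProj T y) = b y.1 k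
  edge : ∀ (y : (Fin n × ℤˣ) × Octahedron) (l k : Fin 4), Sat 1 ⟨true, true, true, true⟩ y.2.1.1 →
    amin y.2.1.1 = {l} → amax y.2.1.1 = {k} →
    p 0 (octahedronProj T y) - p 3 (octahedronProj T y) = e y.1 l k
  white_edge : ∀ (y : (Fin n × ℤˣ) × Octahedron) (l k : Fin 4),
    Sat 1 ⟨false, true, true, true⟩ y.2.1.1 → amin y.2.1.1 = {l} → amax y.2.1.1 = {k} →
    p 1 (octahedronProj T y) - p 3 (octahedronProj T y) = e y.1 l k - w y.1 l
  black_edge : ∀ (y : (Fin n × ℤˣ) × Octahedron) (l k : Fin 4),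
    Sat 1 ⟨true, true, false, true⟩ y.2.1.1 → amin y.2.1.1 = {l} → amax y.2.1.1 = {k} →
    p 2 (octahedronProj T y) - p 3 (octahedronProj T y) = e y.1 l k - b y.1 k

/-- Invariance of functions under the pairings of the white faces. -/
def WhiteInv {A : Type} (w : Fin n × ℤˣ → Fin 4 → A) : Prop :=
  ∀ q l, w (glueOct T q l) (T.perm q.1 l l) = w q l

/-- Invariance of functions under the mirroring in the black faces. -/
def BlackInv {A : Type} (b : Fin n × ℤˣ → Fin 4 → A) : Prop :=
  ∀ i ε ε' k, b (i, ε) k = b (i, ε') k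

/-- The compatibility of differences of potentials. -/
structure Compat {A : Type} [AddCommGroup A] (w b : Fin n × ℤˣ → Fin 4 → A)
    (e : Fin n × ℤˣ → Fin 4 → Fin 4 → A) : Prop where
  white : ∀ q l k, l ≠ k →
    e (glueOct T q l) (T.perm q.1 l l) (T.perm q.1 l k) - w (glueOct T q l) (T.perm q.1 l l) =
      e q l k - w q l
  black : ∀ i ε ε' l k, l ≠ k → e (i, ε) l k - b (i, ε) k = e (i, ε') l k - b (i, ε') k

section

variable {A : Type} [AddCommGroup A]

theorem exists_hasData (ψ : Simplex T.D 1 → A) (hψ : coboundary ψ = 0) :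
    ∃ w b e p, HasData T ψ w b e p := by
  obtain ⟨p, hp⟩ := exists_potentials (contracts_octahedronCover T) ψ hψ
  have h := pathConst_potentials hp
  obtain ⟨g01, h01⟩ := (pathConst_octahedronCover_inter_iff T 0 1).1 (h 0 1)
  obtain ⟨g02, h02⟩ := (pathConst_octahedronCover_inter_iff T 0 2).1 (h 0 2)
  obtain ⟨g03, h03⟩ := (pathConst_octahedronCover_inter_iff T 0 3).1 (h 0 3)
  obtain ⟨g13, h13⟩ := (pathConst_octahedronCover_inter_iff T 1 3).1 (h 1 3)
  obtain ⟨g23, h23⟩ := (pathConst_octahedronCover_inter_iff T 2 3).1 (h 2 3)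
  have k01 : ∀ (y : (Fin n × ℤˣ) × Octahedron) (l : Fin 4),
      Sat 1 ⟨true, true, true, false⟩ y.2.1.1 → amin y.2.1.1 = {l} →
      p 0 (octahedronProj T y) - p 1 (octahedronProj T y) = g01 y.1 ({l}, ∅) := fun y l hy hl => by
    rw [← hl]; exact h01 y hy
  have k02 : ∀ (y : (Fin n × ℤˣ) × Octahedron) (k : Fin 4),
      Sat 1 ⟨true, false, true, true⟩ y.2.1.1 → amax y.2.1.1 = {k} →
      p 0 (octahedronProj T y) - p 2 (octahedronProj T y) = g02 y.1 (∅, {k}) := fun y l hy hl => by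
    rw [← hl]; exact h02 y hy
  have k03 : ∀ (y : (Fin n × ℤˣ) × Octahedron) (l k : Fin 4),
      Sat 1 ⟨true, true, true, true⟩ y.2.1.1 → amin y.2.1.1 = {l} → amax y.2.1.1 = {k} →
      p 0 (octahedronProj T y) - p 3 (octahedronProj T y) = g03 y.1 ({l}, {k}) :=
    fun y l k hy hl hk => by rw [← hl, ← hk]; exact h03 y hy
  have hne : ∀ (y : (Fin n × ℤˣ) × Octahedron) (l k : Fin 4), amin y.2.1.1 = {l} →
      amax y.2.1.1 = {k} → l ≠ k := fun y l k h1 h2 => by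
    have := disjoint_amin_amax (x := y.2.1.1) (by simp [h1])
    simpa [h1, h2] using this
  refine ⟨fun q l => g01 q ({l}, ∅), fun q k => g02 q (∅, {k}), fun q l k => g03 q ({l}, {k}), p,
    hp, k01, k02, k03, fun y l k hy hl hk => ?_, fun y l k hy hl hk => ?_⟩
  all_goals
    -- The point `y'` has the same label as `y` and lies in all four pieces. The differences can be
    -- composed there, and path-constancy carries the result back to `y`.
    obtain ⟨y', hq, hpos, hlt, hmin, hmax⟩ := exists_octahedronPoint (hne y l k hl hk) y.1
    have a1 := k01 y' l ⟨fun _ => hpos, fun _ => by simp [hmin], fun _ => hlt, by simp⟩ hmin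
    have a2 := k02 y' k ⟨fun _ => hpos, by simp, fun _ => hlt, fun _ => by simp [hmax]⟩ hmax
    have a3 := k03 y' l k ⟨fun _ => hpos, fun _ => by simp [hmin], fun _ => hlt,
      fun _ => by simp [hmax]⟩ hmin hmax
  · have b1 := h13 y hy
    have b2 := h13 y' ⟨by simp [octahedronCond, Cond.or],
      fun _ => by simp [hmin], fun _ => hlt, fun _ => by simp [hmax]⟩
    change _ = g13 y.1 (amin _, amax _) at b1
    change _ = g13 y'.1 (amin _, amax _) at b2
    rw [hl, hk] at b1
    rw [hmin, hmax, hq, ← b1] at b2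
    simp only [Pi.sub_apply] at b2
    rw [← b2, ← hq, ← a1, ← a3]
    abel
  · have b1 := h23 y hy
    have b2 := h23 y' ⟨fun _ => hpos, fun _ => by simp [hmin],
      by simp [octahedronCond, Cond.or], fun _ => by simp [hmax]⟩
    change _ = g23 y.1 (amin _, amax _) at b1
    change _ = g23 y'.1 (amin _, amax _) at b2
    rw [hl, hk] at b1
    rw [hmin, hmax, hq, ← b1] at b2
    simp only [Pi.sub_apply] at b2
    rw [← b2, ← hq, ← a2, ← a3]
    abel

variable {T} in
theorem amin_permute_eq {y : Octahedron} {l : Fin 4} (h : amin y.1.1 = {l})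
    (σ : Equiv.Perm (Fin 4)) : amin (y.permute σ).1.1 = {σ l} := by
  refine (amin_permute y.1.1 σ).trans ?_
  rw [h, Finset.map_singleton]
  rfl

theorem amax_permute_eq {y : Octahedron} {l : Fin 4} (h : amax y.1.1 = {l})
    (σ : Equiv.Perm (Fin 4)) : amax (y.permute σ).1.1 = {σ l} := by
  refine (amax_permute y.1.1 σ).trans ?_
  rw [h, Finset.map_singleton]
  rfl

theorem sat_permute_iff {y : Octahedron} {C : Cond} (σ : Equiv.Perm (Fin 4)) :
    Sat 1 C (y.permute σ).1.1 ↔ Sat 1 C y.1.1 := sat_permute σ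

theorem octahedronProj_glue (y : (Fin n × ℤˣ) × Octahedron) (l : Fin 4) (h : y.2.1.1 l = 0) :
    octahedronProj T (glueOct T y.1 l, y.2.permute (T.perm y.1.1 l)) = octahedronProj T y :=
  ((octahedronGluing T).sound (Or.inl ⟨l, h, rfl⟩)).symm

theorem octahedronProj_mirror (i : Fin n) (ε ε' : ℤˣ) (x : Octahedron) (k : Fin 4)
    (h : x.1.1 k = 1 / 2) : octahedronProj T ((i, ε), x) = octahedronProj T ((i, ε'), x) :=
  (octahedronGluing T).sound (Or.inr ⟨k, h, rfl, rfl⟩)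

variable {T}

/-- The jump at an edge is computed from both sides of a point on a white face, respectively in both
copies of a point on a black face. -/
theorem HasData.compat {ψ : Simplex T.D 1 → A} {w b e p} (h : HasData T ψ w b e p) :
    Compat T w b e where
  white q l k hlk := by
    obtain ⟨y, rfl, h0, hlt, hmin, hmax⟩ := exists_whitePoint hlk q
    have hS : Sat 1 ⟨false, true, true, true⟩ y.2.1.1 :=
      ⟨by simp, fun _ => by simp [hmin], fun _ => hlt, fun _ => by simp [hmax]⟩
    rw [← h.white_edge y l k hS hmin hmax, ← h.white_edge
      (glueOct T y.1 l, y.2.permute (T.perm y.1.1 l)) _ _ ((sat_permute_iff _).2 hS)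
      (amin_permute_eq hmin _) (amax_permute_eq hmax _), octahedronProj_glue T y l h0]
  black i ε ε' l k hlk := by
    obtain ⟨⟨-, x⟩, rfl, h0, hlt, hmin, hmax⟩ := exists_blackPoint hlk (i, ε)
    have hS : Sat 1 ⟨true, true, false, true⟩ x.1.1 :=
      ⟨fun _ => h0, fun _ => by simp [hmin], by simp, fun _ => by simp [hmax]⟩
    rw [← h.black_edge ((i, ε), x) l k hS hmin hmax, ← h.black_edge ((i, ε'), x) l k hS hmin hmax,
      octahedronProj_mirror T i ε ε' x k hlt]

theorem HasData.sub {ψ ψ' : Simplex T.D 1 → A} {w b e p w' b' e' p'}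
    (h : HasData T ψ w b e p) (h' : HasData T ψ' w' b' e' p') :
    HasData T (ψ - ψ') (w - w') (b - b') (e - e') (p - p') where
  potential c σ hσ := by
    rw [Pi.sub_apply, Pi.sub_apply, h.potential c σ hσ, h'.potential c σ hσ, edgeDiff_sub,
      Pi.sub_apply]
  white y l hy hl := by
    simp only [Pi.sub_apply]
    rw [← h.white y l hy hl, ← h'.white y l hy hl, sub_sub_sub_comm]
  black y l hy hl := by
    simp only [Pi.sub_apply]
    rw [← h.black y l hy hl, ← h'.black y l hy hl, sub_sub_sub_comm]
  edge y l k hy hl hk := by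
    simp only [Pi.sub_apply]
    rw [← h.edge y l k hy hl hk, ← h'.edge y l k hy hl hk, sub_sub_sub_comm]
  white_edge y l k hy hl hk := by
    simp only [Pi.sub_apply]
    rw [sub_sub_sub_comm, h.white_edge y l k hy hl hk, h'.white_edge y l k hy hl hk,
      sub_sub_sub_comm]
  black_edge y l k hy hl hk := by
    simp only [Pi.sub_apply]
    rw [sub_sub_sub_comm, h.black_edge y l k hy hl hk, h'.black_edge y l k hy hl hk,
      sub_sub_sub_comm]

theorem HasData.map {B : Type} [AddCommGroup B] (f : A →+ B) {ψ : Simplex T.D 1 → A} {w b e p}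
    (h : HasData T ψ w b e p) : HasData T (fun σ => f (ψ σ)) (fun q l => f (w q l))
      (fun q l => f (b q l)) (fun q l k => f (e q l k)) (fun c x => f (p c x)) where
  potential c σ hσ := by
    rw [h.potential c σ hσ, edgeDiff, map_sub]
    rfl
  white y l hy hl := by rw [← map_sub, h.white y l hy hl]
  black y l hy hl := by rw [← map_sub, h.black y l hy hl]
  edge y l k hy hl hk := by rw [← map_sub, h.edge y l k hy hl hk]
  white_edge y l k hy hl hk := by rw [← map_sub, ← map_sub, h.white_edge y l k hy hl hk]
  black_edge y l k hy hl hk := by rw [← map_sub, ← map_sub, h.black_edge y l k hy hl hk]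

end

end Block

/-! ### Cocycles on the manifold versus compatible data -/

namespace Block

open Singular

variable {n : ℕ} {T : Triangulation n} {A : Type} [AddCommGroup A]

theorem sat_or {c : ℕ} {C C' : Cond} {x : Fin 4 → ℝ} :
    Sat c (C.or C') x ↔ Sat c C x ∧ Sat c C' x := by
  simp only [Sat, Cond.or, Bool.or_eq_true, or_imp]
  tauto

theorem Sat.exists_amin {C : Cond} {x : Fin 4 → ℝ} (h : Sat 1 C x) (hu : C.u) :
    ∃ l, amin x = {l} := Finset.card_eq_one.1 (h.2.1 hu)

theorem Sat.exists_amax {C : Cond} {x : Fin 4 → ℝ} (h : Sat 1 C x) (hv : C.v) :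
    ∃ l, amax x = {l} := Finset.card_eq_one.1 (h.2.2.2 hv)

theorem ne_of_amin_eq {x : Fin 4 → ℝ} {l k : Fin 4} (h1 : amin x = {l}) (h2 : amax x = {k}) :
    l ≠ k := by
  simpa [h1, h2] using disjoint_amin_amax (x := x) (by simp [h1])

/-- A face coordinate that vanishes is the smallest one. -/
theorem eq_of_amin_eq {x : Octahedron} {l l' : Fin 4} (h : amin x.1.1 = {l}) (hl : x.1.1 l' = 0) :
    l = l' := by
  have : l' ∈ amin x.1.1 := mem_amin.2 fun m => hl.le.trans (x.1.2.1 m)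
  rw [h, Finset.mem_singleton] at this
  exact this.symm

/-- Invariance under the gluing of the octahedra, face by face. -/
theorem rel_cases {C : Cond} {B : Type} (f : (Fin n × ℤˣ) × Octahedron → B)
    (hw : C.a = false → ∀ y l, Sat 1 C y.2.1.1 → y.2.1.1 l = 0 →
      f (glueOct T y.1 l, y.2.permute (T.perm y.1.1 l)) = f y)
    (hb : C.b = false → ∀ i ε ε' x, Sat 1 C x.1.1 → f ((i, ε), x) = f ((i, ε'), x))
    {y y'} (h : octahedronRel T y y') (hS : Sat 1 C y.2.1.1) : f y = f y' := by
  rcases h with ⟨l, hl, rfl⟩ | ⟨k, hk, h1, h2⟩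
  · refine (hw ?_ y l hS hl).symm
    by_contra ha
    exact absurd (hS.1 (by simpa using ha) l) (by rw [hl]; exact lt_irrefl 0)
  · obtain ⟨⟨i, ε⟩, x⟩ := y
    obtain ⟨⟨i', ε'⟩, x'⟩ := y'
    dsimp only at h1 h2
    subst h1 h2
    refine hb ?_ i' ε ε' x' hS
    by_contra hb'
    exact absurd (hS.2.2.1 (by simpa using hb') k) (by rw [hk]; exact lt_irrefl _)

/-- The value of the data at labels. -/
def theta (w b : Fin n × ℤˣ → Fin 4 → A) (e : Fin n × ℤˣ → Fin 4 → Fin 4 → A) (c : Fin 4)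
    (q : Fin n × ℤˣ) (S : Finset (Fin 4) × Finset (Fin 4)) : A :=
  match c with
  | 0 => 0
  | 1 => ∑ l ∈ S.1, w q l
  | 2 => ∑ k ∈ S.2, b q k
  | 3 => ∑ l ∈ S.1, ∑ k ∈ S.2, e q l k

theorem theta_label (w b : Fin n × ℤˣ → Fin 4 → A) (e : Fin n × ℤˣ → Fin 4 → Fin 4 → A)
    (c : Fin 4) {C : Cond} (hu : (octahedronCond c).u → C.u) (hv : (octahedronCond c).v → C.v)
    (q : Fin n × ℤˣ) (x : Fin 4 → ℝ) :
    theta w b e c q (label C x) = theta w b e c q (amin x, amax x) := by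
  fin_cases c <;> simp_all [theta, label, octahedronCond]

theorem Compat.exists_potentials {w b : Fin n × ℤˣ → Fin 4 → A} {e} (h : Compat T w b e) :
    ∃ p : Fin 4 → T.D → A, ∀ c d (y : (Fin n × ℤˣ) × Octahedron),
      Sat 1 ((octahedronCond c).or (octahedronCond d)) y.2.1.1 →
      p c (octahedronProj T y) - p d (octahedronProj T y) =
        theta w b e d y.1 (amin y.2.1.1, amax y.2.1.1) -
          theta w b e c y.1 (amin y.2.1.1, amax y.2.1.1) := by
  classical
  have hsurj : Function.Surjective (octahedronProj T) :=
    (octahedronGluing T).isQuotientMap.surjective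
  choose r hr using hsurj
  let θ (c : Fin 4) (y : (Fin n × ℤˣ) × Octahedron) : A :=
    theta w b e c y.1 (amin y.2.1.1, amax y.2.1.1)
  -- These potentials depend on the chosen preimages `r x`; only their differences on overlaps are
  -- invariant under the gluing.
  refine ⟨fun c x => -θ c (r x), fun c d y hy => ?_⟩
  have key : ∀ c d (y : (Fin n × ℤˣ) × Octahedron),
      Sat 1 ((octahedronCond c).or (octahedronCond d)) y.2.1.1 → ∀ y', octahedronRel T y y' →
      θ d y - θ c y = θ d y' - θ c y' := by
    intro c d y hy y' hrel
    -- Among overlaps of distinct pieces, only that of white faces and edges meets the white gluing,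
    -- and only that of black faces and edges the mirroring.
    have hwhite : ∀ c d, c < d → ((octahedronCond c).or (octahedronCond d)).a = false →
        c = 1 ∧ d = 3 := by decide
    have hblack : ∀ c d, c < d → ((octahedronCond c).or (octahedronCond d)).b = false →
        c = 2 ∧ d = 3 := by decide
    have key' : ∀ c d, c < d → ∀ (y : (Fin n × ℤˣ) × Octahedron),
        Sat 1 ((octahedronCond c).or (octahedronCond d)) y.2.1.1 → ∀ y', octahedronRel T y y' →
        θ d y - θ c y = θ d y' - θ c y' := by
      intro c d hcd y hy y' hrel
      refine rel_cases (fun y => θ d y - θ c y) ?_ ?_ hrel hy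
      · intro ha y l hy hl
        obtain ⟨rfl, rfl⟩ := hwhite c d hcd ha
        obtain ⟨l', hmin⟩ := hy.exists_amin rfl
        obtain ⟨k, hmax⟩ := hy.exists_amax rfl
        obtain rfl := eq_of_amin_eq hmin hl
        have := h.white y.1 l' k (ne_of_amin_eq hmin hmax)
        simpa [θ, theta, hmin, hmax, amin_permute_eq hmin, amax_permute_eq hmax] using this
      · intro hb i ε ε' x hx
        obtain ⟨rfl, rfl⟩ := hblack c d hcd hb
        obtain ⟨l', hmin⟩ := hx.exists_amin rfl
        obtain ⟨k, hmax⟩ := hx.exists_amax rfl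
        have := h.black i ε ε' l' k (ne_of_amin_eq hmin hmax)
        simpa [θ, theta, hmin, hmax] using this
    rcases lt_trichotomy c d with hcd | rfl | hcd
    · exact key' c d hcd y hy y' hrel
    · rw [sub_self, sub_self]
    · rw [← neg_sub, key' d c hcd y (by rw [sat_or] at hy ⊢; exact hy.symm) y' hrel, neg_sub]
  have h1 := (octahedronGluing T).eq_of_rel
    (fun y => if Sat 1 ((octahedronCond c).or (octahedronCond d)) y.2.1.1 then θ d y - θ c y else 0)
    (fun y y' hrel => by
      have h1 : Sat 1 ((octahedronCond c).or (octahedronCond d)) y.2.1.1 ↔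
          Sat 1 ((octahedronCond c).or (octahedronCond d)) y'.2.1.1 := by
        rw [← (octahedronGluing T).proj_mem_piece, ← (octahedronGluing T).proj_mem_piece,
          (octahedronGluing T).sound hrel]
      by_cases h2 : Sat 1 ((octahedronCond c).or (octahedronCond d)) y.2.1.1
      · rw [if_pos h2, if_pos (h1.1 h2)]
        exact key c d y h2 y' hrel
      · rw [if_neg h2, if_neg fun h3 => h2 (h1.2 h3)])
    (hr (octahedronProj T y))
  have h2 : Sat 1 ((octahedronCond c).or (octahedronCond d)) (r (octahedronProj T y)).2.1.1 := by
    rw [← (octahedronGluing T).proj_mem_piece] at hy ⊢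
    rwa [show (octahedronGluing T).proj (r (octahedronProj T y)) = (octahedronGluing T).proj y from
      hr (octahedronProj T y)]
  rw [if_pos hy, if_pos h2] at h1
  rw [neg_sub_neg]
  exact h1

/-- Compatible data are realized by cocycles. -/
theorem Compat.exists_hasData {w b : Fin n × ℤˣ → Fin 4 → A} {e} (h : Compat T w b e) :
    ∃ ψ p, coboundary ψ = 0 ∧ HasData T ψ w b e p := by
  obtain ⟨p, hp⟩ := h.exists_potentials
  obtain ⟨ψ, hψ, hψp⟩ := exists_cocycle_of_potentials (isOpen_octahedronCover T)
    (exists_mem_octahedronCover T) p fun c d => by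
      refine (pathConst_octahedronCover_inter_iff T c d).2
        ⟨fun q S => theta w b e d q S - theta w b e c q S, fun y hy => ?_⟩
      rw [Pi.sub_apply, hp c d y hy]
      dsimp only
      rw [theta_label w b e d, theta_label w b e c]
      all_goals simp +contextual [Cond.or]
  refine ⟨ψ, p, hψ, hψp, fun y l hy hl => ?_, fun y l hy hl => ?_, fun y l k hy hl hk => ?_,
    fun y l k hy hl hk => ?_, fun y l k hy hl hk => ?_⟩
  · rw [hp 0 1 y hy]; simp [theta, hl]
  · rw [hp 0 2 y hy]; simp [theta, hl]
  · rw [hp 0 3 y hy]; simp [theta, hl, hk]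
  · rw [hp 1 3 y hy]; simp [theta, hl, hk]
  · rw [hp 2 3 y hy]; simp [theta, hl, hk]

/-- A cocycle with trivial data is a coboundary. -/
theorem HasData.exists_eq_edgeDiff {ψ : Simplex T.D 1 → A} {w b e p} (h : HasData T ψ w b e p)
    (hψ : coboundary ψ = 0) (t : Fin n × ℤˣ → A) (hw : WhiteInv T fun q l => w q l - t q)
    (hb : BlackInv fun q k => b q k - t q) : ∃ f : T.D → A, ψ = edgeDiff f := by
  have hc := h.compat
  -- Subtracting from `t` the jump to each piece gives corrections with the same differences as the
  -- potentials. They descend to the glued space: for `w` and `b` by `hw` and `hb`, and for `e` by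
  -- combining these with compatibility.
  let g : Fin 4 → Fin n × ℤˣ → Finset (Fin 4) × Finset (Fin 4) → A :=
    ![fun q _ => t q, fun q S => ∑ l ∈ S.1, (t q - w q l), fun q S => ∑ k ∈ S.2, (t q - b q k),
      fun q S => ∑ l ∈ S.1, ∑ k ∈ S.2, (t q - e q l k)]
  have hκ : ∀ c, ∃ κ : T.D → A, ∀ y : (Fin n × ℤˣ) × Octahedron, Sat 1 (octahedronCond c) y.2.1.1 →
      κ (octahedronProj T y) = g c y.1 (label (octahedronCond c) y.2.1.1) := fun c => by
    refine (octahedronGluing T).exists_function_of_label (g c) fun y y' hrel hS => ?_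
    refine rel_cases (fun y => g c y.1 (label (octahedronCond c) y.2.1.1)) ?_ ?_ hrel hS
    · intro ha y l hy hl
      have hc13 : c = 1 ∨ c = 3 := by
        clear hS hy
        revert c
        decide
      have hw' : ∀ l, t (glueOct T y.1 l) - w (glueOct T y.1 l) (T.perm y.1.1 l l) =
          t y.1 - w y.1 l := fun l => by
        have := congrArg Neg.neg (hw y.1 l)
        simpa only [neg_sub] using this
      obtain ⟨l', hmin⟩ := hy.exists_amin (by rcases hc13 with rfl | rfl <;> rfl)
      obtain rfl := eq_of_amin_eq hmin hl
      rcases hc13 with rfl | rfl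
      · simpa [g, label, octahedronCond, hmin, amin_permute_eq hmin] using hw' l'
      · obtain ⟨k, hmax⟩ := hy.exists_amax rfl
        have := hc.white y.1 l' k (ne_of_amin_eq hmin hmax)
        have h2 : t (glueOct T y.1 l') - e (glueOct T y.1 l') (T.perm y.1.1 l' l')
            (T.perm y.1.1 l' k) = t y.1 - e y.1 l' k := by
          rw [← sub_sub_sub_cancel_right _ _ (w (glueOct T y.1 l') (T.perm y.1.1 l' l')), hw' l',
            this, sub_sub_sub_cancel_right]
        simpa [g, label, octahedronCond, hmin, hmax, amin_permute_eq hmin,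
          amax_permute_eq hmax] using h2
    · intro hbf i ε ε' x hx
      have hc23 : c = 2 ∨ c = 3 := by
        clear hS hx
        revert c
        decide
      have hb' : ∀ k, t (i, ε) - b (i, ε) k = t (i, ε') - b (i, ε') k := fun k => by
        have := congrArg Neg.neg (hb i ε ε' k)
        simpa only [neg_sub] using this
      obtain ⟨k, hmax⟩ := hx.exists_amax (by rcases hc23 with rfl | rfl <;> rfl)
      rcases hc23 with rfl | rfl
      · simpa [g, label, octahedronCond, hmax] using hb' k
      · obtain ⟨l, hmin⟩ := hx.exists_amin rfl
        have := hc.black i ε ε' l k (ne_of_amin_eq hmin hmax)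
        have h2 : t (i, ε) - e (i, ε) l k = t (i, ε') - e (i, ε') l k := by
          rw [← sub_sub_sub_cancel_right _ _ (b (i, ε) k), hb' k, this, sub_sub_sub_cancel_right]
        simpa [g, label, octahedronCond, hmin, hmax] using h2
  choose κ hκ using hκ
  refine Singular.exists_eq_edgeDiff (isOpen_octahedronCover T) (exists_mem_octahedronCover T) ψ hψ
    p κ h.potential (fun c => (pathConst_octahedronCover_iff T c).2 ⟨g c, hκ c⟩) ?_
  have key : ∀ c d, c < d → ∀ x ∈ octahedronCover T c ∩ octahedronCover T d,
      p c x - p d x = κ c x - κ d x := by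
    intro c d hcd x hx
    rw [octahedronCover_inter] at hx
    obtain ⟨y, hy, rfl⟩ := hx
    change p c (octahedronProj T y) - p d (octahedronProj T y) =
      κ c (octahedronProj T y) - κ d (octahedronProj T y)
    have hy2 := sat_or.1 hy
    rw [hκ c y hy2.1, hκ d y hy2.2]
    fin_cases c <;> fin_cases d <;> simp at hcd
    · obtain ⟨l, hmin⟩ := hy.exists_amin rfl
      refine (h.white y l hy hmin).trans ?_
      simp [g, label, octahedronCond, hmin]
    · obtain ⟨k, hmax⟩ := hy.exists_amax rfl
      refine (h.black y k hy hmax).trans ?_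
      simp [g, label, octahedronCond, hmax]
    · obtain ⟨l, hmin⟩ := hy.exists_amin rfl
      obtain ⟨k, hmax⟩ := hy.exists_amax rfl
      refine (h.edge y l k hy hmin hmax).trans ?_
      simp [g, label, octahedronCond, hmin, hmax]
    · obtain ⟨l, hmin⟩ := hy.exists_amin rfl
      obtain ⟨k, hmax⟩ := hy.exists_amax rfl
      have h1 := h.white y l ⟨hy.1, hy.2.1, hy.2.2.1, by simp⟩ hmin
      have h2 := h.black y k ⟨hy.1, by simp, hy.2.2.1, hy.2.2.2⟩ hmax
      -- The overlap of the white and the black neighbourhoods lies in the interior of the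
      -- octahedra, so its jump is found by passing through piece `0`.
      refine (sub_sub_sub_cancel_left _ _ (p 0 (octahedronProj T y))).symm.trans ?_
      simp only [Fin.reduceFinMk, Fin.mk_one]
      rw [h1, h2]
      simp [g, label, octahedronCond, hmin, hmax]
    · obtain ⟨l, hmin⟩ := hy.exists_amin rfl
      obtain ⟨k, hmax⟩ := hy.exists_amax rfl
      refine (h.white_edge y l k hy hmin hmax).trans ?_
      simp [g, label, octahedronCond, hmin, hmax]
    · obtain ⟨l, hmin⟩ := hy.exists_amin rfl
      obtain ⟨k, hmax⟩ := hy.exists_amax rfl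
      refine (h.black_edge y l k hy hmin hmax).trans ?_
      simp [g, label, octahedronCond, hmin, hmax]
  intro c d x hx
  rcases lt_trichotomy c d with hcd | rfl | hcd
  · exact key c d hcd x hx
  · rw [sub_self, sub_self]
  · rw [← neg_sub, key d c hcd x hx.symm, neg_sub]

/-- The data of a coboundary are trivial. -/
theorem HasData.exists_inv {f : T.D → A} {w b e p} (h : HasData T (edgeDiff f) w b e p) :
    ∃ t : Fin n × ℤˣ → A, WhiteInv T (fun q l => w q l - t q) ∧
      BlackInv fun q k => b q k - t q := by
  have hpc : ∀ c, PathConst (octahedronCover T c) (p c - f) := fun c σ hσ => by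
    rw [edgeDiff_sub, Pi.sub_apply, h.potential c σ hσ, sub_self]
  obtain ⟨g0, h0⟩ := (pathConst_octahedronCover_iff T 0).1 (hpc 0)
  obtain ⟨g1, h1⟩ := (pathConst_octahedronCover_iff T 1).1 (hpc 1)
  obtain ⟨g2, h2⟩ := (pathConst_octahedronCover_iff T 2).1 (hpc 2)
  have k1 : ∀ (y : (Fin n × ℤˣ) × Octahedron) l, Sat 1 ⟨false, true, true, false⟩ y.2.1.1 →
      amin y.2.1.1 = {l} → p 1 (octahedronProj T y) - f (octahedronProj T y) = g1 y.1 ({l}, ∅) :=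
    fun y l hy hl => by rw [← hl]; exact h1 y hy
  have k2 : ∀ (y : (Fin n × ℤˣ) × Octahedron) k, Sat 1 ⟨true, false, false, true⟩ y.2.1.1 →
      amax y.2.1.1 = {k} → p 2 (octahedronProj T y) - f (octahedronProj T y) = g2 y.1 (∅, {k}) :=
    fun y l hy hl => by rw [← hl]; exact h2 y hy
  -- On each piece `p c - f` depends only on labels. Its value on an octahedron is the required `t`,
  -- and `w - t`, `b - t` are then minus its values on the white and black pieces, which are
  -- invariant.
  have hwb : ∀ q l k, l ≠ k → w q l - g0 q (∅, ∅) = -g1 q ({l}, ∅) ∧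
      b q k - g0 q (∅, ∅) = -g2 q (∅, {k}) := fun q l k hlk => by
    obtain ⟨y, rfl, hpos, hlt, hmin, hmax⟩ := exists_octahedronPoint hlk q
    have a0 : p 0 (octahedronProj T y) - f (octahedronProj T y) = g0 y.1 (∅, ∅) :=
      h0 y ⟨fun _ => hpos, by simp [octahedronCond], fun _ => hlt, by simp [octahedronCond]⟩
    have a1 := k1 y l ⟨by simp, fun _ => by simp [hmin], fun _ => hlt, by simp⟩ hmin
    have a2 := k2 y k ⟨fun _ => hpos, by simp, by simp, fun _ => by simp [hmax]⟩ hmax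
    have a3 := h.white y l ⟨fun _ => hpos, fun _ => by simp [hmin], fun _ => hlt, by simp⟩ hmin
    have a4 := h.black y k ⟨fun _ => hpos, by simp, fun _ => hlt, fun _ => by simp [hmax]⟩ hmax
    rw [← a0, ← a1, ← a2, ← a3, ← a4]
    constructor <;> abel
  refine ⟨fun q => g0 q (∅, ∅), fun q l => ?_, fun i ε ε' k => ?_⟩
  · obtain ⟨k, hk⟩ := exists_ne l
    obtain ⟨y, rfl, hl, hlt, hmin, hmax⟩ := exists_whitePoint hk.symm q
    have hS : Sat 1 ⟨false, true, true, false⟩ y.2.1.1 :=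
      ⟨by simp, fun _ => by simp [hmin], fun _ => hlt, by simp⟩
    dsimp only
    rw [(hwb y.1 l k hk.symm).1, (hwb _ _ (T.perm y.1.1 l k)
      fun h => hk.symm ((T.perm y.1.1 l).injective h)).1, ← k1 y l hS hmin,
      ← k1 (glueOct T y.1 l, y.2.permute (T.perm y.1.1 l)) _ ((sat_permute_iff _).2 hS)
        (amin_permute_eq hmin _), octahedronProj_glue T y l hl]
  · obtain ⟨l, hl⟩ := exists_ne k
    obtain ⟨⟨-, x⟩, rfl, hpos, hk, hmin, hmax⟩ := exists_blackPoint hl (i, ε)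
    have hS : Sat 1 ⟨true, false, false, true⟩ x.1.1 :=
      ⟨fun _ => hpos, by simp, by simp, fun _ => by simp [hmax]⟩
    dsimp only
    rw [(hwb (i, ε) l k hl).2, (hwb (i, ε') l k hl).2, ← k2 ((i, ε), x) k hS hmax,
      ← k2 ((i, ε'), x) k hS hmax, octahedronProj_mirror T i ε ε' x k hk]

end Block

namespace Singular

/-! ### First homology from a universal cocycle -/

variable {X : Type} [TopologicalSpace X]

theorem map_eval {A B : Type} [AddCommGroup A] [AddCommGroup B] {k : ℕ} (f : A →+ B)
    (φ : Simplex X k → A) (c : Chain X k) : f (eval φ c) = eval (fun σ => f (φ σ)) c := by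
  suffices f.toIntLinearMap ∘ₗ eval φ = eval fun σ => f (φ σ) from LinearMap.congr_fun this c
  ext σ
  simp

theorem eval_edgeDiff {A : Type} [AddCommGroup A] (g : X → A) {c : Chain X 1}
    (hc : boundary c = 0) : eval (edgeDiff g) c = 0 := by
  rw [← coboundary_pointCochain, ← eval_boundary, hc, map_zero]

/-- A homomorphism to the rational circle that vanishes on cycles is a coboundary. -/
theorem exists_edgeDiff_eq_of_cycles (φ : Simplex X 1 → AddCircle (1 : ℚ))
    (hφ : ∀ c, boundary c = 0 → eval φ c = 0) : ∃ g, φ = edgeDiff g := by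
  let N : Submodule ℤ (Chain X 1) := LinearMap.ker boundary
  let i : (Chain X 1 ⧸ N) →ₗ[ℤ] Chain X 0 := N.liftQ boundary le_rfl
  have hi : Function.Injective i := LinearMap.ker_eq_bot.1 (Submodule.ker_liftQ_eq_bot' _ _ rfl)
  -- Chains modulo cycles embed into the `0`-chains, and a homomorphism to the divisible group `ℚ /
  -- ℤ` extends along this embedding.
  obtain ⟨h, hh⟩ := (Module.Baer.of_divisible (AddCircle (1 : ℚ))).extension_property_addMonoidHom
    i.toAddMonoidHom hi (N.liftQ (eval φ) fun c hc => hφ c hc).toAddMonoidHom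
  obtain ⟨g, hg⟩ := exists_eq_pointCochain fun σ : Simplex X 0 => h (Finsupp.single σ 1)
  refine ⟨g, funext fun σ => ?_⟩
  have h1 := DFunLike.congr_fun hh (N.mkQ (Finsupp.single σ 1))
  have h2 : h (boundary (Finsupp.single σ 1)) = φ σ := by
    refine h1.trans ?_
    exact eval_single φ σ
  rw [← coboundary_pointCochain, hg, ← h2, boundary_single, map_sum]
  simp only [coboundary, map_zsmul]

/-- The first homology is the kernel of a homomorphism on the group of values of a cocycle that is
universal up to this homomorphism. -/
theorem nonempty_singularHomology_one_equiv_ker {W V : Type} [AddCommGroup W] [Module ℤ W]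
    [AddCommGroup V] [Module ℤ V] (D : W →ₗ[ℤ] V) [Module.Free ℤ (LinearMap.range D)]
    (F : Simplex X 1 → W) (hF : coboundary F = 0)
    (h₁ : ∀ (A : Type) [AddCommGroup A] (ψ : Simplex X 1 → A), coboundary ψ = 0 →
      ∃ (f : W →+ A) (g : X → A), (ψ - fun σ => f (F σ)) = edgeDiff g)
    (h₂ : ∀ (A : Type) [AddCommGroup A] (f : W →+ A) (g : X → A),
      (fun σ => f (F σ)) = edgeDiff g → ∀ m, D m = 0 → f m = 0)
    (h₃ : ∃ g : X → V, (fun σ => D (F σ)) = edgeDiff g) :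
    Nonempty (singularHomology 1 X ≃ₗ[ℤ] LinearMap.ker D) := by
  obtain rfl : ‹Module ℤ W› = AddCommGroup.toIntModule _ := Subsingleton.elim _ _
  obtain rfl : ‹Module ℤ V› = AddCommGroup.toIntModule _ := Subsingleton.elim _ _
  -- Freeness of the range splits `D`, and `r` is the resulting projection of `W` onto its kernel.
  obtain ⟨s, hs⟩ := D.rangeRestrict.exists_rightInverse_of_surjective D.range_rangeRestrict
  have hs' : ∀ w, D (w - s (D.rangeRestrict w)) = 0 := fun w => by
    have := congrArg Subtype.val (LinearMap.congr_fun hs (D.rangeRestrict w))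
    rw [map_sub, sub_eq_zero]
    exact this.symm
  let r : W →ₗ[ℤ] LinearMap.ker D :=
    (LinearMap.id - s ∘ₗ D.rangeRestrict).codRestrict _ hs'
  have hr : ∀ w, D w = 0 → (r w : W) = w := fun w hw => by
    have : D.rangeRestrict w = 0 := Subtype.ext hw
    change w - s (D.rangeRestrict w) = w
    rw [this, map_zero, sub_zero]
  have hcycle : ∀ c : Chain X 1, boundary c = 0 → D (eval F c) = 0 := fun c hc => by
    obtain ⟨g, hg⟩ := h₃
    rw [show D (eval F c) = D.toAddMonoidHom (eval F c) from rfl, map_eval]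
    change eval (fun σ => D (F σ)) c = 0
    rw [hg, eval_edgeDiff g hc]
  have hzero : ∀ c : Chain X 1, boundary c = 0 → (r (eval F c) = 0 ↔ eval F c = 0) := fun c hc => by
    rw [← Subtype.coe_inj, hr _ (hcycle c hc), ZeroMemClass.coe_zero]
  refine nonempty_singularHomology_one_equiv (r ∘ₗ eval F) ?_ fun c hc => ?_
  · rintro ⟨m, hm⟩
    let S : Submodule ℤ W := (LinearMap.ker (boundary : Chain X 1 →ₗ[ℤ] Chain X 0)).map (eval F)
    by_cases hmS : m ∈ S
    · obtain ⟨c, hc, rfl⟩ := hmS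
      exact ⟨c, hc, Subtype.ext (hr _ hm)⟩
    · exfalso
      have hne : S.mkQ m ≠ 0 := by
        rwa [Submodule.mkQ_apply, Ne, Submodule.Quotient.mk_eq_zero]
      -- If cycles did not reach `m`, a character of the quotient by their values would detect it.
      -- Composed with `F` this character is a coboundary, so `h₂` makes it vanish at `m`.
      obtain ⟨χ, hχ⟩ := CharacterModule.exists_character_apply_ne_zero_of_ne_zero hne
      let f : W →+ AddCircle (1 : ℚ) := AddMonoidHom.comp χ S.mkQ.toAddMonoidHom
      obtain ⟨g, hg⟩ := exists_edgeDiff_eq_of_cycles (fun σ => f (F σ)) fun c hc => by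
        rw [← map_eval f F c]
        have : S.mkQ (eval F c) = 0 := by
          rw [Submodule.mkQ_apply, Submodule.Quotient.mk_eq_zero]
          exact ⟨c, hc, rfl⟩
        change χ (S.mkQ (eval F c)) = 0
        rw [this, map_zero]
      exact hχ (h₂ _ f g hg m hm)
  · rw [LinearMap.comp_apply, hzero c hc]
    constructor
    · intro h0
      let B : Submodule ℤ (Chain X 1) := LinearMap.range boundary
      -- The tautological cocycle with values in chains modulo boundaries: since `h₁` expresses it
      -- through `F`, a cycle on which `F` vanishes is a boundary.
      let ψ : Simplex X 1 → Chain X 1 ⧸ B := fun σ => B.mkQ (Finsupp.single σ 1)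
      have hψ : ∀ c, eval ψ c = B.mkQ c := fun c => by
        suffices eval ψ = B.mkQ from LinearMap.congr_fun this c
        ext σ
        simp [ψ]
      obtain ⟨f, g, hfg⟩ := h₁ _ ψ (funext fun σ => by
        rw [← eval_single (coboundary ψ) σ, ← eval_boundary, hψ, Submodule.mkQ_apply]
        exact (Submodule.Quotient.mk_eq_zero _).2 ⟨_, rfl⟩)
      have h2 := congrArg (fun φ => eval φ c) hfg
      have h3 : eval (ψ - fun σ => f (F σ)) c = eval ψ c - eval (fun σ => f (F σ)) c := by
        suffices eval (ψ - fun σ => f (F σ)) = eval ψ - eval (fun σ => f (F σ)) from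
          LinearMap.congr_fun this c
        ext σ
        simp
      rw [h3, eval_edgeDiff g hc, ← map_eval f F c, h0, map_zero, sub_zero, hψ,
        Submodule.mkQ_apply] at h2
      exact (Submodule.Quotient.mk_eq_zero _).1 h2
    · rintro ⟨b, rfl⟩
      rw [eval_boundary, hF]
      suffices eval (0 : Simplex X 2 → W) = 0 by rw [this]; rfl
      ext σ
      simp

end Singular

namespace Block

open Singular

/-! ### The universal property of the classes of flags -/

variable {n : ℕ} (T : Triangulation n)

/-- Functions on flags that satisfy the relations between the classes of the flags. -/
structure FlagRel {A : Type} [AddCommGroup A] (x : Flag n → A) : Prop where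
  diag : ∀ i l, x (i, l, l) = 0
  antisymm : ∀ i l k, x (i, l, k) + x (i, k, l) = 0
  sum : ∀ i l, ∑ k, x (i, l, k) = 0
  glue : ∀ a, x a + x (glueFlag T a) = 0

/-- The class of a flag. -/
def flagClass (a : Flag n) : FlagClasses T := (trivialFlags T).mkQ (Pi.single a 1)

/-- Each relation comes from one part of `trivialFlags`: antisymmetry from `g₀₂`, zero sums from
`g₀₁`, gluing from `g₁₂`, and the diagonal from the absence of constraints at `l = k`. -/
theorem flagRel_flagClass : FlagRel T (flagClass T) where
  diag i l := by
    refine (Submodule.Quotient.mk_eq_zero _).2 ⟨0, 0, 0, by simp, fun i' l' k' h => ?_⟩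
    have : (i', l', k') ≠ (i, l, l) := fun h' => by
      simp only [Prod.mk.injEq] at h'
      exact h (h'.2.1.trans h'.2.2.symm)
    simp [this]
  antisymm i l k := by
    rw [flagClass, flagClass, ← map_add]
    by_cases hlk : l = k
    · subst hlk
      refine (Submodule.Quotient.mk_eq_zero _).2 ⟨0, 0, 0, by simp, fun i' l' k' h => ?_⟩
      have : (i', l', k') ≠ (i, l, l) := fun h' => by
        simp only [Prod.mk.injEq] at h'
        exact h (h'.2.1.trans h'.2.2.symm)
      simp [this]
    · refine (Submodule.Quotient.mk_eq_zero _).2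
        ⟨0, 0, fun i' S => if i' = i ∧ S = {l, k} then -1 else 0, by simp, fun i' l' k' h => ?_⟩
      have key : ∀ l k l' k' : Fin 4, l ≠ k → l' ≠ k' →
          (({l', k'} : Finset (Fin 4)) = {l, k} ↔ (l' = l ∧ k' = k) ∨ (l' = k ∧ k' = l)) := by
        decide
      have e := key l k l' k' hlk h
      by_cases hi : i' = i
      · subst hi
        by_cases h1 : l' = l ∧ k' = k
        · obtain ⟨rfl, rfl⟩ := h1
          simp [h]
        · by_cases h2 : l' = k ∧ k' = l
          · obtain ⟨rfl, rfl⟩ := h2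
            simp [h, Finset.pair_comm]
          · have h3 : ({l', k'} : Finset (Fin 4)) ≠ {l, k} := fun h3 => (e.1 h3).elim h1 h2
            simp [h1, h2, h3]
      · simp [hi]
  sum i l := by
    simp only [flagClass]
    rw [← map_sum]
    refine (Submodule.Quotient.mk_eq_zero _).2
      ⟨fun i' l' => if i' = i ∧ l' = l then 1 else 0, 0, 0, by simp, fun i' l' k' h => ?_⟩
    rw [Finset.sum_apply]
    simp only [Pi.single_apply, Prod.mk.injEq, ite_and, Pi.zero_apply, add_zero, sub_zero]
    split_ifs <;> simp
  glue a := by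
    rw [flagClass, flagClass, ← map_add]
    refine (Submodule.Quotient.mk_eq_zero _).2
      ⟨0, Pi.single a 1 + Pi.single (glueFlag T a) 1, 0, fun b => ?_, fun i' l' k' h => by simp⟩
    have e1 : glueFlag T b = a ↔ b = glueFlag T a :=
      ⟨fun h => by rw [← h, glueFlag_glueFlag], fun h => by rw [h, glueFlag_glueFlag]⟩
    have e2 : glueFlag T b = glueFlag T a ↔ b = a :=
      ⟨fun h => by rw [← glueFlag_glueFlag T b, h, glueFlag_glueFlag], fun h => by rw [h]⟩
    simp only [Pi.add_apply, Pi.single_apply, e1, e2]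
    exact add_comm _ _

/-- The homomorphism with prescribed values on the classes of flags. -/
theorem FlagRel.exists_hom {A : Type} [AddCommGroup A] {x : Flag n → A} (hx : FlagRel T x) :
    ∃ f : FlagClasses T →+ A, ∀ a, f (flagClass T a) = x a := by
  -- Paired with `x`, the three parts of a trivial function vanish by the zero sums, by cancellation
  -- of glued flags, and by cancellation of flags with `l` and `k` exchanged.
  have hle : trivialFlags T ≤ LinearMap.ker (Fintype.linearCombination ℤ x) := by
    rintro F ⟨g₀₁, g₁₂, g₀₂, hg, hF⟩
    rw [LinearMap.mem_ker, Fintype.linearCombination_apply]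
    have h1 : ∑ a : Flag n, g₀₁ a.1 a.2.1 • x a = 0 := by
      rw [Fintype.sum_prod_type]
      refine Finset.sum_eq_zero fun i _ => ?_
      rw [Fintype.sum_prod_type]
      refine Finset.sum_eq_zero fun l _ => ?_
      dsimp only
      rw [← Finset.smul_sum, hx.sum, smul_zero]
    have h2 : ∑ a : Flag n, g₁₂ a • x a = 0 := by
      refine Finset.sum_involution (fun a _ => glueFlag T a) (fun a _ => ?_)
        (fun a _ _ => glueFlag_ne T a) (fun a _ => Finset.mem_univ _)
        fun a _ => glueFlag_glueFlag T a
      rw [hg, ← smul_add, hx.glue, smul_zero]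
    have h3 : ∑ a : Flag n, g₀₂ a.1 {a.2.1, a.2.2} • x a = 0 := by
      refine Finset.sum_involution (fun a _ => (a.1, a.2.2, a.2.1)) ?_ ?_
        (fun a _ => Finset.mem_univ _) (fun a _ => rfl)
      · rintro ⟨i, l, k⟩ -
        simp only
        rw [Finset.pair_comm k l, ← smul_add, hx.antisymm, smul_zero]
      · rintro ⟨i, l, k⟩ - hne h
        simp only [Prod.mk.injEq] at h
        obtain rfl := h.2.1
        exact hne (by rw [hx.diag, smul_zero])
    have h4 : ∀ a : Flag n, F a • x a =
        g₀₁ a.1 a.2.1 • x a + g₁₂ a • x a - g₀₂ a.1 {a.2.1, a.2.2} • x a := by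
      rintro ⟨i, l, k⟩
      by_cases hlk : l = k
      · subst hlk
        simp [hx.diag]
      · rw [hF i l k hlk, sub_smul, add_smul]
    simp only [h4, Finset.sum_add_distrib, Finset.sum_sub_distrib, h1, h2, h3, add_zero, sub_zero]
  refine ⟨((trivialFlags T).liftQ _ hle).toAddMonoidHom, fun a => ?_⟩
  refine (Fintype.linearCombination_apply_single ℤ x a 1).trans ?_
  rw [one_smul]

theorem flagClasses_hom_eq_zero {A : Type} [AddCommGroup A] {f : FlagClasses T →+ A}
    (h : ∀ a, f (flagClass T a) = 0) (g : FlagClasses T) : f g = 0 := by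
  obtain ⟨F, rfl⟩ := Submodule.mkQ_surjective _ g
  have : F = ∑ a, F a • Pi.single a (1 : ℤ) := by
    simpa using pi_eq_sum_univ' F
  rw [this, map_sum, map_sum]
  refine Finset.sum_eq_zero fun a _ => ?_
  rw [map_zsmul, map_zsmul]
  change F a • f (flagClass T a) = 0
  rw [h, smul_zero]

end Block

namespace Block

open Singular

/-! ### The universal data -/

variable {n : ℕ} (T : Triangulation n) {A : Type} [AddCommGroup A]

/-- The sign of the permutation `(p, q, m, l)` of `(0, 1, 2, 3)`, where `q` is the fourth index, and
`0` if `l`, `m` and `p` are not distinct. -/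
def orient (l m p : Fin 4) : ℤ :=
  let q : ℤ := 6 - (l : ℕ) - (m : ℕ) - (p : ℕ)
  Int.sign ((q - (p : ℕ)) * ((m : ℕ) - (p : ℕ)) * ((l : ℕ) - (p : ℕ)) * ((m : ℕ) - q) *
    ((l : ℕ) - q) * ((l : ℕ) - (m : ℕ)))

theorem orient_self : ∀ l p, orient l l p = 0 := by decide

theorem orient_antisymm : ∀ l m p, orient l m p + orient m l p = 0 := by decide

theorem sum_orient : ∀ l p, ∑ m, orient l m p = 0 := by decide

theorem orient_swap : ∀ a b : Fin 4, a ≠ b → ∀ l m p,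
    orient (Equiv.swap a b l) (Equiv.swap a b m) (Equiv.swap a b p) = -orient l m p := by decide

theorem orient_of_distinct : ∀ l m k k', l ≠ m → l ≠ k → l ≠ k' → m ≠ k → m ≠ k' → k ≠ k' →
    (orient l m k = 1 ∨ orient l m k = -1) ∧ orient l m k' = -orient l m k ∧
      orient l m l = 0 ∧ orient l m m = 0 ∧ Finset.univ = ({l, m, k, k'} : Finset (Fin 4)) := by
  decide

theorem orient_perm (σ : Equiv.Perm (Fin 4)) (l m p : Fin 4) :
    orient (σ l) (σ m) (σ p) = (Equiv.Perm.sign σ : ℤ) * orient l m p := by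
  induction σ using Equiv.Perm.swap_induction_on with
  | one => simp
  | swap_mul f a b hab ih =>
    simp only [Equiv.Perm.mul_apply, orient_swap a b hab, ih, map_mul, Equiv.Perm.sign_swap hab]
    simp

/-- The function on flags given by the differences of a function on vertices. -/
def xOf (y : Fin n → Fin 4 → A) (a : Flag n) : A := ∑ p, orient a.2.1 a.2.2 p • y a.1 p

/-- The function on vertices, vanishing on vertex `0`, that is determined by a function on flags. -/
def yOf (x : Flag n → A) (i : Fin n) : Fin 4 → A :=
  ![0, x (i, 2, 3), x (i, 3, 1), x (i, 1, 2)]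

theorem xOf_eq (y : Fin n → Fin 4 → A) (i : Fin n) {l m k k' : Fin 4} (h₁ : l ≠ m) (h₂ : l ≠ k)
    (h₃ : l ≠ k') (h₄ : m ≠ k) (h₅ : m ≠ k') (h₆ : k ≠ k') :
    xOf y (i, l, m) = orient l m k • (y i k - y i k') := by
  obtain ⟨-, e1, e2, e3, e4⟩ := orient_of_distinct l m k k' h₁ h₂ h₃ h₄ h₅ h₆
  rw [xOf, e4, Finset.sum_insert (by simp [h₁, h₂, h₃]), Finset.sum_insert (by simp [h₄, h₅]),
    Finset.sum_pair h₆]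
  simp [e1, e2, e3, sub_eq_add_neg]

/-- The passage to flags forgets one constant per tetrahedron; `yOf` restores it by the
normalization at vertex `0`. -/
theorem yOf_xOf (y : Fin n → Fin 4 → A) (i : Fin n) (k : Fin 4) :
    yOf (xOf y) i k = y i k - y i 0 := by
  have h1 := xOf_eq y i (l := 2) (m := 3) (k := 1) (k' := 0)
    (by decide) (by decide) (by decide) (by decide) (by decide) (by decide)
  have h2 := xOf_eq y i (l := 3) (m := 1) (k := 2) (k' := 0)
    (by decide) (by decide) (by decide) (by decide) (by decide) (by decide)
  have h3 := xOf_eq y i (l := 1) (m := 2) (k := 3) (k' := 0)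
    (by decide) (by decide) (by decide) (by decide) (by decide) (by decide)
  rw [show orient 2 3 1 = 1 by decide, one_smul] at h1
  rw [show orient 3 1 2 = 1 by decide, one_smul] at h2
  rw [show orient 1 2 3 = 1 by decide, one_smul] at h3
  fin_cases k
  · simp [yOf]
  · exact h1
  · exact h2
  · exact h3

/-- An antisymmetric 4 × 4 matrix with zero row sums is determined by its entries `(2, 3)`, `(3, 1)`
and `(1, 2)`. -/
theorem xOf_yOf {T : Triangulation n} {x : Flag n → A} (hx : FlagRel T x) : xOf (yOf x) = x := by
  funext ⟨i, l, m⟩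
  have s := fun l => hx.sum i l
  have d := fun l => hx.diag i l
  have a := fun l m => hx.antisymm i l m
  simp only [Fin.sum_univ_four] at s
  simp only [xOf, yOf, Fin.sum_univ_four]
  have s1 := s 1
  have s2 := s 2
  have s3 := s 3
  have a01 := a 0 1
  have a02 := a 0 2
  have a03 := a 0 3
  have a12 := a 1 2
  have a13 := a 1 3
  have a23 := a 2 3
  have d0 := d 0
  have d1 := d 1
  have d2 := d 2
  have d3 := d 3
  clear s d a
  fin_cases l <;> fin_cases m <;> simp [orient] <;> grind

/-- The combination of the differences of potentials across the black faces that is the difference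
of the differences of potentials across the two copies of a white face. -/
def faceTerm (y : Fin n → Fin 4 → A) (i : Fin n) (l k : Fin 4) : A :=
  y i k + (Equiv.Perm.sign (T.perm i l) : ℤ) • y (T.adj i l) (T.perm i l k)

/-- The sign by which `orient` changes under the pairing is the sign in `faceTerm`. Thus the gluing
relation for flags is the independence of the face terms from the vertex. -/
theorem xOf_add_xOf_glueFlag (y : Fin n → Fin 4 → A) (i : Fin n) {l m k k' : Fin 4} (h₁ : l ≠ m)
    (h₂ : l ≠ k) (h₃ : l ≠ k') (h₄ : m ≠ k) (h₅ : m ≠ k') (h₆ : k ≠ k') :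
    xOf y (i, l, m) + xOf y (glueFlag T (i, l, m)) =
      orient l m k • (faceTerm T y i l k - faceTerm T y i l k') := by
  have hσ := (T.perm i l).injective
  rw [xOf_eq y i h₁ h₂ h₃ h₄ h₅ h₆, glueFlag, xOf_eq y (T.adj i l) (hσ.ne h₁) (hσ.ne h₂)
    (hσ.ne h₃) (hσ.ne h₄) (hσ.ne h₅) (hσ.ne h₆), orient_perm, faceTerm, faceTerm, mul_comm,
    mul_smul, ← smul_add]
  congr 1
  rw [smul_sub]
  abel

theorem exists_fourth : ∀ l k k' : Fin 4, l ≠ k → l ≠ k' → k ≠ k' →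
    ∃ m, l ≠ m ∧ m ≠ k ∧ m ≠ k' := by decide

theorem exists_others : ∀ l m : Fin 4, l ≠ m →
    ∃ k k', l ≠ k ∧ l ≠ k' ∧ m ≠ k ∧ m ≠ k' ∧ k ≠ k' := by decide

/-- The face terms do not depend on the vertex if the function on flags satisfies the relations. -/
theorem FlagRel.faceTerm_eq {y : Fin n → Fin 4 → A} (h : FlagRel T (xOf y)) (i : Fin n)
    {l k k' : Fin 4} (hk : l ≠ k) (hk' : l ≠ k') : faceTerm T y i l k = faceTerm T y i l k' := by
  by_cases hkk' : k = k'
  · rw [hkk']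
  obtain ⟨m, h1, h2, h3⟩ := exists_fourth l k k' hk hk' hkk'
  have h4 := h.glue (i, l, m)
  rw [xOf_add_xOf_glueFlag T y i h1 hk hk' h2 h3 hkk'] at h4
  rw [← sub_eq_zero]
  obtain ⟨h5 | h5, -⟩ := orient_of_distinct l m k k' h1 hk hk' h2 h3 hkk'
  · rwa [h5, one_smul] at h4
  · rwa [h5, neg_smul, one_smul, neg_eq_zero] at h4

theorem flagRel_xOf {y : Fin n → Fin 4 → A} (h : ∀ i l k k', l ≠ k → l ≠ k' →
    faceTerm T y i l k = faceTerm T y i l k') : FlagRel T (xOf y) where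
  diag i l := by simp [xOf, orient_self]
  antisymm i l k := by
    simp only [xOf, ← Finset.sum_add_distrib, ← add_smul, orient_antisymm, zero_smul,
      Finset.sum_const_zero]
  sum i l := by
    simp only [xOf]
    rw [Finset.sum_comm]
    simp only [← Finset.sum_smul, sum_orient, zero_smul, Finset.sum_const_zero]
  glue a := by
    obtain ⟨i, l, m⟩ := a
    by_cases hlm : l = m
    · subst hlm
      simp [xOf, glueFlag, orient_self]
    · obtain ⟨k, k', h1, h2, h3, h4, h5⟩ := exists_others l m hlm
      rw [xOf_add_xOf_glueFlag T y i hlm h1 h2 h3 h4 h5, h i l k k' h1 h2, sub_self, smul_zero]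

theorem glueOct_glueOct (q : Fin n × ℤˣ) (l : Fin 4) :
    glueOct T (glueOct T q l) (T.perm q.1 l l) = q := by
  refine Prod.ext (T.adj_adj _ _) ?_
  simp only [glueOct, T.perm_adj, Equiv.Perm.sign_inv, ← mul_assoc, neg_mul_neg,
    Int.units_mul_self, one_mul]

theorem perm_glueOct (q : Fin n × ℤˣ) (l : Fin 4) :
    T.perm (glueOct T q l).1 (T.perm q.1 l l) = (T.perm q.1 l)⁻¹ := T.perm_adj _ _

theorem perm_inv_apply_self (σ : Equiv.Perm (Fin 4)) (k : Fin 4) : σ⁻¹ (σ k) = k :=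
  σ.symm_apply_apply k

/-- A choice of one face from every pair. -/
def Rep (a : Fin n × Fin 4) : Prop :=
  finProdFinEquiv a < finProdFinEquiv (T.adj a.1 a.2, T.perm a.1 a.2 a.2)

instance : DecidablePred (Rep T) := fun _ => inferInstanceAs (Decidable (_ < _))

theorem rep_glue (i : Fin n) (l : Fin 4) :
    Rep T (T.adj i l, T.perm i l l) ↔ ¬ Rep T (i, l) := by
  have : T.perm (T.adj i l) (T.perm i l l) (T.perm i l l) = l := by simp [T.perm_adj]
  simp only [Rep, T.adj_adj, this, not_lt]
  exact ⟨le_of_lt, fun h => lt_of_le_of_ne h fun h' =>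
    T.ne_self i l (finProdFinEquiv.injective h')⟩

theorem rep_glueOct (q : Fin n × ℤˣ) (l : Fin 4) :
    Rep T ((glueOct T q l).1, T.perm q.1 l l) ↔ ¬ Rep T (q.1, l) := rep_glue T q.1 l

/-- The white invariance can be checked on one face of every pair. -/
theorem whiteInv_of_rep {B : Type} {w : Fin n × ℤˣ → Fin 4 → B}
    (h : ∀ q l, Rep T (q.1, l) → w (glueOct T q l) (T.perm q.1 l l) = w q l) : WhiteInv T w := by
  intro q l
  by_cases hr : Rep T (q.1, l)
  · exact h q l hr
  · have h1 := h (glueOct T q l) (T.perm q.1 l l) ((rep_glueOct T q l).2 hr)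
    rw [glueOct_glueOct, perm_glueOct, perm_inv_apply_self] at h1
    exact h1.symm

/-- The standard data on the white faces. -/
def stdWhite (y : Fin n → Fin 4 → A) (e : {a // Rep T a} → A) (q : Fin n × ℤˣ) (l : Fin 4) : A :=
  if h : Rep T (q.1, l) then e ⟨_, h⟩ - if q.2 = 1 then 0 else faceTerm T y q.1 l (l + 1) else 0

/-- The standard data on the black faces. -/
def stdBlack (y : Fin n → Fin 4 → A) (q : Fin n × ℤˣ) (k : Fin 4) : A :=
  if q.2 = 1 then y q.1 k else 0

/-- The standard data on the edges. -/
def stdEdge (y : Fin n → Fin 4 → A) (e : {a // Rep T a} → A) (q : Fin n × ℤˣ) (l k : Fin 4) : A :=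
  stdBlack y q k + if h : Rep T (q.1, l) then e ⟨_, h⟩ - faceTerm T y q.1 l k +
    (if Equiv.Perm.sign (T.perm q.1 l) = 1 then y (T.adj q.1 l) (T.perm q.1 l k) else 0) else 0

theorem ne_add_one (l : Fin 4) : l ≠ l + 1 := by revert l; decide

/-- On the chosen face of each pair the white jump is `e` in copy `1` and `e` minus the face term in
copy `-1`; on the other face it is zero. The vertex `l + 1` is just some vertex of face `l`, and
`hy` makes the choice irrelevant. -/
theorem compat_std {y : Fin n → Fin 4 → A} (hy : ∀ i l k k', l ≠ k → l ≠ k' →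
    faceTerm T y i l k = faceTerm T y i l k') (e : {a // Rep T a} → A) :
    Compat T (stdWhite T y e) (stdBlack y) (stdEdge T y e) where
  white := by
    have key : ∀ q l k, l ≠ k → Rep T (q.1, l) →
        stdEdge T y e (glueOct T q l) (T.perm q.1 l l) (T.perm q.1 l k) -
          stdWhite T y e (glueOct T q l) (T.perm q.1 l l) =
        stdEdge T y e q l k - stdWhite T y e q l := by
      rintro ⟨i, ε⟩ l k hlk hr
      have hr' := mt (rep_glueOct T (i, ε) l).1 (not_not.2 hr)
      dsimp only at hr hr'
      simp only [stdEdge, stdWhite, dif_pos hr, dif_neg hr', add_zero, sub_zero,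
        hy i l _ _ (ne_add_one l) hlk]
      simp only [faceTerm, stdBlack, glueOct]
      rcases Int.units_eq_one_or (Equiv.Perm.sign (T.perm i l)) with h | h <;>
        rcases Int.units_eq_one_or ε with rfl | rfl <;>
          simp [h, show (-1 : ℤˣ) ≠ 1 by decide] <;> abel
    intro q l k hlk
    by_cases hr : Rep T (q.1, l)
    · exact key q l k hlk hr
    · have h1 := key (glueOct T q l) (T.perm q.1 l l) (T.perm q.1 l k)
        ((T.perm q.1 l).injective.ne hlk) ((rep_glueOct T q l).2 hr)
      rw [glueOct_glueOct, perm_glueOct, perm_inv_apply_self,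
        perm_inv_apply_self] at h1
      exact h1.symm
  black i ε ε' l k hlk := by simp only [stdEdge]; abel

/-- The closed path around an octahedron edge crosses two copies of a white face and one black face
on each side of it. Copies are exchanged across the white face exactly when the pairing is even,
which produces the sign in the face term. -/
theorem Compat.sub_eq {w b : Fin n × ℤˣ → Fin 4 → A} {e} (h : Compat T w b e) (i : Fin n)
    {l k : Fin 4} (hlk : l ≠ k) :
    (w (i, 1) l - w (glueOct T (i, 1) l) (T.perm i l l)) -
      (w (i, -1) l - w (glueOct T (i, -1) l) (T.perm i l l)) =
      faceTerm T (fun i k => b (i, 1) k - b (i, -1) k) i l k := by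
  have h1 := h.white (i, 1) l k hlk
  have h2 := h.white (i, -1) l k hlk
  have h3 := h.black i 1 (-1) l k hlk
  have h4 := h.black (T.adj i l) 1 (-1) (T.perm i l l) (T.perm i l k)
    ((T.perm i l).injective.ne hlk)
  simp only [faceTerm, glueOct] at h1 h2 ⊢
  rcases Int.units_eq_one_or (Equiv.Perm.sign (T.perm i l)) with hs | hs <;>
    simp only [hs, mul_one, neg_neg, mul_neg, Units.val_one, Units.val_neg, one_smul,
      neg_smul] at h1 h2 h3 h4 ⊢ <;> grind

/-- Data are equivalent to the standard data with the same differences. -/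
theorem Compat.whiteInv_sub_std {w b : Fin n × ℤˣ → Fin 4 → A} {e} (h : Compat T w b e) :
    WhiteInv T (w - stdWhite T (fun i k => b (i, 1) k - b (i, -1) k)
      fun a => w (a.1.1, 1) a.1.2 - w (glueOct T (a.1.1, 1) a.1.2) (T.perm a.1.1 a.1.2 a.1.2)) := by
  refine whiteInv_of_rep T ?_
  rintro ⟨i, ε⟩ l hr
  have hr' := mt (rep_glueOct T (i, ε) l).1 (not_not.2 hr)
  have h1 := h.sub_eq T i (ne_add_one l)
  dsimp only at hr hr'
  simp only [Pi.sub_apply, stdWhite, dif_pos hr, dif_neg hr', ← h1]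
  rcases Int.units_eq_one_or ε with rfl | rfl
  · simp
  · simp [show (-1 : ℤˣ) ≠ 1 by decide]

theorem blackInv_sub_std (b : Fin n × ℤˣ → Fin 4 → A) :
    BlackInv (b - stdBlack fun i k => b (i, 1) k - b (i, -1) k) := by
  have h : ∀ i ε k, (b - stdBlack fun i k => b (i, 1) k - b (i, -1) k) (i, ε) k = b (i, -1) k := by
    intro i ε k
    rcases Int.units_eq_one_or ε with rfl | rfl
    · simp [stdBlack]
    · simp [stdBlack, show (-1 : ℤˣ) ≠ 1 by decide]
  intro i ε ε' k
  rw [h, h]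

theorem map_faceTerm {B : Type} [AddCommGroup B] (f : A →+ B) (y : Fin n → Fin 4 → A) (i : Fin n)
    (l k : Fin 4) : f (faceTerm T y i l k) = faceTerm T (fun i k => f (y i k)) i l k := by
  simp only [faceTerm, map_add, map_zsmul]

theorem map_stdWhite {B : Type} [AddCommGroup B] (f : A →+ B) (y : Fin n → Fin 4 → A)
    (e : {a // Rep T a} → A) (q : Fin n × ℤˣ) (l : Fin 4) :
    f (stdWhite T y e q l) = stdWhite T (fun i k => f (y i k)) (fun a => f (e a)) q l := by
  simp only [stdWhite]
  split_ifs <;> simp [map_faceTerm]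

theorem map_stdBlack {B : Type} [AddCommGroup B] (f : A →+ B) (y : Fin n → Fin 4 → A)
    (q : Fin n × ℤˣ) (k : Fin 4) :
    f (stdBlack y q k) = stdBlack (fun i k => f (y i k)) q k := by
  simp only [stdBlack]
  split_ifs <;> simp

end Block

namespace Block

open Singular

/-! ### The first homology of the manifold -/

variable {n : ℕ} (T : Triangulation n)

/-- The boundary map of the graph dual to the triangulation. -/
def faceBoundary : ({a // Rep T a} → ℤ) →ₗ[ℤ] (Fin n → ℤ) :=
  Fintype.linearCombination ℤ fun a => Pi.single (T.adj a.1.1 a.1.2) 1 - Pi.single a.1.1 1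

theorem faceBoundary_single (a : {a // Rep T a}) :
    faceBoundary T (Pi.single a 1) = Pi.single (T.adj a.1.1 a.1.2) 1 - Pi.single a.1.1 1 := by
  rw [faceBoundary, Fintype.linearCombination_apply_single, one_smul]

/-- The group of values of the universal cocycle. -/
abbrev Values : Type := FlagClasses T × ({a // Rep T a} → ℤ)

/-- The universal differences across black faces. -/
def univY (i : Fin n) (k : Fin 4) : Values T := (yOf (flagClass T) i k, 0)

/-- The universal differences across white faces. -/
def univE (a : {a // Rep T a}) : Values T := (0, Pi.single a 1)

theorem yOf_map {A B : Type} [AddCommGroup A] [AddCommGroup B] (f : A →+ B) (x : Flag n → A)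
    (i : Fin n) (k : Fin 4) : f (yOf x i k) = yOf (fun a => f (x a)) i k := by
  fin_cases k <;> simp [yOf]

theorem xOf_map {A B : Type} [AddCommGroup A] [AddCommGroup B] (f : A →+ B)
    (y : Fin n → Fin 4 → A) (a : Flag n) : f (xOf y a) = xOf (fun i k => f (y i k)) a := by
  simp only [xOf, map_sum, map_zsmul]

theorem faceTerm_univY (i : Fin n) (l k k' : Fin 4) (hk : l ≠ k) (hk' : l ≠ k') :
    faceTerm T (univY T) i l k = faceTerm T (univY T) i l k' := by
  have h : FlagRel T (xOf (yOf (flagClass T))) := by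
    rw [xOf_yOf (flagRel_flagClass T)]
    exact flagRel_flagClass T
  have h1 := map_faceTerm T (AddMonoidHom.inl (FlagClasses T) ({a // Rep T a} → ℤ))
    (yOf (flagClass T)) i l
  have h2 : (fun i k => AddMonoidHom.inl (FlagClasses T) ({a // Rep T a} → ℤ)
    (yOf (flagClass T) i k)) = univY T := rfl
  rw [h2] at h1
  rw [← h1, ← h1, h.faceTerm_eq T i hk hk']

/-- A homomorphism on the group of values that vanishes on the universal differences across black
faces vanishes on the classes of flags. -/
theorem map_inl_eq_zero {A : Type} [AddCommGroup A] (f : Values T →+ A)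
    (h : ∀ i k, f (univY T i k) = 0) (g : FlagClasses T) : f (g, 0) = 0 := by
  refine flagClasses_hom_eq_zero T (f := f.comp (AddMonoidHom.inl _ _)) (fun a => ?_) g
  rw [← xOf_yOf (flagRel_flagClass T), xOf_map]
  have : (fun i k => (f.comp (AddMonoidHom.inl _ _)) (yOf (flagClass T) i k)) = fun _ _ => 0 :=
    funext fun i => funext fun k => h i k
  rw [this]
  simp [xOf]

theorem map_eq_sum {A : Type} [AddCommGroup A] (f : Values T →+ A) (m : Values T) :
    f m = f (m.1, 0) + ∑ a, m.2 a • f (univE T a) := by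
  have h : m = (m.1, 0) + ∑ a, m.2 a • univE T a := by
    refine Prod.ext ?_ ?_
    · simp [univE, Prod.fst_sum]
    · simpa [univE, Prod.snd_sum] using pi_eq_sum_univ' m.2
  conv_lhs => rw [h]
  rw [map_add, map_sum]
  simp only [map_zsmul]

/-- The homomorphism with prescribed values on the universal differences. -/
theorem exists_hom {A : Type} [AddCommGroup A] {y : Fin n → Fin 4 → A}
    (hy : ∀ i l k k', l ≠ k → l ≠ k' → faceTerm T y i l k = faceTerm T y i l k')
    (hy0 : ∀ i, y i 0 = 0) (e : {a // Rep T a} → A) :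
    ∃ f : Values T →+ A, (∀ i k, f (univY T i k) = y i k) ∧ ∀ a, f (univE T a) = e a := by
  obtain ⟨f, hf⟩ := (flagRel_xOf T hy).exists_hom T
  refine ⟨f.coprod (Fintype.linearCombination ℤ e).toAddMonoidHom, fun i k => ?_, fun a => ?_⟩
  · rw [AddMonoidHom.coprod_apply]
    simp only [univY, map_zero, add_zero]
    rw [yOf_map]
    simp only [hf]
    rw [show (fun a => xOf y a) = xOf y from rfl, yOf_xOf, hy0, sub_zero]
  · rw [AddMonoidHom.coprod_apply]
    simp only [univE, map_zero, zero_add]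
    refine (Fintype.linearCombination_apply_single ℤ e a 1).trans (one_smul ℤ _)

/-- The first homology of the manifold. -/
theorem nonempty_homology_D_equiv_ker : Nonempty (singularHomology 1 T.D ≃ₗ[ℤ]
    LinearMap.ker (faceBoundary T ∘ₗ LinearMap.snd ℤ (FlagClasses T) ({a // Rep T a} → ℤ))) := by
  obtain ⟨F, p, hF, hd⟩ := (compat_std T (faceTerm_univY T) (univE T)).exists_hasData
  refine nonempty_singularHomology_one_equiv_ker _ F hF ?_ ?_ ?_
  · intro A _ ψ hψ
    obtain ⟨w, b, e, p', h⟩ := exists_hasData T ψ hψ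
    -- Shifting the potential on copy `1` of each octahedron achieves the normalization at vertex
    -- `0` required by `exists_hom`.
    let t (q : Fin n × ℤˣ) : A := if q.2 = 1 then b (q.1, 1) 0 - b (q.1, -1) 0 else 0
    have hc : Compat T (fun q l => w q l - t q) (fun q k => b q k - t q)
        fun q l k => e q l k - t q := by
      obtain ⟨h1, h2⟩ := h.compat
      constructor
      · intro q l k hlk
        simpa only [sub_sub_sub_cancel_right] using h1 q l k hlk
      · intro i ε ε' l k hlk
        simpa only [sub_sub_sub_cancel_right] using h2 i ε ε' l k hlk
    obtain ⟨f, hfy, hfe⟩ := exists_hom T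
      (y := fun i k => b (i, 1) k - t (i, 1) - (b (i, -1) k - t (i, -1)))
      (fun i l k k' hk hk' => (hc.sub_eq T i hk).symm.trans (hc.sub_eq T i hk'))
      (fun i => by simp [t, show (-1 : ℤˣ) ≠ 1 by decide])
      (fun a => (w (a.1.1, 1) a.1.2 - t (a.1.1, 1)) -
        (w (glueOct T (a.1.1, 1) a.1.2) (T.perm a.1.1 a.1.2 a.1.2) -
          t (glueOct T (a.1.1, 1) a.1.2)))
    have hcob : coboundary (ψ - fun σ => f (F σ)) = 0 := by
      rw [coboundary_sub, hψ, funext (coboundary_map f F), hF, zero_sub, neg_eq_zero]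
      exact funext fun _ => map_zero f
    obtain ⟨g, hg⟩ := (h.sub (hd.map f)).exists_eq_edgeDiff hcob t (by
      have h1 := hc.whiteInv_sub_std T
      intro q l
      have h2 := h1 q l
      simp only [Pi.sub_apply, map_stdWhite, hfy, hfe] at h2 ⊢
      rw [sub_right_comm, h2, sub_right_comm]) (by
      have h1 := blackInv_sub_std fun q k => b q k - t q
      intro i ε ε' k
      have h2 := h1 i ε ε' k
      simp only [Pi.sub_apply, map_stdBlack, hfy] at h2 ⊢
      rw [sub_right_comm, h2, sub_right_comm])
    exact ⟨f, g, hg⟩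
  · rintro A _ f g hfg m hm
    have h := hd.map f
    rw [hfg] at h
    obtain ⟨t, hw, hb⟩ := h.exists_inv
    have hy : ∀ i k, f (univY T i k) = t (i, 1) - t (i, -1) := fun i k => by
      have := hb i 1 (-1) k
      simp only [map_stdBlack] at this
      simp only [stdBlack, if_true, show (-1 : ℤˣ) ≠ 1 by decide, if_false, zero_sub] at this
      rw [sub_eq_iff_eq_add] at this
      rw [this]
      abel
    -- The universal black difference at vertex `0` is zero, so `t` agrees on the two copies. Then
    -- all black differences are killed, and on `univE` the homomorphism factors through the
    -- boundary map of the dual graph.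
    have ht : ∀ i, t (i, 1) = t (i, -1) := fun i => by
      rw [← sub_eq_zero, ← hy i 0]
      simp only [univY, yOf, Matrix.cons_val_zero]
      exact map_zero f
    have ht' : ∀ i ε, t (i, ε) = t (i, 1) := fun i ε => by
      rcases Int.units_eq_one_or ε with rfl | rfl
      exacts [rfl, (ht i).symm]
    have he : ∀ a, f (univE T a) = t (a.1.1, 1) - t (T.adj a.1.1 a.1.2, 1) := by
      rintro ⟨⟨i, l⟩, hr⟩
      have := hw (i, 1) l
      have hr' := mt (rep_glueOct T (i, 1) l).1 (not_not.2 hr)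
      dsimp only at hr'
      simp only [stdWhite, dif_pos hr, dif_neg hr', if_true, sub_zero, map_zero, zero_sub] at this
      rw [eq_sub_iff_add_eq] at this
      rw [← this, ht' (glueOct T (i, 1) l).1]
      simp only [glueOct]
      abel
    have hD : ∑ a, m.2 a • (Pi.single (T.adj a.1.1 a.1.2) 1 - Pi.single a.1.1 1 : Fin n → ℤ) = 0 :=
      hm
    have h2 := congrArg (Fintype.linearCombination ℤ fun i => t (i, 1)) hD
    simp only [map_sum, map_smul, map_sub, Fintype.linearCombination_apply_single, one_smul,
      map_zero] at h2
    rw [map_eq_sum, map_inl_eq_zero T f fun i k => by rw [hy, ht, sub_self], zero_add]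
    simp only [he]
    rw [← neg_eq_zero, ← h2, ← Finset.sum_neg_distrib]
    refine Finset.sum_congr rfl fun a _ => ?_
    rw [← smul_neg, neg_sub]
  · let f : Values T →+ (Fin n → ℤ) :=
      (faceBoundary T ∘ₗ LinearMap.snd ℤ (FlagClasses T) ({a // Rep T a} → ℤ)).toAddMonoidHom
    have hfy : ∀ i k, f (univY T i k) = 0 := fun i k => map_zero (faceBoundary T)
    have hfe : ∀ a, f (univE T a) = Pi.single (T.adj a.1.1 a.1.2) 1 - Pi.single a.1.1 1 :=
      faceBoundary_single T
    have hfc : ∀ i l, faceTerm T (fun i k => f (univY T i k)) i l (l + 1) = 0 := fun i l => by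
      simp [faceTerm, hfy]
    -- Minus the basis vector of a tetrahedron, on both of its copies, is a potential whose jumps
    -- across white faces are the values of `faceBoundary`.
    refine (hd.map f).exists_eq_edgeDiff ?_ (fun q => -Pi.single q.1 1) ?_ ?_
    · rw [funext (coboundary_map f F), hF]
      exact funext fun _ => map_zero f
    · refine whiteInv_of_rep T ?_
      rintro ⟨i, ε⟩ l hr
      have hr' := mt (rep_glueOct T (i, ε) l).1 (not_not.2 hr)
      dsimp only at hr hr'
      simp only [map_stdWhite]
      simp only [stdWhite, dif_pos hr, dif_neg hr', hfe, hfc, ite_self]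
      simp only [glueOct]
      abel
    · intro i ε ε' k
      simp only [map_stdBlack]
      simp [stdBlack, hfy]

theorem faceBoundary_mem_range (i : Fin n) (l : Fin 4) :
    (Pi.single (T.adj i l) 1 - Pi.single i 1 : Fin n → ℤ) ∈ LinearMap.range (faceBoundary T) := by
  by_cases hr : Rep T (i, l)
  · exact ⟨_, faceBoundary_single T ⟨_, hr⟩⟩
  · have := faceBoundary_single T ⟨_, (rep_glue T i l).2 hr⟩
    rw [T.adj_adj] at this
    rw [← neg_sub, ← this]
    exact Submodule.neg_mem _ ⟨_, rfl⟩

theorem single_sub_single_mem_range (i j : Fin n) :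
    (Pi.single j 1 - Pi.single i 1 : Fin n → ℤ) ∈ LinearMap.range (faceBoundary T) := by
  induction T.connected i j with
  | refl => simp
  | tail _ h ih =>
    obtain ⟨l, rfl⟩ := h
    rw [← sub_add_sub_cancel]
    exact Submodule.add_mem _ (faceBoundary_mem_range T _ l) ih

/-- Connectedness puts all differences of basis vectors into the range, and these span the vectors
with coordinate sum zero. -/
theorem range_faceBoundary : LinearMap.range (faceBoundary T) =
    LinearMap.ker (Fintype.linearCombination ℤ fun _ : Fin n => (1 : ℤ)) := by
  refine le_antisymm ?_ fun v hv => ?_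
  · rintro _ ⟨z, rfl⟩
    rw [LinearMap.mem_ker, faceBoundary, Fintype.linearCombination_apply ℤ _ z, map_sum]
    refine Finset.sum_eq_zero fun a _ => ?_
    rw [map_smul, map_sub, Fintype.linearCombination_apply_single,
      Fintype.linearCombination_apply_single, sub_self, smul_zero]
  · have hv' : ∑ i, v i = 0 := by simpa [Fintype.linearCombination_apply] using hv
    let o : Fin n := ⟨0, T.pos⟩
    have : v = ∑ i, v i • (Pi.single i 1 - Pi.single o 1 : Fin n → ℤ) := by
      simp only [smul_sub, Finset.sum_sub_distrib, ← Finset.sum_smul, hv', zero_smul, sub_zero]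
      simpa using pi_eq_sum_univ' v
    rw [this]
    exact Submodule.sum_mem _ fun i _ => Submodule.smul_mem _ _ (single_sub_single_mem_range T o i)

/-- The pairing exchanges chosen and unchosen faces, so exactly half of the `4 n` faces are chosen.
-/
theorem card_rep : Fintype.card {a // Rep T a} = 2 * n := by
  have e : {a // Rep T a} ≃ {a // ¬ Rep T a} :=
    { toFun := fun a => ⟨(T.adj a.1.1 a.1.2, T.perm a.1.1 a.1.2 a.1.2), fun h =>
        (rep_glue T a.1.1 a.1.2).1 h a.2⟩
      invFun := fun a => ⟨(T.adj a.1.1 a.1.2, T.perm a.1.1 a.1.2 a.1.2),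
        (rep_glue T a.1.1 a.1.2).2 a.2⟩
      left_inv := fun a => by ext1; simp [T.adj_adj, T.perm_adj]
      right_inv := fun a => by ext1; simp [T.adj_adj, T.perm_adj] }
  have h1 := Fintype.card_congr e
  have h2 := Fintype.card_subtype_compl (Rep T)
  have h3 := Fintype.card_subtype_le (Rep T)
  rw [Fintype.card_prod, Fintype.card_fin, Fintype.card_fin] at h2 h3
  omega

/-- The range is the kernel of a surjection from `ℤ^n` to `ℤ` and has rank `n - 1`; what remains of
`2 n` is `n + 1`. -/
theorem finrank_ker_faceBoundary :
    Module.finrank ℤ (LinearMap.ker (faceBoundary T)) = n + 1 := by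
  have h1 : ∀ {M N : Type} [AddCommGroup M] [AddCommGroup N] [Module.Finite ℤ M] (f : M →ₗ[ℤ] N),
      Module.finrank ℤ (LinearMap.range f) + Module.finrank ℤ (LinearMap.ker f) =
        Module.finrank ℤ M := fun f => by
    rw [← f.quotKerEquivRange.finrank_eq]
    exact Submodule.finrank_quotient_add_finrank _
  have h2 := h1 (faceBoundary T)
  have h3 := h1 (Fintype.linearCombination ℤ fun _ : Fin n => (1 : ℤ))
  have h4 : LinearMap.range (Fintype.linearCombination ℤ fun _ : Fin n => (1 : ℤ)) = ⊤ := by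
    refine LinearMap.range_eq_top.2 fun z => ⟨Pi.single ⟨0, T.pos⟩ z, ?_⟩
    rw [Fintype.linearCombination_apply_single, smul_eq_mul, mul_one]
  rw [range_faceBoundary, Module.finrank_fintype_fun_eq_card, card_rep] at h2
  rw [h4, finrank_top, Module.finrank_self, Module.finrank_fintype_fun_eq_card,
    Fintype.card_fin] at h3
  omega

/-- An abelian group carries only one `ℤ`-module structure, which settles all comparisons of
instances. -/
theorem nonempty_linearEquiv_of_addEquiv {M N : Type} [AddCommGroup M] [AddCommGroup N]
    [Module ℤ M] [Module ℤ N] (e : M ≃+ N) : Nonempty (M ≃ₗ[ℤ] N) := by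
  obtain rfl : ‹Module ℤ M› = AddCommGroup.toIntModule _ := Subsingleton.elim _ _
  obtain rfl : ‹Module ℤ N› = AddCommGroup.toIntModule _ := Subsingleton.elim _ _
  exact ⟨e.toIntLinearEquiv⟩

theorem nonempty_homology_D_equiv : Nonempty (singularHomology 1 T.D ≃ₗ[ℤ]
    (Fin (n + 1) → ℤ) × FlagClasses T) := by
  obtain ⟨e⟩ := nonempty_homology_D_equiv_ker T
  let e₁ : LinearMap.ker (faceBoundary T ∘ₗ
      LinearMap.snd ℤ (FlagClasses T) ({a // Rep T a} → ℤ)) ≃ₗ[ℤ]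
      LinearMap.ker (faceBoundary T) × FlagClasses T :=
    { toFun := fun m => (⟨m.1.2, m.2⟩, m.1.1)
      invFun := fun m => ⟨(m.2, m.1.1), m.1.2⟩
      map_add' := fun _ _ => rfl
      map_smul' := fun _ _ => rfl
      left_inv := fun _ => rfl
      right_inv := fun _ => rfl }
  let e₂ : LinearMap.ker (faceBoundary T) ≃ₗ[ℤ] (Fin (n + 1) → ℤ) :=
    (Module.finBasisOfFinrankEq ℤ _ (finrank_ker_faceBoundary T)).equivFun
  exact nonempty_linearEquiv_of_addEquiv ((e.toAddEquiv.trans e₁.toAddEquiv).trans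
    (e₂.toAddEquiv.prodCongr (AddEquiv.refl _)))

end Block

end

/-! ### Conclusion: comparison through the classes of flags -/

theorem mainTheorem10 (n : ℕ) (T : Triangulation n) :
    Nonempty (singularHomology 1 T.D ≃ₗ[ℤ]
      (Fin (n + 1) → ℤ) × singularCohomology 2 T.dualPolyhedron) := by
  obtain ⟨e⟩ := Block.nonempty_homology_D_equiv T
  obtain ⟨e'⟩ := Block.nonempty_cohomology_dualPolyhedron_equiv T
  exact Block.nonempty_linearEquiv_of_addEquiv (e.toAddEquiv.trans
    ((AddEquiv.refl _).prodCongr e'.symm.toAddEquiv))
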